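/- Let $\mathcal G$ be a connected metric graph with finitely many vertices and finitely many edges (loops and multiple edges are allowed), each edge $e$ being identified with an interval $[0,\ell_e]$, $0<\ell_e<\infty$, or with a half-line $[0,+\infty)$. The space $H^1(\mathcal G)$ consists of the continuous functions $u:\mathcal G\to\mathbb R$ such that $u$ and its weak derivative $u'$ along the edges are in $L^2(\mathcal G)$; let $C_c(\mathcal G)$ be the space of continuous functions with compact support. Let $p>2$ with $p\neq 6$, and let $(W_n)_{n\in\mathbb N},(\rho_n)_{n\in\mathbb N}\subseteq L^\infty(\mathcal G)$ satisfy assumption (H): (i) there is $\bar W\in\mathbb R$ such that $|W_n(x)|\le \bar W$ for all $n$ and almost all $x\in\mathcal G$; (ii) there is $b>0$ such that $0\le\rho_n(x)\le b$ for all $n$ and almost all $x\in\mathcal G$; (iii) there is $a\in(0,b)$ such that for every edge $e$, either $\rho_n\ge a$ a.e. on $e$ for all $n$, or $\rho_n= 0$ a.e. on $e$ for all $n$. Let $(\lambda_n)\subseteq\mathbb R$ and let $(u_n)\subseteq H^1(\mathcal G)$ be such that, for every $n$, $u_n$ is a (weak) solution of $$-u_n''+W_n(x)u_n+\lambda_nu_n=\rho_n(x)|u_n|^{p-2}u_n\quad\text{on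 every edge},$$ with the Kirchhoff condition (the outgoing derivatives of $u_n$ at each vertex sum to $0$), that is, $$\int_{\mathcal G}\big(u_n'\varphi'+(W_n+\lambda_n)u_n\varphi\big)\,dx=\int_{\mathcal G}\rho_n|u_n|^{p-2}u_n\varphi\,dx\qquad\text{for all }\varphi\in H^1(\mathcal G)\cap C_c(\mathcal G).$$ Let the Morse index $m(u_n)\in\mathbb N\cup\{+\infty\}$ be the largest dimension of a subspace of $H^1(\mathcal G)\cap C_c(\mathcal G)$ on which the quadratic form $$Q_n(\varphi)=\int_{\mathcal G}\big(|\varphi'|^2+(W_n+\lambda_n)|\varphi|^2-(p-1)\rho_n|u_n|^{p-2}|\varphi|^2\big)\,dx$$ is negative for every $\varphi\ne0$ ($+\infty$ if there is no largest one). Suppose that, for some $c>0$ and some integer $m^*>0$, $$\int_{\mathcal G}|u_n|^2\,dx=c\quad\text{and}\quad m(u_n)\le m^*\qquad\text{for all }n\in\mathbb N.$$ Then the sequence $(\lambda_n)$ is bounded from above. -/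

import Mathlib

open MeasureTheory Set

open scoped ENNReal ContDiff

noncomputable section

/-- `g` is a weak (distributional) derivative of `f` on the open set `U ⊆ ℝ`. -/
def HasWeakDerivOn (f g : ℝ → ℝ) (U : Set ℝ) : Prop :=
  LocallyIntegrableOn f U ∧ LocallyIntegrableOn g U ∧
    ∀ ψ : ℝ → ℝ, ContDiff ℝ ∞ ψ → HasCompactSupport ψ → tsupport ψ ⊆ U →
      ∫ x in U, f x * deriv ψ x = -∫ x in U, g x * ψ x

/-- Two weak derivatives of the same function on an open set agree almost everywhere. -/
theorem HasWeakDerivOn.ae_eq {f g h : ℝ → ℝ} {U : Set ℝ} (hU : IsOpen U)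
    (hg : HasWeakDerivOn f g U) (hh : HasWeakDerivOn f h U) :
    ∀ᵐ x ∂(volume.restrict U), g x = h x := by
  rw [ae_restrict_iff' hU.measurableSet]
  have key := hU.ae_eq_zero_of_integral_contDiff_smul_eq_zero (μ := volume)
    (f := fun x => g x - h x) (hg.2.1.sub hh.2.1) ?_
  · filter_upwards [key] with x hx hxU using sub_eq_zero.1 (hx hxU)
  · intro ψ hψ hc hs
    have int : ∀ k : ℝ → ℝ, LocallyIntegrableOn k U → Integrable (fun x => k x * ψ x) := by
      intro k hk
      have h1 : IntegrableOn k (tsupport ψ) := hk.integrableOn_compact_subset hs hc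
      have h2 : IntegrableOn (fun x => k x * ψ x) (tsupport ψ) :=
        h1.mul_continuousOn hψ.continuous.continuousOn hc
      refine (integrableOn_iff_integrable_of_support_subset ?_).1 h2
      intro x hx
      exact subset_tsupport ψ (fun h0 => hx (by simp [h0]))
    have full : ∀ k : ℝ → ℝ, ∫ x in U, k x * ψ x = ∫ x, k x * ψ x := by
      intro k
      refine setIntegral_eq_integral_of_forall_compl_eq_zero fun x hx => ?_
      simp [image_eq_zero_of_notMem_tsupport (fun h0 => hx (hs h0))]
    have e : ∫ x in U, g x * ψ x = ∫ x in U, h x * ψ x :=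
      neg_injective ((hg.2.2 ψ hψ hc hs).symm.trans (hh.2.2 ψ hψ hc hs))
    rw [full, full] at e
    have : ∀ x, ψ x • (g x - h x) = g x * ψ x - h x * ψ x := fun x => by
      simp only [smul_eq_mul]; ring
    simp only [this]
    rw [integral_sub (int g hg.2.1) (int h hh.2.1), e, sub_self]

open Classical in
/-- The weak derivative of `f` on the open set `U` (a representative of it, which is unique up to
equality almost everywhere); zero if there is none. -/
def weakDeriv (f : ℝ → ℝ) (U : Set ℝ) : ℝ → ℝ :=
  if h : ∃ g, HasWeakDerivOn f g U then h.choose else 0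

/-- The data of a metric graph with vertex set `V` and edge set `E`; loops and multiple edges are
allowed. The edge `e` is identified with the closed interval `[0, length e]`, or with the half-line
`[0, ∞)` if `length e = ∞`. The endpoint with coordinate `0` is attached to the vertex `tail e`;
if the edge is bounded, the endpoint with coordinate `length e` is attached to the vertex `v` with
`head e = some v`, and a half-line has `head e = none`. -/
structure MetricGraph (V E : Type*) where
  length : E → ℝ≥0∞
  length_pos : ∀ e, 0 < length e
  tail : E → V
  head : E → Option V
  head_eq_none_iff : ∀ e, head e = none ↔ length e = ⊤

namespace MetricGraph

variable {V E : Type*} (G : MetricGraph V E)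

/-- The graph is connected: it has a vertex, and any two vertices are joined by a chain of bounded
edges. -/
def IsConnected : Prop :=
  (SimpleGraph.fromRel fun v w : V => ∃ e, G.tail e = v ∧ G.head e = some w).Connected

/-- The closed interval `[0, length e]` or `[0, ∞)` with which the edge `e` is identified. -/
def interval (e : E) : Set ℝ :=
  {x | 0 ≤ x ∧ ENNReal.ofReal x ≤ G.length e}

/-- The open edge `(0, length e)`. -/
def openInterval (e : E) : Set ℝ :=
  {x | 0 < x ∧ ENNReal.ofReal x < G.length e}

/-- Lebesgue measure on the edge `e`. -/
def edgeMeasure (e : E) : Measure ℝ :=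
  volume.restrict (G.interval e)

/-- A function on the graph is identified with the family `(u e)` of its restrictions to the edges,
where only the values of `u e` on `G.interval e` matter. This is the integral of such a function
over a graph with finitely many edges. -/
def integral [Fintype E] (u : E → ℝ → ℝ) : ℝ :=
  ∑ e, ∫ x, u e x ∂(G.edgeMeasure e)

/-- Continuity on the graph: continuity along every edge, and at every vertex agreement of the
values at all the edge ends attached to it. -/
def IsContinuous (u : E → ℝ → ℝ) : Prop :=
  (∀ e, ContinuousOn (u e) (G.interval e)) ∧
    ∃ value : V → ℝ, ∀ e, u e 0 = value (G.tail e) ∧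
      ∀ v, G.head e = some v → u e (G.length e).toReal = value v

/-- The derivative `u'` along the edges, as a weak derivative. -/
def der (u : E → ℝ → ℝ) (e : E) : ℝ → ℝ :=
  weakDeriv (u e) (G.openInterval e)

/-- Membership in `H¹(G)` for a graph with finitely many edges: `u` is continuous on `G` and, on
every edge, `u` and its weak derivative are square integrable. -/
def MemH1 (u : E → ℝ → ℝ) : Prop :=
  G.IsContinuous u ∧
    ∀ e, MemLp (u e) 2 (G.edgeMeasure e) ∧
      ∃ g, HasWeakDerivOn (u e) g (G.openInterval e) ∧ MemLp g 2 (G.edgeMeasure e)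

/-- Membership in `H¹(G) ∩ C_c(G)` for a graph with finitely many edges, in which a closed set is
compact if and only if it meets every half-line in a bounded set. -/
def IsTestFunction (φ : E → ℝ → ℝ) : Prop :=
  G.MemH1 φ ∧ ∀ e, ∃ R : ℝ, ∀ x ∈ G.interval e, R < x → φ e x = 0

/-- Membership in `L^∞(G)` for a graph with finitely many edges. -/
def MemLInfty (W : E → ℝ → ℝ) : Prop :=
  ∀ e, MemLp (W e) ⊤ (G.edgeMeasure e)

/-- `u` is an `H¹(G)` solution of `-u'' + W u + lam u = ρ |u|^(p-2) u` on the edges, with continuity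
and the Kirchhoff condition at the vertices, in the weak sense. -/
def IsSolution [Fintype E] (p : ℝ) (W ρ : E → ℝ → ℝ) (lam : ℝ) (u : E → ℝ → ℝ) : Prop :=
  G.MemH1 u ∧ ∀ φ, G.IsTestFunction φ →
    G.integral (fun e x => G.der u e x * G.der φ e x + (W e x + lam) * u e x * φ e x) =
      G.integral (fun e x => ρ e x * |u e x| ^ (p - 2) * u e x * φ e x)

/-- The quadratic form of the linearization of the equation at `u`. -/
def quadForm [Fintype E] (p : ℝ) (W ρ : E → ℝ → ℝ) (lam : ℝ) (u φ : E → ℝ → ℝ) : ℝ :=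
  G.integral fun e x => |G.der φ e x| ^ 2 + (W e x + lam) * |φ e x| ^ 2 -
    (p - 1) * ρ e x * |u e x| ^ (p - 2) * |φ e x| ^ 2

/-- The Morse index of `u`: the largest dimension of a finite-dimensional space of functions in
`H¹(G) ∩ C_c(G)` on which the quadratic form is negative definite, or `∞` if there is no largest
one. -/
def morseIndex [Fintype E] (p : ℝ) (W ρ : E → ℝ → ℝ) (lam : ℝ) (u : E → ℝ → ℝ) : ℕ∞ :=
  sSup {m : ℕ∞ | ∃ (k : ℕ) (X : Submodule ℝ (E → ℝ → ℝ)), m = k ∧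
    FiniteDimensional ℝ X ∧ Module.finrank ℝ X = k ∧ (∀ φ ∈ X, G.IsTestFunction φ) ∧
      ∀ φ ∈ X, φ ≠ 0 → G.quadForm p W ρ lam u φ < 0}

/-- The standing assumption on the potentials `W n` and the weights `ρ n`: uniform bounds
`|W n| ≤ Wbar` and `0 ≤ ρ n ≤ b`, and a constant `a ∈ (0, b)` such that on each edge either
`ρ n ≥ a` for all `n`, or `ρ n = 0` for all `n`. All inequalities hold almost everywhere. -/
def AssumptionH (W ρ : ℕ → E → ℝ → ℝ) : Prop :=
  (∀ n, G.MemLInfty (W n)) ∧ (∀ n, G.MemLInfty (ρ n)) ∧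
  (∃ Wbar : ℝ, ∀ n e, ∀ᵐ x ∂(G.edgeMeasure e), |W n e x| ≤ Wbar) ∧
  ∃ b : ℝ, 0 < b ∧
    (∀ n e, ∀ᵐ x ∂(G.edgeMeasure e), 0 ≤ ρ n e x ∧ ρ n e x ≤ b) ∧
    ∃ a : ℝ, 0 < a ∧ a < b ∧ ∀ e,
      (∀ n, ∀ᵐ x ∂(G.edgeMeasure e), a ≤ ρ n e x) ∨
      (∀ n, ∀ᵐ x ∂(G.edgeMeasure e), ρ n e x = 0)

end MetricGraph

end

/-! The proof compares λ with the maximum M of |u|. On a half-line u tends to zero, so M is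
attained. At a maximum point the slope vanishes: inside an edge by Fermat, at a vertex because the
outgoing slopes of sign(u)·u all have the same sign there while Kirchhoff makes their sum zero
(`deriv_eq_zero_of_isMax`). If λ - W̄ > b M^(p-2), then |u| would be strictly convex near that point
and would exceed M; hence λ - W̄ ≤ b M^(p-2), and a large λ forces a large M. For λ > W̄ the same
convexity argument puts the maximum on an edge where ρ ≥ a (`exists_maximal_branch`). The natural
length there is M^(-(p-2)/2).

Case p < 6. A Taylor estimate keeps |u| ≥ M/2 on an arc of natural length, so the mass c is at least
a constant times M^(2-(p-2)/2). The exponent is positive exactly when p < 6, so M, and with it λ, is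
bounded (`exists_lam_bound_of_lt_six`).

Case p > 6. Concentration no longer costs mass, and the Morse index takes over, in two ways. (a) If
M^(p-2) were much larger than λ, then u rescaled at its maximum would nearly solve v'' = -k
|v|^(p-2) v with k ≥ a on a long interval, and would oscillate. Each arc between successive zeros
carries a negative direction of the quadratic form, namely u itself, and more than m such arcs
contradict the index bound. So λ is at least of order M^(p-2) (`exists_sup_bound`). (b) Cut an edge
into cells of length L of order ε'/M², each of mass at most ε'. Test the form with u times a cutoff
living on three consecutive cells. Either the form is negative, which happens for at most 3m
triples, or the middle cell has mass at most A times that of the triple, with A of order 1/(λ L²),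
hence M⁴/λ, hence M^(6-p). Summation bounds the mass of the edge by (2+3m) ε' plus a term that tends
to zero as M grows; for large M the total falls below c (`integral_sq_le_of_morseIndex_le`,
`exists_lam_bound_of_six_lt`).

The form is computed from the equation tested with u η², which expresses its value at u η through ∫
(u η')² and the nonlinear term alone (`integral_quadDensity_eq`). -/

noncomputable section

/-! ### Weak derivatives on an interval of the line. -/

theorem exists_Ioo_subset_of_isCompact {U K : Set ℝ} (hU : IsOpen U) (hc : U.OrdConnected)
    (hne : U.Nonempty) (hK : IsCompact K) (hKU : K ⊆ U) :
    ∃ a b : ℝ, a < b ∧ Icc a b ⊆ U ∧ K ⊆ Ioo a b := by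
  wlog hKn : K.Nonempty generalizing K
  · obtain ⟨x, hx⟩ := hne
    obtain ⟨a, b, h1, h2, _⟩ := this (K := {x}) isCompact_singleton (by simpa using hx) ⟨x, rfl⟩
    refine ⟨a, b, h1, h2, ?_⟩
    rw [not_nonempty_iff_eq_empty.1 hKn]
    exact empty_subset _
  have ha := hKU (hK.sInf_mem hKn)
  have hb := hKU (hK.sSup_mem hKn)
  obtain ⟨ε, hε, h1⟩ := Metric.isOpen_iff.1 hU _ ha
  obtain ⟨δ, hδ, h2⟩ := Metric.isOpen_iff.1 hU _ hb
  have hle : sInf K ≤ sSup K := csInf_le_csSup hKn hK.bddBelow hK.bddAbove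
  refine ⟨sInf K - ε / 2, sSup K + δ / 2, by linarith, ?_, ?_⟩
  · refine hc.out (h1 ?_) (h2 ?_)
    · rw [Metric.mem_ball, Real.dist_eq, abs_lt]; constructor <;> linarith
    · rw [Metric.mem_ball, Real.dist_eq, abs_lt]; constructor <;> linarith
  · intro x hx
    have := csInf_le hK.bddBelow hx
    have := le_csSup hK.bddAbove hx
    constructor <;> linarith

theorem setIntegral_eq_intervalIntegral_of_forall_notMem {U : Set ℝ} {a b : ℝ} (hab : a ≤ b)
    (hU : Icc a b ⊆ U) {k : ℝ → ℝ} (hk : ∀ x, x ∉ Ioo a b → k x = 0) :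
    ∫ x in U, k x = ∫ x in a..b, k x := by
  rw [intervalIntegral.integral_of_le hab, setIntegral_eq_integral_of_forall_compl_eq_zero,
    setIntegral_eq_integral_of_forall_compl_eq_zero]
  · exact fun x hx => hk x fun h => hx (Ioo_subset_Ioc_self h)
  · exact fun x hx => hk x fun h => hx (hU (Ioo_subset_Icc_self h))

theorem MeasureTheory.LocallyIntegrableOn.intervalIntegrable {g : ℝ → ℝ} {U : Set ℝ}
    (hg : LocallyIntegrableOn g U) (hc : U.OrdConnected) {x y : ℝ} (hx : x ∈ U) (hy : y ∈ U) :
    IntervalIntegrable g volume x y :=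
  (hg.integrableOn_compact_subset (hc.uIcc_subset hx hy) isCompact_uIcc).intervalIntegrable

/-- Integration by parts for absolutely continuous functions, on a compact interval that contains
the support of the test function in its interior. -/
theorem HasWeakDerivOn.of_integral {U : Set ℝ} (hU : IsOpen U) (hc : U.OrdConnected)
    {f g : ℝ → ℝ} (hf : ContinuousOn f U) (hg : LocallyIntegrableOn g U)
    (h : ∀ x ∈ U, ∀ y ∈ U, f y - f x = ∫ t in x..y, g t) : HasWeakDerivOn f g U := by
  refine ⟨hf.locallyIntegrableOn hU.measurableSet, hg, fun ψ hψ hcs hs => ?_⟩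
  rcases U.eq_empty_or_nonempty with rfl | hne
  · simp
  obtain ⟨a, b, hab, hI, hK⟩ := exists_Ioo_subset_of_isCompact hU hc hne hcs hs
  have haU := hI (left_mem_Icc.2 hab.le)
  have hbU := hI (right_mem_Icc.2 hab.le)
  have h0 : ∀ x, x ∉ Ioo a b → ψ x = 0 := fun x hx =>
    image_eq_zero_of_notMem_tsupport fun h => hx (hK h)
  have h0' : ∀ x, x ∉ Ioo a b → deriv ψ x = 0 := fun x hx =>
    image_eq_zero_of_notMem_tsupport fun h => hx (hK (tsupport_deriv_subset h))
  rw [setIntegral_eq_intervalIntegral_of_forall_notMem hab.le hI (fun x hx => by simp [h0' x hx]),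
    setIntegral_eq_intervalIntegral_of_forall_notMem hab.le hI (fun x hx => by simp [h0 x hx])]
  have hgi : IntervalIntegrable g volume a b := hg.intervalIntegrable hc haU hbU
  have hac := hgi.absolutelyContinuousOnInterval_intervalIntegral (c := a) (by simp)
  have hψac : AbsolutelyContinuousOnInterval ψ a b :=
    (hψ.of_le (by simp)).contDiffOn.absolutelyContinuousOnInterval
  have key := hac.integral_mul_deriv_eq_deriv_mul hψac
  rw [h0 a (by simp), h0 b (by simp)] at key
  have e1 : ∫ x in a..b, f x * deriv ψ x =
      ∫ x in a..b, ((∫ t in a..x, g t) * deriv ψ x + f a * deriv ψ x) := by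
    refine intervalIntegral.integral_congr fun x hx => ?_
    rw [uIcc_of_le hab.le] at hx
    have := h a haU x (hI hx)
    simp only [← this]; ring
  have e2 : ∫ x in a..b, deriv (fun x => ∫ t in a..x, g t) x * ψ x = ∫ x in a..b, g x * ψ x := by
    refine intervalIntegral.integral_congr_ae ?_
    filter_upwards [hgi.ae_hasDerivAt_integral] with x hx hxm
    rw [(hx (uIoc_subset_uIcc hxm) a (by simp)).deriv]
  have hd : Continuous (deriv ψ) := hψ.continuous_deriv (by simp)
  rw [e1, intervalIntegral.integral_add, key, e2, intervalIntegral.integral_const_mul,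
    intervalIntegral.integral_deriv_eq_sub' ψ rfl
      (fun x _ => (hψ.differentiable (by simp)).differentiableAt) hd.continuousOn,
    h0 a (by simp), h0 b (by simp)]
  · simp
  · exact hd.intervalIntegrable a b |>.continuousOn_mul hac.continuousOn
  · exact (hd.intervalIntegrable a b).const_mul _

theorem MeasureTheory.LocallyIntegrableOn.integrable_mul_of_tsupport_subset {U : Set ℝ}
    {k ψ : ℝ → ℝ} (hk : LocallyIntegrableOn k U) (hψ : Continuous ψ) (hcs : HasCompactSupport ψ)
    (hs : tsupport ψ ⊆ U) : Integrable (fun x => k x * ψ x) := by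
  have h2 : IntegrableOn (fun x => k x * ψ x) (tsupport ψ) :=
    (hk.integrableOn_compact_subset hs hcs).mul_continuousOn hψ.continuousOn hcs
  refine (integrableOn_iff_integrable_of_support_subset fun x hx => ?_).1 h2
  exact subset_tsupport ψ (fun h0 => hx (by simp [h0]))

/-- The du Bois-Reymond argument: subtracting from ψ a multiple of a fixed bump ψ₀ of integral one
leaves a function of integral zero, whose primitive is again a test function. The constant is
therefore ∫ f ψ₀. -/
theorem ae_eq_const_of_hasWeakDerivOn_zero {U : Set ℝ} (hU : IsOpen U) (hc : U.OrdConnected)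
    {f : ℝ → ℝ} (h : HasWeakDerivOn f 0 U) : ∃ c, ∀ᵐ x, x ∈ U → f x = c := by
  rcases U.eq_empty_or_nonempty with rfl | ⟨x₀, hx₀⟩
  · simp
  obtain ⟨ε, hε, hεU⟩ := Metric.nhds_basis_closedBall.mem_iff.1 (hU.mem_nhds hx₀)
  let B : ContDiffBump x₀ := ⟨ε / 2, ε, by linarith, by linarith⟩
  set ψ₀ : ℝ → ℝ := B.normed volume with hψ₀
  have s0 : tsupport ψ₀ ⊆ U := by rw [hψ₀, B.tsupport_normed_eq]; exact hεU
  have c0 : HasCompactSupport ψ₀ := B.hasCompactSupport_normed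
  have d0 : ContDiff ℝ ∞ ψ₀ := B.contDiff_normed
  refine ⟨∫ x in U, f x * ψ₀ x, ?_⟩
  set c := ∫ x in U, f x * ψ₀ x with hcdef
  have key := hU.ae_eq_zero_of_integral_contDiff_smul_eq_zero (μ := volume)
    (f := fun x => f x - c) (h.1.sub (continuousOn_const.locallyIntegrableOn hU.measurableSet)) ?_
  · filter_upwards [key] with x hx hxU using sub_eq_zero.1 (hx hxU)
  intro ψ hψ hcs hs
  have full : ∀ k : ℝ → ℝ, ∀ ψ : ℝ → ℝ, tsupport ψ ⊆ U → ∫ x in U, k x * ψ x = ∫ x, k x * ψ x :=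
    fun k ψ hs => setIntegral_eq_integral_of_forall_compl_eq_zero fun x hx => by
      simp [image_eq_zero_of_notMem_tsupport (fun h0 => hx (hs h0))]
  obtain ⟨a, b, hab, hI, hK⟩ := exists_Ioo_subset_of_isCompact hU hc ⟨x₀, hx₀⟩
    (hcs.union c0) (union_subset hs s0)
  set θ : ℝ → ℝ := fun x => ψ x - (∫ t, ψ t) * ψ₀ x with hθ
  have θ0 : ∀ x, x ∉ Ioo a b → θ x = 0 := fun x hx => by
    simp only [hθ]
    rw [image_eq_zero_of_notMem_tsupport (fun h => hx (hK (Or.inl h))),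
      image_eq_zero_of_notMem_tsupport (fun h => hx (hK (Or.inr h)))]
    simp
  have θd : ContDiff ℝ ∞ θ := hψ.sub (contDiff_const.mul d0)
  have iψ : Integrable ψ := hψ.continuous.integrable_of_hasCompactSupport hcs
  have iψ₀ : Integrable ψ₀ := d0.continuous.integrable_of_hasCompactSupport c0
  have θint : ∫ x, θ x = 0 := by
    simp only [hθ]
    rw [integral_sub iψ (iψ₀.const_mul _), integral_const_mul, B.integral_normed]
    simp
  have θab : ∫ x in a..b, θ x = 0 := by
    rw [← setIntegral_eq_intervalIntegral_of_forall_notMem hab.le (subset_univ _) θ0]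
    simpa using θint
  set Θ : ℝ → ℝ := fun x => ∫ t in a..x, θ t with hΘ
  have Θd : ∀ x, HasDerivAt Θ (θ x) x := fun x =>
    (θd.continuous.integral_hasStrictDerivAt a x).hasDerivAt
  have Θderiv : deriv Θ = θ := funext fun x => (Θd x).deriv
  have ΘC : ContDiff ℝ ∞ Θ := contDiff_infty_iff_deriv.2
    ⟨fun x => (Θd x).differentiableAt, by rw [Θderiv]; exact θd⟩
  have Θs : tsupport Θ ⊆ Icc a b := by
    refine closure_minimal (fun x hx => ?_) isClosed_Icc
    by_contra hx'
    apply hx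
    simp only [mem_Icc, not_and_or, not_le] at hx'
    rcases hx' with hx' | hx'
    · simp only [hΘ]
      rw [intervalIntegral.integral_congr (g := fun _ => 0)]
      · simp
      · intro t ht
        rw [uIcc_of_ge hx'.le] at ht
        exact θ0 t fun h => absurd h.1 (not_lt.2 ht.2)
    · simp only [hΘ]
      rw [← intervalIntegral.integral_add_adjacent_intervals
        (θd.continuous.intervalIntegrable a b) (θd.continuous.intervalIntegrable b x), θab,
        intervalIntegral.integral_congr (g := fun _ => 0)]
      · simp
      · intro t ht
        rw [uIcc_of_le hx'.le] at ht
        exact θ0 t fun h => absurd h.2 (not_lt.2 ht.1)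
  have e := h.2.2 Θ ΘC (HasCompactSupport.intro isCompact_Icc fun x hx =>
    image_eq_zero_of_notMem_tsupport fun h => hx (Θs h)) (Θs.trans hI)
  rw [Θderiv] at e
  simp only [Pi.zero_apply, zero_mul, integral_zero, neg_zero] at e
  have e2 : ∫ x, f x * ψ x - (∫ t, ψ t) * (f x * ψ₀ x) = 0 := by
    have : ∫ x in U, f x * θ x = ∫ x, f x * θ x := full f θ (fun x hx => by
      refine hI (closure_minimal (fun y hy => ?_) isClosed_Icc hx)
      by_contra hy'
      exact hy (θ0 y fun h => hy' (Ioo_subset_Icc_self h)))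
    rw [← e, this]
    congr 1; ext x; simp only [hθ]; ring
  rw [integral_sub (h.1.integrable_mul_of_tsupport_subset hψ.continuous hcs hs)
    ((h.1.integrable_mul_of_tsupport_subset d0.continuous c0 s0).const_mul _), integral_const_mul, ← full f ψ₀ s0,
    ← hcdef] at e2
  have : ∀ x, ψ x • (f x - c) = f x * ψ x - c * ψ x := fun x => by simp only [smul_eq_mul]; ring
  simp only [this]
  rw [integral_sub (h.1.integrable_mul_of_tsupport_subset hψ.continuous hcs hs) (iψ.const_mul _), integral_const_mul]
  linarith

/-- The difference between f and a primitive of g has zero weak derivative, so f is that primitive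
up to a constant. -/
theorem HasWeakDerivOn.exists_continuousOn {U : Set ℝ} (hU : IsOpen U) (hc : U.OrdConnected)
    (hne : U.Nonempty) {f g : ℝ → ℝ} (h : HasWeakDerivOn f g U) :
    ∃ F : ℝ → ℝ, ContinuousOn F U ∧ (∀ᵐ x, x ∈ U → f x = F x) ∧
      ∀ x ∈ U, ∀ y ∈ U, F y - F x = ∫ t in x..y, g t := by
  obtain ⟨x₀, hx₀⟩ := hne
  set G : ℝ → ℝ := fun x => ∫ t in x₀..x, g t with hG
  have hGint : ∀ x ∈ U, ∀ y ∈ U, G y - G x = ∫ t in x..y, g t := fun x hx y hy => by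
    simp only [hG]
    rw [intervalIntegral.integral_interval_sub_left] <;>
    exact h.2.1.intervalIntegrable hc hx₀ ‹_›
  have hGc : ContinuousOn G U := by
    intro x hx
    obtain ⟨a, b, hab, hI, hK⟩ := exists_Ioo_subset_of_isCompact hU hc ⟨x₀, hx₀⟩
      (isCompact_singleton (x := x)) (by simpa using hx)
    have hac := (h.2.1.intervalIntegrable hc (hI (left_mem_Icc.2 hab.le))
      (hI (right_mem_Icc.2 hab.le))).absolutelyContinuousOnInterval_intervalIntegral
        (c := a) (by simp)
    have h1 : ContinuousAt (fun y => G a + ∫ t in a..y, g t) x := by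
      refine continuousAt_const.add (hac.continuousOn.continuousAt ?_)
      rw [uIcc_of_le hab.le]
      exact Icc_mem_nhds (hK rfl).1 (hK rfl).2
    refine (h1.congr ?_).continuousWithinAt
    filter_upwards [hU.mem_nhds hx] with y hy
    rw [← hGint a (hI (left_mem_Icc.2 hab.le)) y hy]; ring
  have hGw : HasWeakDerivOn G g U := HasWeakDerivOn.of_integral hU hc hGc h.2.1 hGint
  have h0 : HasWeakDerivOn (fun x => f x - G x) 0 U := by
    refine ⟨h.1.sub hGw.1, (locallyIntegrable_zero).locallyIntegrableOn U, fun ψ hψ hcs hs => ?_⟩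
    have int : ∀ k : ℝ → ℝ, LocallyIntegrableOn k U → IntegrableOn (fun x => k x * deriv ψ x) U :=
      fun k hk => (hk.integrable_mul_of_tsupport_subset (hψ.continuous_deriv (by simp)) hcs.deriv
        (tsupport_deriv_subset.trans hs)).integrableOn
    simp only [sub_mul]
    rw [integral_sub (int _ h.1) (int _ hGw.1), h.2.2 ψ hψ hcs hs, hGw.2.2 ψ hψ hcs hs]
    simp
  obtain ⟨c, hcc⟩ := ae_eq_const_of_hasWeakDerivOn_zero hU hc h0
  refine ⟨fun x => G x + c, hGc.add continuousOn_const, ?_, fun x hx y hy => ?_⟩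
  · filter_upwards [hcc] with x hx hxU
    have := hx hxU
    linarith
  · rw [← hGint x hx y hy]; ring

theorem HasWeakDerivOn.add {U : Set ℝ} {f f' g g' : ℝ → ℝ} (h : HasWeakDerivOn f g U)
    (h' : HasWeakDerivOn f' g' U) : HasWeakDerivOn (f + f') (g + g') U := by
  refine ⟨h.1.add h'.1, h.2.1.add h'.2.1, fun ψ hψ hcs hs => ?_⟩
  have hd := hψ.continuous_deriv (by simp)
  have hs' := tsupport_deriv_subset.trans hs
  simp only [Pi.add_apply, add_mul]
  rw [integral_add
      (h.1.integrable_mul_of_tsupport_subset hd hcs.deriv hs').integrableOn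
      (h'.1.integrable_mul_of_tsupport_subset hd hcs.deriv hs').integrableOn,
    integral_add
      (h.2.1.integrable_mul_of_tsupport_subset hψ.continuous hcs hs).integrableOn
      (h'.2.1.integrable_mul_of_tsupport_subset hψ.continuous hcs hs).integrableOn,
    h.2.2 ψ hψ hcs hs, h'.2.2 ψ hψ hcs hs]
  ring

theorem HasWeakDerivOn.const_smul {U : Set ℝ} {f g : ℝ → ℝ} (h : HasWeakDerivOn f g U) (c : ℝ) :
    HasWeakDerivOn (c • f) (c • g) U := by
  refine ⟨h.1.smul c, h.2.1.smul c, fun ψ hψ hcs hs => ?_⟩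
  simp only [Pi.smul_apply, smul_eq_mul, mul_assoc]
  rw [integral_const_mul, integral_const_mul, h.2.2 ψ hψ hcs hs]
  ring

theorem HasWeakDerivOn.sub_eq_integral {U : Set ℝ} (hU : IsOpen U) (hc : U.OrdConnected)
    {f g : ℝ → ℝ} (h : HasWeakDerivOn f g U) (hf : ContinuousOn f U) {x y : ℝ} (hx : x ∈ U)
    (hy : y ∈ U) : f y - f x = ∫ t in x..y, g t := by
  obtain ⟨F, hF, hae, hint⟩ := h.exists_continuousOn hU hc ⟨x, hx⟩
  have : EqOn f F U := by
    refine Measure.eqOn_open_of_ae_eq (μ := volume) ?_ hU hf hF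
    rw [Filter.EventuallyEq, ae_restrict_iff' hU.measurableSet]
    exact hae
  rw [this hx, this hy, hint x hx y hy]

theorem continuousOn_primitive_of_isClosed {I : Set ℝ} (hI : IsClosed I) (hc : I.OrdConnected)
    {g : ℝ → ℝ} (hg : LocallyIntegrableOn g I) {x₀ : ℝ} (hx₀ : x₀ ∈ I) :
    ContinuousOn (fun x => ∫ t in x₀..x, g t) I := by
  have hint : ∀ a b, IntervalIntegrable (I.indicator g) volume a b := by
    intro a b
    refine IntegrableOn.intervalIntegrable ?_
    rw [integrableOn_indicator_iff hI.measurableSet]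
    exact hg.integrableOn_compact_subset inter_subset_left
      ((isCompact_uIcc).inter_left hI)
  refine (intervalIntegral.continuous_primitive hint x₀).continuousOn.congr fun x hx => ?_
  refine intervalIntegral.integral_congr fun t ht => ?_
  exact (indicator_of_mem (hc.uIcc_subset hx₀ hx ht) g).symm

/-- Both sides are continuous up to the ends of the edge and agree on a dense part, so the
fundamental theorem extends to the vertices. -/
theorem sub_eq_integral_of_subset_closure {I U : Set ℝ} (hI : IsClosed I) (hc : I.OrdConnected)
    (hU : U.Nonempty) (hUI : U ⊆ I) (hIU : I ⊆ closure U) {f g : ℝ → ℝ} (hf : ContinuousOn f I)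
    (hg : LocallyIntegrableOn g I) (h : ∀ x ∈ U, ∀ y ∈ U, f y - f x = ∫ t in x..y, g t) :
    ∀ x ∈ I, ∀ y ∈ I, f y - f x = ∫ t in x..y, g t := by
  obtain ⟨x₀, hx₀⟩ := hU
  have key : EqOn f (fun x => f x₀ + ∫ t in x₀..x, g t) I := by
    refine EqOn.of_subset_closure (s := U) (fun x hx => ?_) hf (continuousOn_const.add
      (continuousOn_primitive_of_isClosed hI hc hg (hUI hx₀))) hUI hIU
    rw [← h x₀ hx₀ x hx]; ring
  intro x hx y hy
  rw [key hx, key hy, ← intervalIntegral.integral_interval_sub_left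
    (hg.intervalIntegrable hc (hUI hx₀) hy) (hg.intervalIntegrable hc (hUI hx₀) hx)]
  ring

theorem MeasureTheory.MemLp.locallyIntegrableOn {I : Set ℝ} (hI : IsClosed I) {g : ℝ → ℝ}
    {q : ℝ≥0∞} (hq : 1 ≤ q) (hg : MemLp g q (volume.restrict I)) : LocallyIntegrableOn g I :=
  (locallyIntegrableOn_iff_locallyIntegrable_restrict hI).2 (hg.locallyIntegrable hq)

/-! ### Edges of the graph, and H¹ functions on them. -/

namespace MetricGraph

variable {V E : Type*} (G : MetricGraph V E)

theorem isClosed_interval (e : E) : IsClosed (G.interval e) :=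
  isClosed_Ici.inter (isClosed_le ENNReal.continuous_ofReal continuous_const)

theorem isOpen_openInterval (e : E) : IsOpen (G.openInterval e) :=
  isOpen_Ioi.inter (isOpen_lt ENNReal.continuous_ofReal continuous_const)

theorem ordConnected_interval (e : E) : (G.interval e).OrdConnected :=
  ⟨fun _ hx _ hy _ hz => ⟨hx.1.trans hz.1, (ENNReal.ofReal_le_ofReal hz.2).trans hy.2⟩⟩

theorem ordConnected_openInterval (e : E) : (G.openInterval e).OrdConnected :=
  ⟨fun _ hx _ hy _ hz => ⟨hx.1.trans_le hz.1, (ENNReal.ofReal_le_ofReal hz.2).trans_lt hy.2⟩⟩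

theorem openInterval_subset (e : E) : G.openInterval e ⊆ G.interval e :=
  fun _ hx => ⟨hx.1.le, hx.2.le⟩

theorem zero_mem_interval (e : E) : (0 : ℝ) ∈ G.interval e := ⟨le_rfl, by simp⟩

theorem mem_interval_of_le {e : E} {x y : ℝ} (hy : y ∈ G.interval e) (h0 : 0 ≤ x) (hxy : x ≤ y) :
    x ∈ G.interval e :=
  (G.ordConnected_interval e).out (G.zero_mem_interval e) hy ⟨h0, hxy⟩

theorem Ioo_subset_openInterval {e : E} {x y : ℝ} (hx : x ∈ G.interval e)
    (hy : y ∈ G.interval e) : Ioo x y ⊆ G.openInterval e :=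
  fun _ hz => ⟨hx.1.trans_lt hz.1,
    ((ENNReal.ofReal_lt_ofReal_iff (hx.1.trans_lt (hz.1.trans hz.2))).2 hz.2).trans_le hy.2⟩

theorem Icc_subset_interval {e : E} {x y : ℝ} (hx : x ∈ G.interval e)
    (hy : y ∈ G.interval e) : Icc x y ⊆ G.interval e :=
  (G.ordConnected_interval e).out hx hy

theorem exists_pos_mem_interval (e : E) : ∃ x ∈ G.interval e, 0 < x := by
  obtain ⟨r, hr, hr'⟩ := ENNReal.lt_iff_exists_nnreal_btwn.1 (G.length_pos e)
  exact ⟨r, ⟨r.2, by simpa using hr'.le⟩, by exact_mod_cast hr⟩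

theorem openInterval_nonempty (e : E) : (G.openInterval e).Nonempty := by
  obtain ⟨x, hx, h0⟩ := G.exists_pos_mem_interval e
  exact ⟨x / 2, G.Ioo_subset_openInterval (G.zero_mem_interval e) hx ⟨by linarith, by linarith⟩⟩

theorem interval_subset_closure (e : E) : G.interval e ⊆ closure (G.openInterval e) := by
  intro x hx
  obtain ⟨y, hy⟩ := G.openInterval_nonempty e
  have hy' := G.openInterval_subset e hy
  rcases lt_trichotomy x y with h | rfl | h
  · refine closure_mono (G.Ioo_subset_openInterval hx hy') ?_
    rw [closure_Ioo h.ne]; exact left_mem_Icc.2 h.le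
  · exact subset_closure hy
  · refine closure_mono (G.Ioo_subset_openInterval hy' hx) ?_
    rw [closure_Ioo h.ne]; exact right_mem_Icc.2 h.le

theorem length_mem_interval {e : E} (h : G.length e ≠ ⊤) : (G.length e).toReal ∈ G.interval e :=
  ⟨ENNReal.toReal_nonneg, by rw [ENNReal.ofReal_toReal h]⟩

theorem le_toReal_length {e : E} {x : ℝ} (hx : x ∈ G.interval e) (h : G.length e ≠ ⊤) :
    x ≤ (G.length e).toReal :=
  (ENNReal.ofReal_le_iff_le_toReal h).1 hx.2

theorem interval_eq_Icc {e : E} (h : G.length e ≠ ⊤) :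
    G.interval e = Icc 0 (G.length e).toReal :=
  Subset.antisymm (fun _ hx => ⟨hx.1, G.le_toReal_length hx h⟩)
    (G.Icc_subset_interval (G.zero_mem_interval e) (G.length_mem_interval h))

theorem interval_eq_Ici {e : E} (h : G.length e = ⊤) : G.interval e = Ici 0 :=
  Subset.antisymm (fun _ hx => hx.1) fun _ hx => ⟨hx, by simp [h]⟩

theorem openInterval_ae_eq (e : E) : G.openInterval e =ᵐ[volume] G.interval e := by
  have : G.interval e ⊆ G.openInterval e ∪ ({0, (G.length e).toReal} : Set ℝ) := by
    intro x hx
    by_cases h0 : x = 0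
    · exact Or.inr (by simp [h0])
    by_cases h1 : ENNReal.ofReal x < G.length e
    · exact Or.inl ⟨lt_of_le_of_ne hx.1 (Ne.symm h0), h1⟩
    · refine Or.inr (Or.inr ?_)
      rw [← le_antisymm hx.2 (not_lt.1 h1), ENNReal.toReal_ofReal hx.1]; rfl
  refine (G.openInterval_subset e).eventuallyLE.antisymm ?_
  refine this.eventuallyLE.trans (union_ae_eq_left_of_ae_eq_empty
    (ae_eq_empty.2 ((Set.toFinite _).measure_zero _))).le

theorem edgeMeasure_eq (e : E) : G.edgeMeasure e = volume.restrict (G.openInterval e) :=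
  (Measure.restrict_congr_set (G.openInterval_ae_eq e)).symm

theorem ae_edgeMeasure_iff {e : E} {P : ℝ → Prop} :
    (∀ᵐ x ∂(G.edgeMeasure e), P x) ↔ ∀ᵐ x, x ∈ G.interval e → P x :=
  ae_restrict_iff' (G.isClosed_interval e).measurableSet

variable {G}

theorem MemH1.continuousOn {u : E → ℝ → ℝ} (hu : G.MemH1 u) (e : E) :
    ContinuousOn (u e) (G.interval e) := hu.1.1 e

theorem MemH1.hasWeakDerivOn {u : E → ℝ → ℝ} (hu : G.MemH1 u) (e : E) :
    HasWeakDerivOn (u e) (G.der u e) (G.openInterval e) := by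
  obtain ⟨g, hg, _⟩ := (hu.2 e).2
  have h : ∃ g, HasWeakDerivOn (u e) g (G.openInterval e) := ⟨g, hg⟩
  rw [der, weakDeriv, dif_pos h]
  exact h.choose_spec

theorem MemH1.memLp_der {u : E → ℝ → ℝ} (hu : G.MemH1 u) (e : E) :
    MemLp (G.der u e) 2 (G.edgeMeasure e) := by
  obtain ⟨g, hg, hg2⟩ := (hu.2 e).2
  refine (memLp_congr_ae ?_).1 hg2
  rw [edgeMeasure_eq]
  exact hg.ae_eq (G.isOpen_openInterval e) (hu.hasWeakDerivOn e)

theorem MemH1.sub_eq_integral {u : E → ℝ → ℝ} (hu : G.MemH1 u) (e : E) :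
    ∀ x ∈ G.interval e, ∀ y ∈ G.interval e, u e y - u e x = ∫ t in x..y, G.der u e t :=
  sub_eq_integral_of_subset_closure (G.isClosed_interval e) (G.ordConnected_interval e)
    (G.openInterval_nonempty e) (G.openInterval_subset e) (G.interval_subset_closure e)
    (hu.continuousOn e)
    ((hu.memLp_der e).locallyIntegrableOn (G.isClosed_interval e) (by norm_num))
    fun _ hx _ hy => (hu.hasWeakDerivOn e).sub_eq_integral (G.isOpen_openInterval e)
      (G.ordConnected_openInterval e) ((hu.continuousOn e).mono (G.openInterval_subset e)) hx hy

/-- The tool by which every explicit test function is recognized. `der` is an arbitrarily chosen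
representative, so it agrees with the prescribed derivative only almost everywhere. -/
theorem isTestFunction_of_integral {φ h : E → ℝ → ℝ} (hc : G.IsContinuous φ)
    (hh : ∀ e, MemLp (h e) 2 (G.edgeMeasure e))
    (hint : ∀ e, ∀ x ∈ G.openInterval e, ∀ y ∈ G.openInterval e, φ e y - φ e x = ∫ t in x..y, h e t)
    (hR : ∀ e, ∃ R : ℝ, ∀ x ∈ G.interval e, R < x → φ e x = 0) :
    G.IsTestFunction φ ∧ ∀ e, G.der φ e =ᵐ[G.edgeMeasure e] h e := by
  have hw : ∀ e, HasWeakDerivOn (φ e) (h e) (G.openInterval e) := fun e =>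
    HasWeakDerivOn.of_integral (G.isOpen_openInterval e) (G.ordConnected_openInterval e)
      ((hc.1 e).mono (G.openInterval_subset e))
      (((hh e).locallyIntegrableOn (G.isClosed_interval e) (by norm_num)).mono_set
        (G.openInterval_subset e)) (hint e)
  have hL : ∀ e, MemLp (φ e) 2 (G.edgeMeasure e) := by
    intro e
    obtain ⟨R, hR⟩ := hR e
    have hK : IsCompact (G.interval e ∩ Icc 0 R) := isCompact_Icc.inter_left (G.isClosed_interval e)
    obtain ⟨C, hC⟩ := hK.exists_bound_of_continuousOn ((hc.1 e).mono inter_subset_left)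
    have h1 : MemLp (φ e) 2 (volume.restrict (G.interval e ∩ Icc 0 R)) := by
      have : IsFiniteMeasure (volume.restrict (G.interval e ∩ Icc 0 R)) :=
        ⟨by simpa using hK.measure_lt_top (μ := volume)⟩
      refine MemLp.of_bound (((hc.1 e).mono inter_subset_left).aestronglyMeasurable
        hK.measurableSet) C ?_
      rw [ae_restrict_iff' hK.measurableSet]
      exact ae_of_all _ hC
    rw [← memLp_indicator_iff_restrict hK.measurableSet] at h1
    rw [edgeMeasure, ← memLp_indicator_iff_restrict (G.isClosed_interval e).measurableSet]
    convert h1 using 1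
    ext x
    by_cases hx : x ∈ G.interval e
    · by_cases hxR : x ≤ R
      · rw [indicator_of_mem hx, indicator_of_mem (show x ∈ G.interval e ∩ Icc 0 R from ⟨hx, hx.1, hxR⟩)]
      · rw [indicator_of_mem hx, indicator_of_notMem (fun h => hxR h.2.2), hR x hx (not_le.1 hxR)]
    · rw [indicator_of_notMem hx, indicator_of_notMem (fun h => hx h.1)]
  have hH : G.MemH1 φ := ⟨hc, fun e => ⟨hL e, h e, hw e, hh e⟩⟩
  refine ⟨⟨hH, hR⟩, fun e => ?_⟩
  rw [edgeMeasure_eq]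
  exact (hH.hasWeakDerivOn e).ae_eq (G.isOpen_openInterval e) (hw e)

/-! ### Test functions supported in one arc of an edge. -/

variable (G) in
/-- `F` vanishes at the ends of the arc `[s, t]` of the edge `e`, and has derivative `H` there. -/
structure IsArcFunction (e : E) (s t : ℝ) (F H : ℝ → ℝ) : Prop where
  left_mem : s ∈ G.interval e
  right_mem : t ∈ G.interval e
  lt : s < t
  continuousOn : ContinuousOn F (Icc s t)
  continuousOn_deriv : ContinuousOn H (Icc s t)
  left_eq : F s = 0
  right_eq : F t = 0
  sub_eq : ∀ x ∈ Icc s t, ∀ y ∈ Icc s t, F y - F x = ∫ z in x..y, H z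

open Classical in
/-- The function on the graph which is `F` on the arc `(s, t)` of the edge `e`, and zero
elsewhere. -/
def arc (e : E) (s t : ℝ) (F : ℝ → ℝ) : E → ℝ → ℝ := Pi.single e ((Ioo s t).indicator F)

theorem arc_same (e : E) (s t : ℝ) (F : ℝ → ℝ) : arc e s t F e = (Ioo s t).indicator F := by
  simp [arc]

theorem arc_of_ne {e e' : E} (h : e' ≠ e) (s t : ℝ) (F : ℝ → ℝ) : arc e s t F e' = 0 := by
  simp [arc, h]

theorem integral_indicator_Ioo_eq {s t x y : ℝ} {F H : ℝ → ℝ} (hst : s < t)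
    (hH : ContinuousOn H (Icc s t)) (hs : F s = 0) (ht : F t = 0)
    (h : ∀ x ∈ Icc s t, ∀ y ∈ Icc s t, F y - F x = ∫ z in x..y, H z) :
    (Ioo s t).indicator F y - (Ioo s t).indicator F x = ∫ z in x..y, (Ioo s t).indicator H z := by
  have hi : ∀ a b, IntervalIntegrable ((Ioo s t).indicator H) volume a b := fun a b => by
    have : Integrable ((Ioo s t).indicator H) := by
      rw [integrable_indicator_iff measurableSet_Ioo]
      exact (hH.integrableOn_compact isCompact_Icc).mono_set Ioo_subset_Icc_self
    exact this.intervalIntegrable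
  have key : ∀ y, (Ioo s t).indicator F y = ∫ z in s..y, (Ioo s t).indicator H z := by
    have h1 : ∀ y ∈ Icc s t, F y = ∫ z in s..y, (Ioo s t).indicator H z := by
      intro y hy
      have := h s (left_mem_Icc.2 hst.le) y hy
      rw [hs, sub_zero] at this
      rw [this, intervalIntegral.integral_of_le hy.1, intervalIntegral.integral_of_le hy.1,
        integral_Ioc_eq_integral_Ioo, integral_Ioc_eq_integral_Ioo]
      refine setIntegral_congr_fun measurableSet_Ioo fun z hz => ?_
      rw [indicator_of_mem (show z ∈ Ioo s t from ⟨hz.1, hz.2.trans_le hy.2⟩)]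
    intro y
    by_cases hy : y ∈ Ioo s t
    · rw [indicator_of_mem hy, h1 y (Ioo_subset_Icc_self hy)]
    rw [indicator_of_notMem hy]
    rcases le_or_gt y s with hys | hys
    · rw [intervalIntegral.integral_congr (g := fun _ => 0)]
      · simp
      · intro z hz
        rw [uIcc_of_ge hys] at hz
        exact indicator_of_notMem (fun h => absurd h.1 (not_lt.2 hz.2)) _
    · have hty : t ≤ y := not_lt.1 fun h => hy ⟨hys, h⟩
      rw [← intervalIntegral.integral_add_adjacent_intervals (hi s t) (hi t y),
        ← h1 t (right_mem_Icc.2 hst.le), ht,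
        intervalIntegral.integral_congr (a := t) (b := y) (g := fun _ => 0)]
      · simp
      · intro z hz
        rw [uIcc_of_le hty] at hz
        exact indicator_of_notMem (fun h => absurd h.2 (not_lt.2 hz.1)) _
  rw [key y, key x, intervalIntegral.integral_interval_sub_left (hi _ _) (hi _ _)]

/-- Since F vanishes at both ends of the arc, its extension by zero is continuous, even when an end
is a vertex: every vertex value is zero. -/
theorem IsArcFunction.isTestFunction {e : E} {s t : ℝ} {F H : ℝ → ℝ}
    (h : G.IsArcFunction e s t F H) :
    G.IsTestFunction (arc e s t F) ∧
      ∀ e', G.der (arc e s t F) e' =ᵐ[G.edgeMeasure e'] arc e s t H e' := by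
  have hcont : Continuous ((Ioo s t).indicator F) := by
    have : (Ioo s t).indicator F = fun x => F (projIcc s t h.lt.le x) := by
      ext x
      by_cases hx : x ∈ Ioo s t
      · rw [indicator_of_mem hx, projIcc_of_mem h.lt.le (Ioo_subset_Icc_self hx)]
      rw [indicator_of_notMem hx]
      rcases le_or_gt x s with h1 | h1
      · rw [projIcc_of_le_left _ h1, h.left_eq]
      · rw [projIcc_of_right_le _ (not_lt.1 fun h2 => hx ⟨h1, h2⟩), h.right_eq]
    rw [this]
    exact (continuousOn_iff_continuous_domRestrict.1 h.continuousOn).comp continuous_projIcc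
  refine isTestFunction_of_integral ⟨fun e' => ?_, 0, fun e' => ⟨?_, fun v hv => ?_⟩⟩ (fun e' => ?_)
    (fun e' x _ y _ => ?_) fun e' => ⟨t, fun x _ hx => ?_⟩
  all_goals by_cases he : e' = e
  any_goals subst he; simp only [arc_same]
  any_goals simp only [arc_of_ne he]
  · exact hcont.continuousOn
  · exact continuousOn_const
  · exact indicator_of_notMem (fun h' => absurd h'.1 (not_lt.2 h.left_mem.1)) _
  · rfl
  · refine indicator_of_notMem (fun h' => absurd h'.2 (not_lt.2 (G.le_toReal_length h.right_mem ?_))) _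
    intro h0
    rw [(G.head_eq_none_iff _).2 h0] at hv
    exact absurd hv (by simp)
  · rfl
  · obtain ⟨C, hC⟩ := isCompact_Icc.exists_bound_of_continuousOn h.continuousOn_deriv
    have h1 : MemLp ((Ioo s t).indicator H) 2 volume := by
      rw [memLp_indicator_iff_restrict measurableSet_Ioo]
      have : IsFiniteMeasure (volume.restrict (Ioo s t)) := ⟨by simp⟩
      refine MemLp.of_bound ((h.continuousOn_deriv.mono Ioo_subset_Icc_self).aestronglyMeasurable
        measurableSet_Ioo) C ?_
      rw [ae_restrict_iff' measurableSet_Ioo]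
      exact ae_of_all _ fun x hx => hC x (Ioo_subset_Icc_self hx)
    exact h1.mono_measure Measure.restrict_le_self
  · exact MemLp.zero
  · exact integral_indicator_Ioo_eq h.lt h.continuousOn_deriv h.left_eq h.right_eq h.sub_eq
  · simp
  · exact indicator_of_notMem (fun h' => absurd h'.2 (not_lt.2 hx.le)) _
  · rfl

theorem setIntegral_indicator_Ioo {e : E} {s t : ℝ} (hs : s ∈ G.interval e)
    (ht : t ∈ G.interval e) (k : ℝ → ℝ) :
    ∫ x, (Ioo s t).indicator k x ∂(G.edgeMeasure e) = ∫ x in Ioo s t, k x := by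
  rw [integral_indicator measurableSet_Ioo, edgeMeasure, Measure.restrict_restrict measurableSet_Ioo,
    inter_eq_left.2 (Ioo_subset_Icc_self.trans (G.Icc_subset_interval hs ht))]

theorem integral_eq_of_arc [Fintype E] {e : E} {s t : ℝ} (hs : s ∈ G.interval e)
    (ht : t ∈ G.interval e) {k : E → ℝ → ℝ} {K : ℝ → ℝ}
    (hk : ∀ e', k e' =ᵐ[G.edgeMeasure e'] arc e s t K e') :
    G.integral k = ∫ x in Ioo s t, K x := by
  rw [MetricGraph.integral, Finset.sum_eq_single e]
  · rw [integral_congr_ae (hk e), arc_same, setIntegral_indicator_Ioo hs ht]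
  · intro e' _ he
    rw [integral_congr_ae (hk e'), arc_of_ne he]
    simp
  · simp

theorem IsArcFunction.weak_form [Fintype E] {e : E} {s t : ℝ} {F H : ℝ → ℝ}
    (h : G.IsArcFunction e s t F H) {p lam : ℝ} {W ρ u : E → ℝ → ℝ}
    (hu : G.IsSolution p W ρ lam u) :
    ∫ x in Ioo s t, (G.der u e x * H x + (W e x + lam) * u e x * F x) =
      ∫ x in Ioo s t, ρ e x * |u e x| ^ (p - 2) * u e x * F x := by
  have key := hu.2 _ h.isTestFunction.1
  rw [integral_eq_of_arc h.left_mem h.right_mem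
      (K := fun x => G.der u e x * H x + (W e x + lam) * u e x * F x),
    integral_eq_of_arc h.left_mem h.right_mem
      (K := fun x => ρ e x * |u e x| ^ (p - 2) * u e x * F x)] at key
  · exact key
  · intro e'
    by_cases he : e' = e
    · subst he
      refine ae_of_all _ fun x => ?_
      simp only [arc_same, indicator_apply]
      split_ifs <;> simp
    · simp only [arc_of_ne he]
      exact ae_of_all _ fun x => by simp
  · intro e'
    filter_upwards [h.isTestFunction.2 e'] with x hx
    rw [hx]
    by_cases he : e' = e
    · subst he
      simp only [arc_same, indicator_apply]
      split_ifs <;> simp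
    · simp [arc_of_ne he]

end MetricGraph

theorem sq_sum_of_mul_eq_zero {ι : Type*} (S : Finset ι) (a : ι → ℝ)
    (h : ∀ i ∈ S, ∀ j ∈ S, i ≠ j → a i * a j = 0) : (∑ i ∈ S, a i) ^ 2 = ∑ i ∈ S, a i ^ 2 := by
  rw [sq, Finset.sum_mul_sum]
  refine Finset.sum_congr rfl fun i hi => ?_
  rw [Finset.sum_eq_single i (fun j hj hji => h i hi j hj hji.symm) fun h => absurd hi h, sq]

/-! ### Linear combinations of test functions, and regularity of solutions. -/

namespace MetricGraph

variable {V E : Type*} {G : MetricGraph V E}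

theorem IsContinuous.add {u v : E → ℝ → ℝ} (hu : G.IsContinuous u) (hv : G.IsContinuous v) :
    G.IsContinuous (u + v) := by
  obtain ⟨hu, a, ha⟩ := hu
  obtain ⟨hv, b, hb⟩ := hv
  refine ⟨fun e => (hu e).add (hv e), a + b, fun e => ⟨?_, fun v hv => ?_⟩⟩
  · simp [(ha e).1, (hb e).1]
  · simp [(ha e).2 v hv, (hb e).2 v hv]

theorem IsContinuous.smul {u : E → ℝ → ℝ} (hu : G.IsContinuous u) (c : ℝ) :
    G.IsContinuous (c • u) := by
  obtain ⟨hu, a, ha⟩ := hu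
  refine ⟨fun e => (hu e).const_smul c, c • a, fun e => ⟨?_, fun v hv => ?_⟩⟩
  · simp [(ha e).1]
  · simp [(ha e).2 v hv]

theorem IsTestFunction.add {φ ψ : E → ℝ → ℝ} (hφ : G.IsTestFunction φ)
    (hψ : G.IsTestFunction ψ) : G.IsTestFunction (φ + ψ) ∧
      ∀ e, G.der (φ + ψ) e =ᵐ[G.edgeMeasure e] G.der φ e + G.der ψ e := by
  have hw : ∀ e, HasWeakDerivOn ((φ + ψ) e) (G.der φ e + G.der ψ e) (G.openInterval e) :=
    fun e => (hφ.1.hasWeakDerivOn e).add (hψ.1.hasWeakDerivOn e)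
  have h : G.MemH1 (φ + ψ) := ⟨hφ.1.1.add hψ.1.1, fun e => ⟨(hφ.1.2 e).1.add (hψ.1.2 e).1,
    _, hw e, (hφ.1.memLp_der e).add (hψ.1.memLp_der e)⟩⟩
  refine ⟨⟨h, fun e => ?_⟩, fun e => ?_⟩
  · obtain ⟨R, hR⟩ := hφ.2 e
    obtain ⟨R', hR'⟩ := hψ.2 e
    refine ⟨max R R', fun x hx hxR => ?_⟩
    simp [hR x hx ((le_max_left _ _).trans_lt hxR), hR' x hx ((le_max_right _ _).trans_lt hxR)]
  · rw [edgeMeasure_eq]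
    exact (h.hasWeakDerivOn e).ae_eq (G.isOpen_openInterval e) (hw e)

theorem IsTestFunction.smul {φ : E → ℝ → ℝ} (hφ : G.IsTestFunction φ) (c : ℝ) :
    G.IsTestFunction (c • φ) ∧ ∀ e, G.der (c • φ) e =ᵐ[G.edgeMeasure e] c • G.der φ e := by
  have hw : ∀ e, HasWeakDerivOn ((c • φ) e) (c • G.der φ e) (G.openInterval e) :=
    fun e => (hφ.1.hasWeakDerivOn e).const_smul c
  have h : G.MemH1 (c • φ) := ⟨hφ.1.1.smul c, fun e => ⟨(hφ.1.2 e).1.const_smul c,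
    _, hw e, (hφ.1.memLp_der e).const_smul c⟩⟩
  refine ⟨⟨h, fun e => ?_⟩, fun e => ?_⟩
  · obtain ⟨R, hR⟩ := hφ.2 e
    exact ⟨R, fun x hx hxR => by simp [hR x hx hxR]⟩
  · rw [edgeMeasure_eq]
    exact (h.hasWeakDerivOn e).ae_eq (G.isOpen_openInterval e) (hw e)

theorem isTestFunction_zero :
    G.IsTestFunction 0 ∧ ∀ e, G.der 0 e =ᵐ[G.edgeMeasure e] 0 :=
  isTestFunction_of_integral (h := 0)
    ⟨fun _ => continuousOn_const, 0, fun _ => ⟨rfl, fun _ _ => rfl⟩⟩ (fun _ => MemLp.zero)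
    (by simp) fun _ => ⟨0, by simp⟩

theorem isTestFunction_sum {ι : Type*} (S : Finset ι) (c : ι → ℝ) {φ h : ι → E → ℝ → ℝ}
    (hφ : ∀ i, G.IsTestFunction (φ i) ∧ ∀ e, G.der (φ i) e =ᵐ[G.edgeMeasure e] h i e) :
    G.IsTestFunction (∑ i ∈ S, c i • φ i) ∧
      ∀ e, G.der (∑ i ∈ S, c i • φ i) e =ᵐ[G.edgeMeasure e] fun x => ∑ i ∈ S, c i * h i e x := by
  classical
  induction S using Finset.induction_on with
  | empty =>
    simp only [Finset.sum_empty]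
    exact isTestFunction_zero
  | insert a S ha ih =>
    rw [Finset.sum_insert ha]
    have h1 := (hφ a).1.smul (c a)
    have h2 := h1.1.add ih.1
    refine ⟨h2.1, fun e => ?_⟩
    filter_upwards [h2.2 e, h1.2 e, ih.2 e, (hφ a).2 e] with x e1 e2 e3 e4
    rw [e1, Pi.add_apply, e2, e3, Finset.sum_insert ha, Pi.smul_apply, e4, smul_eq_mul]

theorem MemLInfty.locallyIntegrableOn {W : E → ℝ → ℝ} (hW : G.MemLInfty W) (e : E) :
    LocallyIntegrableOn (W e) (G.interval e) :=
  (hW e).locallyIntegrableOn (G.isClosed_interval e) (by simp)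

theorem continuousOn_abs_rpow {u : ℝ → ℝ} {I : Set ℝ} (hu : ContinuousOn u I) {q : ℝ}
    (hq : 0 ≤ q) : ContinuousOn (fun x => |u x| ^ q) I :=
  hu.abs.rpow_const fun _ _ => Or.inr hq

theorem locallyIntegrableOn_linear_part {W u : E → ℝ → ℝ} (hW : G.MemLInfty W) (lam : ℝ) {e : E}
    (hu : ContinuousOn (u e) (G.interval e)) :
    LocallyIntegrableOn (fun x => (W e x + lam) * u e x) (G.interval e) :=
  LocallyIntegrableOn.mul_continuousOn ((hW.locallyIntegrableOn e).add
    (continuousOn_const.locallyIntegrableOn (G.isClosed_interval e).measurableSet)) hu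
    (G.isClosed_interval e).isLocallyClosed

theorem locallyIntegrableOn_power_part {ρ u : E → ℝ → ℝ} (hρ : G.MemLInfty ρ) {p : ℝ} (hp : 2 < p)
    {e : E} (hu : ContinuousOn (u e) (G.interval e)) :
    LocallyIntegrableOn (fun x => ρ e x * |u e x| ^ (p - 2)) (G.interval e) :=
  LocallyIntegrableOn.mul_continuousOn (hρ.locallyIntegrableOn e)
    (continuousOn_abs_rpow hu (by linarith)) (G.isClosed_interval e).isLocallyClosed

theorem integrableOn_mul_of_continuousOn {e : E} {s t : ℝ} (hs : s ∈ G.interval e)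
    (ht : t ∈ G.interval e) {k F : ℝ → ℝ} (hk : LocallyIntegrableOn k (G.interval e))
    (hF : ContinuousOn F (Icc s t)) : IntegrableOn (fun x => k x * F x) (Ioo s t) :=
  ((hk.integrableOn_compact_subset (G.Icc_subset_interval hs ht) isCompact_Icc).mul_continuousOn hF
    isCompact_Icc).mono_set Ioo_subset_Icc_self

/-- The second derivative of a solution of the equation. -/
def forcing (p : ℝ) (W ρ : E → ℝ → ℝ) (lam : ℝ) (u : E → ℝ → ℝ) (e : E) (x : ℝ) : ℝ :=
  (W e x + lam) * u e x - ρ e x * |u e x| ^ (p - 2) * u e x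

variable (G) in
/-- `d` is a continuous representative of the derivative of the solution `u`. -/
structure IsClassicalDeriv (p : ℝ) (W ρ : E → ℝ → ℝ) (lam : ℝ) (u d : E → ℝ → ℝ) : Prop where
  locallyIntegrableOn : ∀ e, LocallyIntegrableOn (forcing p W ρ lam u e) (G.interval e)
  continuousOn : ∀ e, ContinuousOn (d e) (G.interval e)
  ae_eq : ∀ e, G.der u e =ᵐ[G.edgeMeasure e] d e
  sub_eq : ∀ e, ∀ x ∈ G.interval e, ∀ y ∈ G.interval e, u e y - u e x = ∫ t in x..y, d e t
  sub_eq' : ∀ e, ∀ x ∈ G.interval e, ∀ y ∈ G.interval e,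
    d e y - d e x = ∫ t in x..y, forcing p W ρ lam u e t

/-- Smooth functions supported inside one edge are admissible in the weak form, which then says that
the second weak derivative of u is the forcing. -/
theorem IsSolution.hasWeakDerivOn_der [Fintype E] {p lam : ℝ} {W ρ u : E → ℝ → ℝ} (hp : 2 < p)
    (hW : G.MemLInfty W) (hρ : G.MemLInfty ρ) (hu : G.IsSolution p W ρ lam u) (e : E) :
    HasWeakDerivOn (G.der u e) (forcing p W ρ lam u e) (G.openInterval e) := by
  have l1 := locallyIntegrableOn_linear_part hW lam (hu.1.continuousOn e)
  have l2 := (locallyIntegrableOn_power_part hρ hp (hu.1.continuousOn e)).mul_continuousOn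
    (hu.1.continuousOn e) (G.isClosed_interval e).isLocallyClosed
  have l3 := (hu.1.memLp_der e).locallyIntegrableOn (G.isClosed_interval e) (by norm_num)
  have hf : LocallyIntegrableOn (forcing p W ρ lam u e) (G.interval e) := l1.sub l2
  refine ⟨l3.mono_set (G.openInterval_subset e), hf.mono_set (G.openInterval_subset e),
    fun ψ hψ hcs hs => ?_⟩
  obtain ⟨s, t, hst, hI, hK⟩ := exists_Ioo_subset_of_isCompact (G.isOpen_openInterval e)
    (G.ordConnected_openInterval e) (G.openInterval_nonempty e) hcs hs
  have hs' := G.openInterval_subset e (hI (left_mem_Icc.2 hst.le))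
  have ht' := G.openInterval_subset e (hI (right_mem_Icc.2 hst.le))
  have h0 : ∀ x, x ∉ Ioo s t → ψ x = 0 := fun x hx =>
    image_eq_zero_of_notMem_tsupport fun h => hx (hK h)
  have h0' : ∀ x, x ∉ Ioo s t → deriv ψ x = 0 := fun x hx =>
    image_eq_zero_of_notMem_tsupport fun h => hx (hK (tsupport_deriv_subset h))
  have hd : Continuous (deriv ψ) := hψ.continuous_deriv (by simp)
  have harc : G.IsArcFunction e s t ψ (deriv ψ) :=
    ⟨hs', ht', hst, hψ.continuous.continuousOn, hd.continuousOn, h0 s (by simp), h0 t (by simp),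
      fun x _ y _ => (intervalIntegral.integral_deriv_eq_sub' ψ rfl
        (fun x _ => (hψ.differentiable (by simp)).differentiableAt) hd.continuousOn).symm⟩
  rw [setIntegral_eq_intervalIntegral_of_forall_notMem hst.le hI (fun x hx => by simp [h0' x hx]),
    setIntegral_eq_intervalIntegral_of_forall_notMem hst.le hI (fun x hx => by simp [h0 x hx]),
    intervalIntegral.integral_of_le hst.le, intervalIntegral.integral_of_le hst.le,
    integral_Ioc_eq_integral_Ioo, integral_Ioc_eq_integral_Ioo]
  have key := harc.weak_form hu
  have i1 := integrableOn_mul_of_continuousOn hs' ht' l1 hψ.continuous.continuousOn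
  have i2 := integrableOn_mul_of_continuousOn hs' ht' l2 hψ.continuous.continuousOn
  rw [integral_add (integrableOn_mul_of_continuousOn hs' ht' l3 hd.continuousOn) i1] at key
  simp only [forcing, sub_mul]
  rw [integral_sub i1 i2]
  linarith

/-- The forcing is locally integrable up to the ends of the edge, so the continuous representative
of u' extends to the vertices. -/
theorem IsSolution.exists_isClassicalDeriv [Fintype E] {p lam : ℝ} {W ρ u : E → ℝ → ℝ}
    (hp : 2 < p) (hW : G.MemLInfty W) (hρ : G.MemLInfty ρ) (hu : G.IsSolution p W ρ lam u) :
    ∃ d, G.IsClassicalDeriv p W ρ lam u d := by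
  have key : ∀ e, ∃ d : ℝ → ℝ, ContinuousOn d (G.interval e) ∧
      G.der u e =ᵐ[G.edgeMeasure e] d ∧ ∀ x ∈ G.interval e, ∀ y ∈ G.interval e,
      d y - d x = ∫ t in x..y, forcing p W ρ lam u e t := by
    intro e
    obtain ⟨F, hF, hae, hint⟩ := (hu.hasWeakDerivOn_der hp hW hρ e).exists_continuousOn
      (G.isOpen_openInterval e) (G.ordConnected_openInterval e) (G.openInterval_nonempty e)
    obtain ⟨x₀, hx₀⟩ := G.openInterval_nonempty e
    have hx₀' := G.openInterval_subset e hx₀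
    have hl : LocallyIntegrableOn (forcing p W ρ lam u e) (G.interval e) :=
      (locallyIntegrableOn_linear_part hW lam (hu.1.continuousOn e)).sub
        ((locallyIntegrableOn_power_part hρ hp (hu.1.continuousOn e)).mul_continuousOn
        (hu.1.continuousOn e) (G.isClosed_interval e).isLocallyClosed)
    refine ⟨fun x => F x₀ + ∫ t in x₀..x, forcing p W ρ lam u e t, continuousOn_const.add
      (continuousOn_primitive_of_isClosed (G.isClosed_interval e) (G.ordConnected_interval e) hl
        hx₀'), ?_, fun x hx y hy => ?_⟩
    · rw [edgeMeasure_eq, Filter.EventuallyEq,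
        ae_restrict_iff' (G.isOpen_openInterval e).measurableSet]
      filter_upwards [hae] with x hx hxU
      rw [hx hxU, ← hint x₀ hx₀ x hxU]; ring
    · rw [← intervalIntegral.integral_interval_sub_left
        (hl.intervalIntegrable (G.ordConnected_interval e) hx₀' hy)
        (hl.intervalIntegrable (G.ordConnected_interval e) hx₀' hx)]
      ring
  choose d h1 h2 h3 using key
  refine ⟨d, fun e => ?_, h1, h2, fun e x hx y hy => ?_, h3⟩
  · exact (locallyIntegrableOn_linear_part hW lam (hu.1.continuousOn e)).sub
      ((locallyIntegrableOn_power_part hρ hp (hu.1.continuousOn e)).mul_continuousOn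
      (hu.1.continuousOn e) (G.isClosed_interval e).isLocallyClosed)
  · rw [hu.1.sub_eq_integral e x hx y hy]
    refine intervalIntegral.integral_congr_ae ?_
    filter_upwards [(G.ae_edgeMeasure_iff).1 (h2 e)] with z hz hzm
    exact hz ((G.ordConnected_interval e).uIcc_subset hx hy (uIoc_subset_uIcc hzm))

/-! ### Lower bounds for the Morse index from disjoint arcs. -/

/-- The density of the quadratic form of the linearization at `u`, on one edge, for the test
function `F` with derivative `H`. -/
def quadDensity (p : ℝ) (W ρ : E → ℝ → ℝ) (lam : ℝ) (u : E → ℝ → ℝ) (e : E) (F H : ℝ → ℝ)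
    (x : ℝ) : ℝ :=
  H x ^ 2 + (W e x + lam) * F x ^ 2 - (p - 1) * ρ e x * |u e x| ^ (p - 2) * F x ^ 2

theorem IsArcFunction.integrableOn_quadDensity {p lam : ℝ} {W ρ u : E → ℝ → ℝ} (hp : 2 < p)
    (hW : G.MemLInfty W) (hρ : G.MemLInfty ρ) (hu : G.MemH1 u) {e : E} {s t : ℝ} {F H : ℝ → ℝ}
    (h : G.IsArcFunction e s t F H) :
    IntegrableOn (quadDensity p W ρ lam u e F H) (Ioo s t) := by
  have h1 : IntegrableOn (fun x => H x ^ 2) (Ioo s t) :=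
    ((h.continuousOn_deriv.pow 2).integrableOn_compact isCompact_Icc).mono_set Ioo_subset_Icc_self
  have h2 : IntegrableOn (fun x => (W e x + lam) * F x ^ 2) (Ioo s t) :=
    integrableOn_mul_of_continuousOn h.left_mem h.right_mem ((hW.locallyIntegrableOn e).add
      (continuousOn_const.locallyIntegrableOn (G.isClosed_interval e).measurableSet))
      (h.continuousOn.pow 2)
  have h3 : IntegrableOn (fun x => (p - 1) * (ρ e x * |u e x| ^ (p - 2) * F x ^ 2)) (Ioo s t) :=
    (integrableOn_mul_of_continuousOn h.left_mem h.right_mem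
      (locallyIntegrableOn_power_part hρ hp (hu.continuousOn e)) (h.continuousOn.pow 2)).const_mul _
  refine ((h1.add h2).sub h3).congr_fun (fun x _ => ?_) measurableSet_Ioo
  simp only [quadDensity, Pi.add_apply, Pi.sub_apply]
  ring

/-- On disjoint supports all cross terms vanish, so the form is diagonal in the coefficients. -/
theorem quadForm_sum_arc [Fintype E] {p lam : ℝ} {W ρ u : E → ℝ → ℝ} (hp : 2 < p)
    (hW : G.MemLInfty W) (hρ : G.MemLInfty ρ) (hu : G.MemH1 u) {e : E} {ι : Type*} [Fintype ι]
    {s t : ι → ℝ} {F H : ι → ℝ → ℝ} (h : ∀ i, G.IsArcFunction e (s i) (t i) (F i) (H i))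
    (hdisj : Pairwise fun i j => Disjoint (Ioo (s i) (t i)) (Ioo (s j) (t j))) (c : ι → ℝ) :
    G.quadForm p W ρ lam u (∑ i, c i • arc e (s i) (t i) (F i)) =
      ∑ i, c i ^ 2 * ∫ x in Ioo (s i) (t i), quadDensity p W ρ lam u e (F i) (H i) x := by
  have hd := (isTestFunction_sum Finset.univ c fun i => (h i).isTestFunction).2
  have hsq : ∀ (K : ι → ℝ → ℝ) (x : ℝ), (∑ i, c i * (Ioo (s i) (t i)).indicator (K i) x) ^ 2 =
      ∑ i, c i ^ 2 * (Ioo (s i) (t i)).indicator (fun x => K i x ^ 2) x := by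
    intro K x
    rw [sq_sum_of_mul_eq_zero]
    · refine Finset.sum_congr rfl fun i _ => ?_
      simp only [indicator_apply]
      split_ifs <;> ring
    · intro i _ j _ hij
      by_cases hi : x ∈ Ioo (s i) (t i)
      · rw [indicator_of_notMem (disjoint_left.1 (hdisj hij) hi)]; ring
      · rw [indicator_of_notMem hi]; ring
  have key : ∀ e', (fun x => |G.der (∑ i, c i • arc e (s i) (t i) (F i)) e' x| ^ 2 +
      (W e' x + lam) * |(∑ i, c i • arc e (s i) (t i) (F i)) e' x| ^ 2 -
      (p - 1) * ρ e' x * |u e' x| ^ (p - 2) * |(∑ i, c i • arc e (s i) (t i) (F i)) e' x| ^ 2)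
      =ᵐ[G.edgeMeasure e'] fun x => ∑ i, c i ^ 2 *
        arc e (s i) (t i) (quadDensity p W ρ lam u e (F i) (H i)) e' x := by
    intro e'
    filter_upwards [hd e'] with x hx
    rw [hx]
    simp only [Finset.sum_apply, Pi.smul_apply, smul_eq_mul, sq_abs]
    by_cases he : e' = e
    · subst he
      simp only [arc_same, hsq]
      rw [Finset.mul_sum, Finset.mul_sum, ← Finset.sum_add_distrib, ← Finset.sum_sub_distrib]
      refine Finset.sum_congr rfl fun i _ => ?_
      simp only [indicator_apply, quadDensity]
      split_ifs <;> ring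
    · simp [arc_of_ne he]
  rw [quadForm, MetricGraph.integral, Finset.sum_eq_single e]
  · rw [integral_congr_ae (key e), integral_finsetSum]
    · refine Finset.sum_congr rfl fun i _ => ?_
      rw [integral_const_mul, arc_same, setIntegral_indicator_Ioo (h i).left_mem (h i).right_mem]
    · intro i _
      refine Integrable.const_mul ?_ _
      rw [arc_same]
      refine Integrable.mono_measure ?_ Measure.restrict_le_self
      exact (integrable_indicator_iff measurableSet_Ioo).2
        ((h i).integrableOn_quadDensity hp hW hρ hu)
  · intro e' _ he
    rw [integral_congr_ae (key e')]
    simp [arc_of_ne he]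
  · simp

/-- By diagonality the form is negative at every combination with nonzero coefficients. Such a
combination cannot be zero, where the form vanishes; this gives the linear independence as well. -/
theorem card_le_morseIndex [Fintype E] {p lam : ℝ} {W ρ u : E → ℝ → ℝ} (hp : 2 < p)
    (hW : G.MemLInfty W) (hρ : G.MemLInfty ρ) (hu : G.MemH1 u) {e : E} {ι : Type*} [Fintype ι]
    {s t : ι → ℝ} {F H : ι → ℝ → ℝ} (h : ∀ i, G.IsArcFunction e (s i) (t i) (F i) (H i))
    (hdisj : Pairwise fun i j => Disjoint (Ioo (s i) (t i)) (Ioo (s j) (t j)))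
    (hneg : ∀ i, ∫ x in Ioo (s i) (t i), quadDensity p W ρ lam u e (F i) (H i) x < 0) :
    (Fintype.card ι : ℕ∞) ≤ G.morseIndex p W ρ lam u := by
  have hQ := quadForm_sum_arc (lam := lam) hp hW hρ hu h hdisj
  have hpos : ∀ c : ι → ℝ, (∀ i, c i = 0) ∨
      G.quadForm p W ρ lam u (∑ i, c i • arc e (s i) (t i) (F i)) < 0 := by
    intro c
    by_cases hc : ∀ i, c i = 0
    · exact Or.inl hc
    push Not at hc
    obtain ⟨i, hi⟩ := hc
    refine Or.inr ?_
    rw [hQ c]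
    refine Finset.sum_neg' (fun j _ => ?_) ⟨i, Finset.mem_univ _, ?_⟩
    · exact mul_nonpos_of_nonneg_of_nonpos (sq_nonneg _) (hneg j).le
    · exact mul_neg_of_pos_of_neg (by positivity) (hneg i)
  have hli : LinearIndependent ℝ fun i => arc e (s i) (t i) (F i) := by
    rw [Fintype.linearIndependent_iff]
    intro c hc
    refine (hpos c).resolve_right ?_
    have h0 := hQ 0
    simp only [Pi.zero_apply, zero_smul, Finset.sum_const_zero, ne_eq, OfNat.ofNat_ne_zero,
      not_false_eq_true, zero_pow, zero_mul] at h0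
    rw [hc, h0]
    exact lt_irrefl _
  refine le_sSup ⟨Fintype.card ι, Submodule.span ℝ (range fun i => arc e (s i) (t i) (F i)), rfl,
    FiniteDimensional.span_of_finite ℝ (finite_range _), finrank_span_eq_card hli, ?_, ?_⟩
  · intro φ hφ
    obtain ⟨c, rfl⟩ := (Submodule.mem_span_range_iff_exists_fun ℝ).1 hφ
    exact (isTestFunction_sum Finset.univ c fun i => (h i).isTestFunction).1
  · intro φ hφ hne
    obtain ⟨c, rfl⟩ := (Submodule.mem_span_range_iff_exists_fun ℝ).1 hφ
    refine (hpos c).resolve_left fun h0 => hne ?_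
    simp [h0]

end MetricGraph

/-! ### The maximum of |u| and the Kirchhoff condition. -/

open Filter Topology in
theorem eventually_cocompact_inf_Ici {P : ℝ → Prop} (h : ∀ᶠ x in atTop, P x) :
    ∀ᶠ x in cocompact ℝ ⊓ 𝓟 (Ici 0), P x := by
  rw [eventually_inf_principal, cocompact_eq_atBot_atTop, eventually_sup]
  refine ⟨?_, h.mono fun x hx _ => hx⟩
  filter_upwards [eventually_lt_atBot 0] with x hx h0
  exact absurd hx (not_lt.2 h0)

theorem max_zero_sub_eq_integral {r : ℝ} (hr : 0 < r) {x y : ℝ} (hx : 0 ≤ x) (hy : 0 ≤ y) :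
    max 0 (1 - y / r) - max 0 (1 - x / r) =
      ∫ t in x..y, (Ico 0 r).indicator (fun _ => -(1 / r)) t := by
  have hi : ∀ a b, IntervalIntegrable ((Ico 0 r).indicator fun _ => -(1 / r)) volume a b :=
    fun a b => ((integrable_indicator_iff measurableSet_Ico).2 (by simp)).intervalIntegrable
  have key : ∀ y, 0 ≤ y → max 0 (1 - y / r) - 1 =
      ∫ t in 0..y, (Ico 0 r).indicator (fun _ => -(1 / r)) t := by
    intro y hy
    rw [intervalIntegral.integral_of_le hy, integral_indicator measurableSet_Ico,
      Measure.restrict_restrict measurableSet_Ico, setIntegral_const]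
    have e : (Ico 0 r ∩ Ioc 0 y : Set ℝ) =ᵐ[volume] (Ioc 0 (min r y) : Set ℝ) := by
      rw [← Ioc_inter_Ioc_left_eq]
      exact (Ico_ae_eq_Ioc).inter (ae_eq_refl _)
    rw [measureReal_congr e, Real.volume_real_Ioc_of_le (le_min hr.le hy), smul_eq_mul]
    rcases le_total r y with h | h
    · rw [min_eq_left h, max_eq_left]
      · field_simp; ring
      · rw [sub_nonpos, one_le_div hr]; exact h
    · rw [min_eq_right h, max_eq_right]
      · field_simp; ring
      · rw [sub_nonneg, div_le_one hr]; exact h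
  rw [← intervalIntegral.integral_interval_sub_left (hi 0 y) (hi 0 x), ← key y hy, ← key x hx]
  ring
where
  Ioc_inter_Ioc_left_eq {r y : ℝ} : Ioc 0 r ∩ Ioc 0 y = Ioc 0 (min r y) := by
    rw [Ioc_inter_Ioc, sup_idem]

namespace MetricGraph

variable {V E : Type*} {G : MetricGraph V E}

variable (G) in
theorem edgeMeasure_le_volume (e : E) : G.edgeMeasure e ≤ volume := Measure.restrict_le_self

theorem IsClassicalDeriv.hasDerivAt {p lam : ℝ} {W ρ u d : E → ℝ → ℝ}
    (h : G.IsClassicalDeriv p W ρ lam u d) {e : E} {x : ℝ} (hx : x ∈ G.openInterval e) :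
    HasDerivAt (u e) (d e x) x := by
  have hU := (G.isOpen_openInterval e).mem_nhds hx
  have hI := G.openInterval_subset e hx
  have h1 : HasDerivAt (fun y => u e x + ∫ t in x..y, d e t) (d e x) x := by
    refine HasDerivAt.const_add _ (intervalIntegral.integral_hasDerivAt_right (by simp) ?_ ?_)
    · exact ((h.continuousOn e).mono (G.openInterval_subset e)).stronglyMeasurableAtFilter
        (G.isOpen_openInterval e) x hx
    · exact ((h.continuousOn e).mono (G.openInterval_subset e)).continuousAt hU
  refine h1.congr_of_eventuallyEq ?_
  filter_upwards [hU] with y hy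
  rw [← h.sub_eq e x hI y (G.openInterval_subset e hy)]; ring

/-- On a half-line both u² and its derivative 2 u u' are integrable, so u² tends to zero. -/
theorem MemH1.tendsto_zero {p lam : ℝ} {W ρ u d : E → ℝ → ℝ} (hu : G.MemH1 u)
    (h : G.IsClassicalDeriv p W ρ lam u d) {e : E} (he : G.length e = ⊤) :
    Filter.Tendsto (u e) Filter.atTop (nhds 0) := by
  have hd2 : MemLp (d e) 2 (G.edgeMeasure e) := (memLp_congr_ae (h.ae_eq e)).1 (hu.memLp_der e)
  have hle : volume.restrict (Ioi 0) ≤ G.edgeMeasure e := by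
    rw [edgeMeasure, G.interval_eq_Ici he]
    exact Measure.restrict_mono Ioi_subset_Ici_self le_rfl
  have h1 : Filter.Tendsto (fun x => u e x ^ 2) Filter.atTop (nhds 0) := by
    refine tendsto_zero_of_hasDerivAt_of_integrableOn_Ioi (a := 0)
      (f' := fun x => 2 * (u e x * d e x)) (fun x hx => ?_) ?_ ?_
    · have := (h.hasDerivAt (e := e) (x := x) ⟨hx, by simp [he]⟩).pow 2
      refine this.congr_deriv ?_
      simp; ring
    · exact (((hu.2 e).1.integrable_mul hd2).const_mul 2).mono_measure hle
    · exact (hu.2 e).1.integrable_sq.mono_measure hle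
  have h2 := h1.sqrt
  simp only [Real.sqrt_sq_eq_abs, Real.sqrt_zero] at h2
  exact (tendsto_zero_iff_abs_tendsto_zero _).2 h2

theorem MemH1.exists_isMaxOn {p lam : ℝ} {W ρ u d : E → ℝ → ℝ} (hu : G.MemH1 u)
    (h : G.IsClassicalDeriv p W ρ lam u d) (e : E) :
    ∃ x ∈ G.interval e, ∀ y ∈ G.interval e, |u e y| ≤ |u e x| := by
  have hc := (hu.continuousOn e).abs
  by_cases he : G.length e = ⊤
  · by_cases h0 : ∃ x ∈ G.interval e, u e x ≠ 0
    · obtain ⟨x, hx, hx0⟩ := h0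
      have ht := (hu.tendsto_zero h he).abs
      rw [abs_zero] at ht
      -- Far out on the half-line |u| drops below the nonzero value |u x|, so the supremum is
      -- decided on a compact set.
      have hev : ∀ᶠ y in Filter.cocompact ℝ ⊓ Filter.principal (G.interval e), |u e y| ≤ |u e x| := by
        rw [G.interval_eq_Ici he]
        exact eventually_cocompact_inf_Ici
          ((ht.eventually (gt_mem_nhds (abs_pos.2 hx0))).mono fun y hy => le_of_lt hy)
      obtain ⟨z, hz, hz'⟩ := hc.exists_isMaxOn' (G.isClosed_interval e) hx hev
      exact ⟨z, hz, fun y hy => hz' hy⟩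
    · push Not at h0
      exact ⟨0, G.zero_mem_interval e, fun y hy => by simp [h0 y hy]⟩
  · have hK : IsCompact (G.interval e) := by
      rw [G.interval_eq_Icc he]; exact isCompact_Icc
    obtain ⟨z, hz, hz'⟩ := hK.exists_isMaxOn ⟨0, G.zero_mem_interval e⟩ hc
    exact ⟨z, hz, fun y hy => hz' hy⟩

theorem MemH1.exists_isMax [Finite E] [Nonempty E] {p lam : ℝ} {W ρ u d : E → ℝ → ℝ}
    (hu : G.MemH1 u) (h : G.IsClassicalDeriv p W ρ lam u d) :
    ∃ e, ∃ x ∈ G.interval e, ∀ e', ∀ y ∈ G.interval e', |u e' y| ≤ |u e x| := by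
  choose x hx hmax using hu.exists_isMaxOn h
  obtain ⟨e, he⟩ := Finite.exists_max fun e => |u e (x e)|
  exact ⟨e, x e, hx e, fun e' y hy => (hmax e' y hy).trans (he e')⟩

variable (G) in
/-- Uniform bounds for the potential and for the weight. -/
structure CoefficientBounds (W ρ : E → ℝ → ℝ) (Wbar b : ℝ) : Prop where
  memLInfty_W : G.MemLInfty W
  memLInfty_ρ : G.MemLInfty ρ
  W_le : ∀ e, ∀ᵐ x ∂(G.edgeMeasure e), |W e x| ≤ Wbar
  ρ_le : ∀ e, ∀ᵐ x ∂(G.edgeMeasure e), 0 ≤ ρ e x ∧ ρ e x ≤ b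

theorem abs_forcing_le {p lam Wbar b M w r y : ℝ} (hp : 2 < p) (hw : |w| ≤ Wbar) (hr0 : 0 ≤ r)
    (hr : r ≤ b) (hy : |y| ≤ M) :
    |(w + lam) * y - r * |y| ^ (p - 2) * y| ≤ (Wbar + |lam| + b * M ^ (p - 2)) * |y| := by
  have h1 : (w + lam) * y - r * |y| ^ (p - 2) * y = (w + lam - r * |y| ^ (p - 2)) * y := by ring
  rw [h1, abs_mul]
  refine mul_le_mul_of_nonneg_right ?_ (abs_nonneg y)
  have h2 : |y| ^ (p - 2) ≤ M ^ (p - 2) := Real.rpow_le_rpow (abs_nonneg y) hy (by linarith)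
  have h3 : 0 ≤ |y| ^ (p - 2) := by positivity
  have h4 : r * |y| ^ (p - 2) ≤ b * M ^ (p - 2) := mul_le_mul hr h2 h3 (hr0.trans hr)
  calc |w + lam - r * |y| ^ (p - 2)| ≤ |w + lam| + |r * |y| ^ (p - 2)| := abs_sub _ _
    _ ≤ |w| + |lam| + r * |y| ^ (p - 2) := by
      rw [abs_of_nonneg (mul_nonneg hr0 h3)]
      linarith [abs_add_le w lam]
    _ ≤ _ := by linarith

-- A Kirchhoff condition for difference quotients. Test the equation with the tent of radius r at v:
-- the derivative term is exactly the sum of the difference quotients, and the remaining terms are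
-- O(r) because the forcing is bounded and the tent lives on length at most 2r per edge.
open Classical in
theorem IsSolution.abs_sum_slopes_le [Fintype E] {p lam Wbar b M r : ℝ} {W ρ u : E → ℝ → ℝ}
    (hp : 2 < p) (hWρ : G.CoefficientBounds W ρ Wbar b) (hu : G.IsSolution p W ρ lam u)
    (hM : ∀ e, ∀ x ∈ G.interval e, |u e x| ≤ M) (hr : 0 < r)
    (hrl : ∀ e, ENNReal.ofReal r ≤ G.length e) (hM0 : 0 ≤ M) (v : V) :
    |∑ e, ((if G.tail e = v then (u e 0 - u e r) / r else 0) +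
      if G.head e = some v then
        (u e (G.length e).toReal - u e ((G.length e).toReal - r)) / r else 0)| ≤
      Fintype.card E * (2 * ((Wbar + |lam| + b * M ^ (p - 2)) * M) * r) := by
  set ℓ : E → ℝ := fun e => (G.length e).toReal with hℓ
  set A : E → ℝ := fun e => if G.tail e = v then 1 else 0 with hA
  set B : E → ℝ := fun e => if G.head e = some v then 1 else 0 with hB
  set C := (Wbar + |lam| + b * M ^ (p - 2)) * M with hC
  have hlt : ∀ e, B e ≠ 0 → G.length e ≠ ⊤ := fun e he h0 => by
    have := (G.head_eq_none_iff e).2 h0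
    simp [hB, this] at he
  have hrI : ∀ e, r ∈ G.interval e := fun e => ⟨hr.le, hrl e⟩
  have hrℓ : ∀ e, B e ≠ 0 → r ≤ ℓ e := fun e he => G.le_toReal_length (hrI e) (hlt e he)
  set K : ℝ → ℝ := fun x => max 0 (1 - x / r) with hK
  set κ : ℝ → ℝ := (Ico 0 r).indicator fun _ => -(1 / r) with hκ
  have hKc : Continuous K := by fun_prop
  have K0 : K 0 = 1 := by simp [hK]
  have Kr : ∀ x, r ≤ x → K x = 0 := fun x hx => by
    simp only [hK]
    rw [max_eq_left]
    rw [sub_nonpos, one_le_div hr]; exact hx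
  have Kle : ∀ x, 0 ≤ x → |K x| ≤ 1 := fun x hx => by
    rw [abs_of_nonneg (le_max_left _ _)]
    refine max_le zero_le_one ?_
    have : 0 ≤ x / r := by positivity
    linarith
  -- One tent for each end attached to v; on a loop both are present, and they may overlap. Since r
  -- is at most the length of every edge, each tent vanishes at the opposite end.
  set φ : E → ℝ → ℝ := fun e x => A e * K x + B e * K (ℓ e - x) with hφ
  set h : E → ℝ → ℝ := fun e x => A e * κ x - B e * κ (ℓ e - x) with hh
  have hκL : MemLp κ 2 volume :=
    memLp_indicator_const 2 measurableSet_Ico _ (Or.inr (by simp))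
  have hκL' : ∀ l, MemLp (fun x => κ (l - x)) 2 volume := fun l =>
    hκL.comp_measurePreserving (Measure.measurePreserving_sub_left volume l)
  have hκi : ∀ x y, IntervalIntegrable κ volume x y := fun x y =>
    ((integrable_indicator_iff measurableSet_Ico).2 (by simp)).intervalIntegrable
  have test := isTestFunction_of_integral (G := G) (φ := φ) (h := h)
    ⟨fun e => by fun_prop, fun w => if w = v then 1 else 0, fun e => ⟨?_, fun w hw => ?_⟩⟩
    (fun e => ?_) (fun e x hx y hy => ?_) fun e => ?_
  rotate_left
  · by_cases hBe : B e = 0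
    · simp [hφ, hBe, K0, hA]
    · simp [hφ, K0, hA, Kr _ (hrℓ e hBe)]
  · have hne : G.length e ≠ ⊤ := fun h0 => by
      rw [(G.head_eq_none_iff e).2 h0] at hw; exact absurd hw (by simp)
    simp [hφ, hℓ, hB, Kr _ (G.le_toReal_length (hrI e) hne), hw, K0]
  · exact ((hκL.const_mul _).sub ((hκL' _).const_mul _)).mono_measure Measure.restrict_le_self
  · simp only [hφ, hh]
    rw [intervalIntegral.integral_sub, intervalIntegral.integral_const_mul,
      intervalIntegral.integral_const_mul, intervalIntegral.integral_comp_sub_left,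
      ← max_zero_sub_eq_integral hr hx.1.le hy.1.le]
    · by_cases hBe : B e = 0
      · simp [hBe]; ring
      · rw [← max_zero_sub_eq_integral hr (sub_nonneg.2 (G.le_toReal_length
          (G.openInterval_subset e hy) (hlt e hBe))) (sub_nonneg.2 (G.le_toReal_length
          (G.openInterval_subset e hx) (hlt e hBe)))]
        ring
    · exact (hκi x y).const_mul _
    · have := (hκi (ℓ e - x) (ℓ e - y)).comp_sub_left (ℓ e)
      simp only [sub_sub_cancel] at this
      exact this.const_mul _
  · by_cases hBe : B e = 0
    · exact ⟨r, fun x _ hx => by simp [hφ, hBe, Kr x hx.le]⟩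
    · exact ⟨ℓ e, fun x hx hx' => absurd hx' (not_lt.2 (G.le_toReal_length hx (hlt e hBe)))⟩
  have slope : ∀ e x y, x ∈ G.interval e → y ∈ G.interval e → x ≤ y → ∀ S : Set ℝ,
      MeasurableSet S → S =ᵐ[volume] (Ioc x y : Set ℝ) →
      ∫ z, G.der u e z * S.indicator (fun _ => -(1 / r)) z ∂(G.edgeMeasure e) =
        (u e x - u e y) / r := by
    intro e x y hx hy hxy S hS hSe
    have e1 : (fun z => G.der u e z * S.indicator (fun _ => -(1 / r)) z) =
        S.indicator fun z => -(1 / r) * G.der u e z := by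
      ext z; simp only [indicator_apply]; split_ifs <;> ring
    have e2 : (S ∩ G.interval e : Set ℝ) =ᵐ[volume] (Ioc x y : Set ℝ) := by
      refine (hSe.inter (ae_eq_refl (G.interval e))).trans ?_
      rw [inter_eq_left.2 (Ioc_subset_Icc_self.trans (G.Icc_subset_interval hx hy))]
      exact ae_eq_refl _
    rw [e1, integral_indicator hS, edgeMeasure, Measure.restrict_restrict hS,
      setIntegral_congr_set e2, integral_const_mul, ← intervalIntegral.integral_of_le hxy,
      ← hu.1.sub_eq_integral e x hx y hy]
    ring
  have hφL : ∀ e, MemLp (φ e) 2 (G.edgeMeasure e) := fun e => (test.1.1.2 e).1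
  have hhL : ∀ e, MemLp (h e) 2 (G.edgeMeasure e) := fun e =>
    ((hκL.const_mul _).sub ((hκL' _).const_mul _)).mono_measure Measure.restrict_le_self
  have I1 : ∀ e, ∫ x, G.der u e x * h e x ∂(G.edgeMeasure e) =
      A e * ((u e 0 - u e r) / r) + B e * ((u e (ℓ e) - u e (ℓ e - r)) / r) := by
    intro e
    have i1 : Integrable (fun x => G.der u e x * κ x) (G.edgeMeasure e) :=
      (hu.1.memLp_der e).integrable_mul (hκL.mono_measure Measure.restrict_le_self)
    have i2 : Integrable (fun x => G.der u e x * κ (ℓ e - x)) (G.edgeMeasure e) :=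
      (hu.1.memLp_der e).integrable_mul ((hκL' _).mono_measure Measure.restrict_le_self)
    have e1 : (fun x => G.der u e x * h e x) = fun x =>
        A e * (G.der u e x * κ x) - B e * (G.der u e x * κ (ℓ e - x)) := by
      ext x; simp only [hh]; ring
    rw [e1, integral_sub (i1.const_mul _) (i2.const_mul _), integral_const_mul, integral_const_mul,
      slope e 0 r (G.zero_mem_interval e) (hrI e) hr.le _ measurableSet_Ico Ico_ae_eq_Ioc]
    by_cases hBe : B e = 0
    · simp [hBe]
    · have hℓI := G.length_mem_interval (hlt e hBe)
      have e2 : (fun x => G.der u e x * κ (ℓ e - x)) = fun x => G.der u e x *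
          (Ioc (ℓ e - r) (ℓ e)).indicator (fun _ => -(1 / r)) x := by
        ext x
        have : ℓ e - x ∈ Ico 0 r ↔ x ∈ Ioc (ℓ e - r) (ℓ e) := by
          constructor <;> intro hx <;> constructor <;> linarith [hx.1, hx.2]
        simp only [hκ, indicator_apply, this]
      rw [e2, slope e (ℓ e - r) (ℓ e) (G.mem_interval_of_le hℓI (sub_nonneg.2 (hrℓ e hBe))
        (by linarith)) hℓI (by linarith) _ measurableSet_Ioc (ae_eq_refl _)]
      ring
  have hfor : ∀ e, ∀ᵐ x ∂(G.edgeMeasure e), |forcing p W ρ lam u e x| ≤ C := by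
    intro e
    filter_upwards [hWρ.W_le e, hWρ.ρ_le e,
      (G.ae_edgeMeasure_iff (P := fun x => |u e x| ≤ M)).2 (ae_of_all _ (hM e))] with x h1 h2 h3
    refine (abs_forcing_le hp h1 h2.1 h2.2 h3).trans (mul_le_mul_of_nonneg_left h3 ?_)
    have := (abs_nonneg _).trans h1
    have := h2.1.trans h2.2
    positivity
  have hC0 : ∀ e : E, 0 ≤ C := fun e => by
    have : (ae (G.edgeMeasure e)).NeBot := by
      rw [ae_neBot, edgeMeasure, Ne, Measure.restrict_eq_zero]
      intro h0
      have := measure_mono_null (G.Icc_subset_interval (G.zero_mem_interval e) (hrI e)) h0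
      simp only [Real.volume_Icc, sub_zero, ENNReal.ofReal_eq_zero] at this
      linarith
    obtain ⟨x, hx⟩ := (hfor e).exists
    exact (abs_nonneg _).trans hx
  have hφle : ∀ e, ∀ x ∈ G.interval e, |φ e x| ≤ (Icc 0 r).indicator (fun _ => (1 : ℝ)) x +
      (Icc (ℓ e - r) (ℓ e)).indicator (fun _ => (1 : ℝ)) x := by
    intro e x hx
    refine (abs_add_le _ _).trans (add_le_add ?_ ?_)
    · by_cases hxr : x ≤ r
      · rw [indicator_of_mem (show x ∈ Icc 0 r from ⟨hx.1, hxr⟩), abs_mul]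
        refine mul_le_one₀ ?_ (abs_nonneg _) (Kle x hx.1)
        simp only [hA]; split_ifs <;> simp
      · rw [Kr x (not_le.1 hxr).le]
        simpa using indicator_nonneg (fun _ _ => zero_le_one) x
    · by_cases hBe : B e = 0
      · rw [hBe]
        simpa using indicator_nonneg (fun _ _ => zero_le_one) x
      have hxl := G.le_toReal_length hx (hlt e hBe)
      by_cases hxr : ℓ e - r ≤ x
      · rw [indicator_of_mem (show x ∈ Icc (ℓ e - r) (ℓ e) from ⟨hxr, hxl⟩), abs_mul]
        refine mul_le_one₀ ?_ (abs_nonneg _) (Kle _ (sub_nonneg.2 hxl))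
        simp only [hB]; split_ifs <;> simp
      · rw [Kr (ℓ e - x) (by linarith)]
        simpa using indicator_nonneg (fun _ _ => zero_le_one) x
  have I2 : ∀ e, |∫ x, forcing p W ρ lam u e x * φ e x ∂(G.edgeMeasure e)| ≤ 2 * C * r := by
    intro e
    have j1 : ∀ x y : ℝ, Integrable ((Icc x y).indicator fun _ => (1 : ℝ)) := fun x y =>
      (integrable_indicator_iff measurableSet_Icc).2 (by simp)
    have j2 : ∀ x : ℝ, ∫ z, (Icc x (x + r)).indicator (fun _ => (1 : ℝ)) z ∂(G.edgeMeasure e) ≤ r := by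
      intro x
      refine (integral_mono_measure Measure.restrict_le_self (ae_of_all _ fun z =>
        indicator_nonneg (fun _ _ => zero_le_one) z) (j1 _ _)).trans ?_
      rw [integral_indicator measurableSet_Icc]
      simp [hr.le]
    have j3 := j2 0
    have j4 := j2 (ℓ e - r)
    rw [zero_add] at j3
    rw [sub_add_cancel] at j4
    have j5 := (j1 0 r).mono_measure (G.edgeMeasure_le_volume e)
    have j6 := (j1 (ℓ e - r) (ℓ e)).mono_measure (G.edgeMeasure_le_volume e)
    rw [← Real.norm_eq_abs]
    refine (norm_integral_le_of_norm_le ((j5.add j6).const_mul C) ?_).trans ?_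
    · filter_upwards [hfor e, (G.ae_edgeMeasure_iff).2 (ae_of_all _ (hφle e))] with x h1 h2
      rw [Real.norm_eq_abs, abs_mul]
      exact mul_le_mul h1 h2 (abs_nonneg _) (hC0 e)
    · rw [integral_const_mul, integral_add' j5 j6]
      nlinarith [hC0 e]
  have hsplit : ∀ e, ∫ x, (G.der u e x * G.der φ e x + (W e x + lam) * u e x * φ e x)
        ∂(G.edgeMeasure e) - ∫ x, ρ e x * |u e x| ^ (p - 2) * u e x * φ e x ∂(G.edgeMeasure e) =
      ∫ x, G.der u e x * h e x ∂(G.edgeMeasure e) +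
        ∫ x, forcing p W ρ lam u e x * φ e x ∂(G.edgeMeasure e) := by
    intro e
    have i0 : Integrable (fun x => u e x * φ e x) (G.edgeMeasure e) :=
      (hu.1.2 e).1.integrable_mul (hφL e)
    have i1 : Integrable (fun x => G.der u e x * h e x) (G.edgeMeasure e) :=
      (hu.1.memLp_der e).integrable_mul (hhL e)
    have i2 : Integrable (fun x => (W e x + lam) * u e x * φ e x) (G.edgeMeasure e) := by
      simp only [mul_assoc]
      refine i0.bdd_mul (c := Wbar + |lam|)
        ((hWρ.memLInfty_W e).1.add aestronglyMeasurable_const) ?_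
      filter_upwards [hWρ.W_le e] with x hx
      exact (abs_add_le _ _).trans (by linarith)
    have i3 : Integrable (fun x => ρ e x * |u e x| ^ (p - 2) * u e x * φ e x)
        (G.edgeMeasure e) := by
      simp only [mul_assoc _ (u e _)]
      refine i0.bdd_mul (c := b * M ^ (p - 2)) ((hWρ.memLInfty_ρ e).1.mul
        ((continuousOn_abs_rpow (hu.1.continuousOn e) (by linarith)).aestronglyMeasurable
          (G.isClosed_interval e).measurableSet)) ?_
      filter_upwards [hWρ.ρ_le e,
        (G.ae_edgeMeasure_iff (P := fun x => |u e x| ≤ M)).2 (ae_of_all _ (hM e))] with x h2 h3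
      rw [Real.norm_eq_abs, abs_mul, abs_of_nonneg h2.1, abs_of_nonneg (by positivity)]
      exact mul_le_mul h2.2 (Real.rpow_le_rpow (abs_nonneg _) h3 (by linarith)) (by positivity)
        (h2.1.trans h2.2)
    rw [integral_congr_ae (g := fun x => G.der u e x * h e x + (W e x + lam) * u e x * φ e x),
      integral_add i1 i2, add_sub_assoc, ← integral_sub i2 i3]
    · simp only [forcing, sub_mul]
    · filter_upwards [test.2 e] with x hx
      rw [hx]
  have key := hu.2 φ test.1
  rw [MetricGraph.integral, MetricGraph.integral, ← sub_eq_zero, ← Finset.sum_sub_distrib] at key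
  simp only [hsplit, I1] at key
  rw [Finset.sum_add_distrib] at key
  have hgoal : ∑ e, ((if G.tail e = v then (u e 0 - u e r) / r else 0) +
      if G.head e = some v then (u e (ℓ e) - u e (ℓ e - r)) / r else 0) =
      ∑ e, (A e * ((u e 0 - u e r) / r) + B e * ((u e (ℓ e) - u e (ℓ e - r)) / r)) := by
    refine Finset.sum_congr rfl fun e _ => ?_
    simp only [hA, hB]
    split_ifs <;> ring
  rw [hgoal, eq_neg_of_add_eq_zero_left key, abs_neg]
  refine (Finset.abs_sum_le_sum_abs _ _).trans ((Finset.sum_le_sum fun e _ => I2 e).trans ?_)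
  simp

end MetricGraph

/-- For continuous g the integral over [0, r] is r · g 0 + o(r), which cannot be O(r²) unless g 0 =
0. -/
theorem eq_zero_of_abs_integral_le {g : ℝ → ℝ} {R D : ℝ} (hR : 0 < R)
    (hg : ContinuousOn g (Icc 0 R)) (h : ∀ r, 0 < r → r ≤ R → |∫ t in 0..r, g t| ≤ D * r ^ 2) :
    g 0 = 0 := by
  have hD : 0 ≤ D := by
    have := (abs_nonneg _).trans (h R hR le_rfl)
    by_contra hD
    have : D * R ^ 2 < 0 := mul_neg_of_neg_of_pos (not_le.1 hD) (by positivity)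
    linarith
  by_contra h0
  have hε : 0 < |g 0| / 2 := by positivity
  obtain ⟨δ, hδ, hδ'⟩ := Metric.continuousOn_iff.1 hg 0 (left_mem_Icc.2 hR.le) _ hε
  -- Continuity makes the oscillation of g on [0, r] at most |g 0| / 2, and the last entry gives D r
  -- ≤ |g 0| / 4; together |g 0| ≤ 3/4 |g 0|.
  set r := min (min R (δ / 2)) (|g 0| / (4 * (D + 1))) with hr
  have hr0 : 0 < r := by
    simp only [hr, lt_min_iff]
    exact ⟨⟨hR, by positivity⟩, by positivity⟩
  have hrR : r ≤ R := (min_le_left _ _).trans (min_le_left _ _)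
  have hrδ : r ≤ δ / 2 := (min_le_left _ _).trans (min_le_right _ _)
  have hrD : r ≤ |g 0| / (4 * (D + 1)) := min_le_right _ _
  have hi : IntervalIntegrable g volume 0 r := (hg.mono (by
    rw [uIcc_of_le hr0.le]; exact Icc_subset_Icc_right hrR)).intervalIntegrable
  have h1 : |∫ t in 0..r, (g t - g 0)| ≤ |g 0| / 2 * |r - 0| := by
    rw [← Real.norm_eq_abs]
    refine intervalIntegral.norm_integral_le_of_norm_le_const fun t ht => ?_
    rw [uIoc_of_le hr0.le] at ht
    have := hδ' t ⟨ht.1.le, ht.2.trans hrR⟩ (by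
      rw [Real.dist_eq, sub_zero, abs_of_pos ht.1]; linarith [ht.2])
    rw [Real.dist_eq] at this
    exact this.le
  rw [intervalIntegral.integral_sub hi (by simp), intervalIntegral.integral_const, sub_zero,
    abs_of_pos hr0, smul_eq_mul] at h1
  have h2 := h r hr0 hrR
  have h3 : |r * g 0| ≤ |g 0| / 2 * r + D * r ^ 2 := by
    have := abs_sub_abs_le_abs_sub (r * g 0) (∫ t in 0..r, g t)
    rw [abs_sub_comm] at this
    linarith
  rw [abs_mul, abs_of_pos hr0] at h3
  have h4 : |g 0| ≤ |g 0| / 2 + D * r := by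
    have : r * |g 0| ≤ r * (|g 0| / 2 + D * r) := by linarith
    exact le_of_mul_le_mul_left this hr0
  have h5 : D * r ≤ |g 0| / 4 := by
    rw [le_div_iff₀ (by positivity)] at hrD
    nlinarith
  have : 0 < |g 0| := abs_pos.2 h0
  linarith

/-! ### Sign and orientation; a solution followed from its maximum. -/

theorem exists_sign_mul_eq_abs (y : ℝ) : ∃ τ : ℝ, (τ = 1 ∨ τ = -1) ∧ τ * y = |y| := by
  rcases le_total 0 y with h | h
  · exact ⟨1, Or.inl rfl, by rw [one_mul, abs_of_nonneg h]⟩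
  · exact ⟨-1, Or.inr rfl, by rw [abs_of_nonpos h]; ring⟩

theorem sign_mul_le_abs {τ : ℝ} (hτ : τ = 1 ∨ τ = -1) (y : ℝ) : τ * y ≤ |y| := by
  rcases hτ with rfl | rfl
  · simpa using le_abs_self y
  · simpa using neg_le_abs y

theorem abs_sign_mul {τ : ℝ} (hτ : τ = 1 ∨ τ = -1) (y : ℝ) : |τ * y| = |y| := by
  rcases hτ with rfl | rfl <;> simp

/-- A solution `v` of the equation on `[0, R]` with coefficients `Wt`, `ρt` and derivative `w`,
starting at its maximum `M` with slope zero. -/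
structure IsBranch (p lam Wbar b M R : ℝ) (v w Wt ρt : ℝ → ℝ) : Prop where
  continuousOn : ContinuousOn v (Icc 0 R)
  continuousOn_deriv : ContinuousOn w (Icc 0 R)
  sub_eq : ∀ x ∈ Icc 0 R, ∀ y ∈ Icc 0 R, v y - v x = ∫ t in x..y, w t
  intervalIntegrable : ∀ x ∈ Icc 0 R, ∀ y ∈ Icc 0 R, IntervalIntegrable
    (fun t => (Wt t + lam) * v t - ρt t * |v t| ^ (p - 2) * v t) volume x y
  sub_eq' : ∀ x ∈ Icc 0 R, ∀ y ∈ Icc 0 R, w y - w x =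
    ∫ t in x..y, ((Wt t + lam) * v t - ρt t * |v t| ^ (p - 2) * v t)
  W_le : ∀ᵐ t, t ∈ Icc 0 R → |Wt t| ≤ Wbar
  ρ_le : ∀ᵐ t, t ∈ Icc 0 R → 0 ≤ ρt t ∧ ρt t ≤ b
  abs_le : ∀ t ∈ Icc 0 R, |v t| ≤ M
  zero_eq : v 0 = M
  deriv_zero_eq : w 0 = 0

theorem measurePreserving_add_sign_mul {σ : ℝ} (hσ : σ = 1 ∨ σ = -1) (x₀ : ℝ) :
    MeasurePreserving (fun t => x₀ + σ * t) (volume : Measure ℝ) volume := by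
  rcases hσ with rfl | rfl
  · simpa using measurePreserving_add_left volume x₀
  · simpa [sub_eq_add_neg] using Measure.measurePreserving_sub_left volume x₀

theorem integral_comp_add_sign_mul {σ : ℝ} (hσ : σ = 1 ∨ σ = -1) (x₀ x y : ℝ) (f : ℝ → ℝ) :
    ∫ t in x..y, f (x₀ + σ * t) = σ * ∫ t in (x₀ + σ * x)..(x₀ + σ * y), f t := by
  rw [intervalIntegral.integral_comp_add_mul _ (by rcases hσ with rfl | rfl <;> norm_num)]
  rcases hσ with rfl | rfl <;> norm_num

theorem add_sign_mul_mem_segment {σ R t x₀ : ℝ} (hσ : σ = 1 ∨ σ = -1) (ht : t ∈ Icc 0 R) :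
    x₀ + σ * t ∈ uIcc x₀ (x₀ + σ * R) := by
  rw [mem_uIcc]
  rcases hσ with rfl | rfl
  · left; constructor <;> linarith [ht.1, ht.2]
  · right; constructor <;> linarith [ht.1, ht.2]

namespace MetricGraph

variable {V E : Type*} {G : MetricGraph V E}

theorem exists_pos_le_length [Finite E] (G : MetricGraph V E) :
    ∃ r : ℝ, 0 < r ∧ ∀ e, ENNReal.ofReal r ≤ G.length e := by
  cases isEmpty_or_nonempty E
  · exact ⟨1, one_pos, fun e => isEmptyElim e⟩
  choose x hx h0 using G.exists_pos_mem_interval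
  obtain ⟨e, he⟩ := Finite.exists_min x
  exact ⟨x e, h0 e, fun e' => (ENNReal.ofReal_le_ofReal (he e')).trans (hx e').2⟩

/-- At a vertex the difference quotients of τ u towards the vertex are all nonnegative, so each is
bounded by their sum, which is O(r) by `abs_sum_slopes_le`. Increments of order r² along the edge
mean zero slope. -/
theorem IsSolution.deriv_eq_zero_of_isMax [Fintype E] {p lam Wbar b : ℝ} {W ρ u d : E → ℝ → ℝ}
    (hp : 2 < p) (hWρ : G.CoefficientBounds W ρ Wbar b) (hu : G.IsSolution p W ρ lam u)
    (h : G.IsClassicalDeriv p W ρ lam u d) {e : E} {x : ℝ} (hx : x ∈ G.interval e)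
    (hmax : ∀ e', ∀ y ∈ G.interval e', |u e' y| ≤ |u e x|) : d e x = 0 := by
  classical
  obtain ⟨τ, hτ, hτu⟩ := exists_sign_mul_eq_abs (u e x)
  have hle : ∀ e', ∀ y ∈ G.interval e', τ * u e' y ≤ τ * u e x := fun e' y hy =>
    (sign_mul_le_abs hτ _).trans ((hmax e' y hy).trans hτu.ge)
  have hτ0 : τ ≠ 0 := by rcases hτ with rfl | rfl <;> norm_num
  by_cases hxU : x ∈ G.openInterval e
  · have h1 : IsLocalMax (fun y => τ * u e y) x := by
      filter_upwards [(G.isOpen_openInterval e).mem_nhds hxU] with y hy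
      exact hle e y (G.openInterval_subset e hy)
    have := h1.hasDerivAt_eq_zero ((h.hasDerivAt hxU).const_mul τ)
    exact (mul_eq_zero.1 this).resolve_left hτ0
  obtain ⟨r₀, hr₀, hr₀l⟩ := G.exists_pos_le_length
  obtain ⟨value, hvalue⟩ := hu.1.1.2
  set M := |u e x|
  -- Working with increments instead of derivatives treats all edge ends at v alike, loops included;
  -- D does not depend on r.
  have main : ∀ v, value v = u e x → ∃ D : ℝ, ∀ r, 0 < r → r ≤ r₀ → ∀ e',
      (G.tail e' = v → |u e' r - u e' 0| ≤ D * r ^ 2) ∧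
      (G.head e' = some v →
        |u e' (G.length e').toReal - u e' ((G.length e').toReal - r)| ≤ D * r ^ 2) := by
    intro v hv
    refine ⟨Fintype.card E * (2 * ((Wbar + |lam| + b * M ^ (p - 2)) * M)), fun r hr hrr₀ => ?_⟩
    have hrl : ∀ e, ENNReal.ofReal r ≤ G.length e := fun e =>
      (ENNReal.ofReal_le_ofReal hrr₀).trans (hr₀l e)
    have key := hu.abs_sum_slopes_le hp hWρ hmax hr hrl (abs_nonneg _) v
    set T₁ : E → ℝ := fun e => if G.tail e = v then (u e 0 - u e r) / r else 0 with hT₁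
    set T₂ : E → ℝ := fun e => if G.head e = some v then
        (u e (G.length e).toReal - u e ((G.length e).toReal - r)) / r else 0 with hT₂
    have p1 : ∀ e', 0 ≤ τ * T₁ e' := by
      intro e'
      simp only [hT₁]
      split_ifs with ht
      · have := hle e' r ⟨hr.le, hrl e'⟩
        rw [(hvalue e').1, ht, hv, ← mul_div_assoc, mul_sub]
        exact div_nonneg (sub_nonneg.2 this) hr.le
      · simp
    have p2 : ∀ e', 0 ≤ τ * T₂ e' := by
      intro e'
      simp only [hT₂]
      split_ifs with ht
      · have hne : G.length e' ≠ ⊤ := fun h0 => by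
          rw [(G.head_eq_none_iff e').2 h0] at ht; exact absurd ht (by simp)
        have hm := G.length_mem_interval hne
        have := hle e' ((G.length e').toReal - r) (G.mem_interval_of_le hm (sub_nonneg.2
          (G.le_toReal_length ⟨hr.le, hrl e'⟩ hne)) (by linarith))
        rw [(hvalue e').2 v ht, hv, ← mul_div_assoc, mul_sub]
        exact div_nonneg (sub_nonneg.2 this) hr.le
      · simp
    have hsum : ∀ e', |T₁ e'| + |T₂ e'| ≤
        Fintype.card E * (2 * ((Wbar + |lam| + b * M ^ (p - 2)) * M) * r) := by
      intro e'
      rw [← abs_sign_mul hτ (T₁ e'), ← abs_sign_mul hτ (T₂ e'), abs_of_nonneg (p1 e'),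
        abs_of_nonneg (p2 e'), ← mul_add]
      refine le_trans ?_ key
      refine le_trans ?_ (sign_mul_le_abs hτ _)
      rw [Finset.mul_sum]
      exact Finset.single_le_sum (f := fun e => τ * (T₁ e + T₂ e))
        (fun e _ => by rw [mul_add]; exact add_nonneg (p1 e) (p2 e)) (Finset.mem_univ e')
    intro e'
    have hs := hsum e'
    constructor
    · intro ht
      have h1 : T₁ e' = (u e' 0 - u e' r) / r := by simp only [hT₁, if_pos ht]
      have h2 := (le_add_of_nonneg_right (abs_nonneg (T₂ e'))).trans hs
      rw [h1, abs_div, abs_of_pos hr, div_le_iff₀ hr, abs_sub_comm] at h2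
      exact h2.trans_eq (by ring)
    · intro ht
      have h1 : T₂ e' = (u e' (G.length e').toReal - u e' ((G.length e').toReal - r)) / r := by
        simp only [hT₂, if_pos ht]
      have h2 := (le_add_of_nonneg_left (abs_nonneg (T₁ e'))).trans hs
      rw [h1, abs_div, abs_of_pos hr, div_le_iff₀ hr] at h2
      exact h2.trans_eq (by ring)
  have hrI : r₀ ∈ G.interval e := ⟨hr₀.le, hr₀l e⟩
  by_cases hx0 : x = 0
  · subst hx0
    obtain ⟨D, hD⟩ := main (G.tail e) (hvalue e).1.symm
    refine eq_zero_of_abs_integral_le hr₀ ((h.continuousOn e).mono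
      (G.Icc_subset_interval hx hrI)) (D := D) fun r h0 hr => ?_
    rw [← h.sub_eq e 0 hx r (G.mem_interval_of_le hrI h0.le hr)]
    exact (hD r h0 hr e).1 rfl
  · have hxl : ENNReal.ofReal x = G.length e := by
      by_contra hne
      exact hxU ⟨lt_of_le_of_ne hx.1 (Ne.symm hx0), lt_of_le_of_ne hx.2 hne⟩
    have hne : G.length e ≠ ⊤ := hxl ▸ ENNReal.ofReal_ne_top
    have hxℓ : (G.length e).toReal = x := by rw [← hxl, ENNReal.toReal_ofReal hx.1]
    obtain ⟨v, hv⟩ := Option.ne_none_iff_exists'.1 (mt (G.head_eq_none_iff e).1 hne)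
    obtain ⟨D, hD⟩ := main v (by rw [← (hvalue e).2 v hv, hxℓ])
    have hr₀x : r₀ ≤ x := hxℓ ▸ G.le_toReal_length hrI hne
    have h0 := eq_zero_of_abs_integral_le (g := fun t => d e (x - t)) (D := D) hr₀
      ((h.continuousOn e).comp (by fun_prop) fun t ht => G.mem_interval_of_le hx
        (by linarith [ht.2]) (by linarith [ht.1])) fun r h0 hr => ?_
    · simpa using h0
    · rw [intervalIntegral.integral_comp_sub_left, sub_zero,
        ← h.sub_eq e _ (G.mem_interval_of_le hx (by linarith) (by linarith)) x hx]
      have := (hD r h0 hr e).2 hv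
      rwa [hxℓ] at this

/-- The equation is invariant under u ↦ -u and under reversal of the edge. The signs τ and σ make
the value at the maximum positive and direct the branch towards a side where the edge is long
enough. -/
theorem IsClassicalDeriv.isBranch {p lam Wbar b R : ℝ} {W ρ u d : E → ℝ → ℝ}
    (hWρ : G.CoefficientBounds W ρ Wbar b) (hu : G.MemH1 u)
    (h : G.IsClassicalDeriv p W ρ lam u d) {e : E} {x₀ : ℝ} (hx₀ : x₀ ∈ G.interval e)
    (hmax : ∀ e', ∀ y ∈ G.interval e', |u e' y| ≤ |u e x₀|) (hd : d e x₀ = 0) {σ τ : ℝ}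
    (hσ : σ = 1 ∨ σ = -1) (hτ : τ = 1 ∨ τ = -1) (hτu : τ * u e x₀ = |u e x₀|)
    (hR : x₀ + σ * R ∈ G.interval e) :
    IsBranch p lam Wbar b |u e x₀| R (fun t => τ * u e (x₀ + σ * t))
      (fun t => τ * σ * d e (x₀ + σ * t)) (fun t => W e (x₀ + σ * t))
      (fun t => ρ e (x₀ + σ * t)) := by
  have hm : ∀ t ∈ Icc 0 R, x₀ + σ * t ∈ G.interval e := fun t ht =>
    (G.ordConnected_interval e).uIcc_subset hx₀ hR (add_sign_mul_mem_segment hσ ht)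
  have hmc : MapsTo (fun t => x₀ + σ * t) (Icc 0 R) (G.interval e) := hm
  have hc : Continuous fun t => x₀ + σ * t := by fun_prop
  have hσσ : σ * σ = 1 := by rcases hσ with rfl | rfl <;> norm_num
  have hae : ∀ {P : ℝ → Prop}, (∀ᵐ x ∂(G.edgeMeasure e), P x) →
      ∀ᵐ t, t ∈ Icc 0 R → P (x₀ + σ * t) := fun {P} hP => by
    filter_upwards [(measurePreserving_add_sign_mul hσ x₀).quasiMeasurePreserving.ae
      ((G.ae_edgeMeasure_iff).1 hP)] with t ht htm
    exact ht (hm t htm)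
  have hf : (fun t => (W e (x₀ + σ * t) + lam) * (τ * u e (x₀ + σ * t)) -
      ρ e (x₀ + σ * t) * |τ * u e (x₀ + σ * t)| ^ (p - 2) * (τ * u e (x₀ + σ * t))) =
      fun t => τ * forcing p W ρ lam u e (x₀ + σ * t) := by
    ext t
    rw [abs_sign_mul hτ, forcing]
    ring
  refine ⟨?_, ?_, fun x hx y hy => ?_, fun x hx y hy => ?_, fun x hx y hy => ?_, hae (hWρ.W_le e),
    hae (hWρ.ρ_le e), fun t ht => ?_, ?_, ?_⟩
  · exact continuousOn_const.mul ((hu.continuousOn e).comp hc.continuousOn hmc)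
  · exact continuousOn_const.mul ((h.continuousOn e).comp hc.continuousOn hmc)
  · rw [intervalIntegral.integral_const_mul, integral_comp_add_sign_mul hσ,
      ← h.sub_eq e _ (hm x hx) _ (hm y hy), ← mul_assoc, mul_assoc τ σ, hσσ]
    ring
  · simp only [hf]
    refine IntervalIntegrable.const_mul ?_ _
    have hi := (h.locallyIntegrableOn e).intervalIntegrable (G.ordConnected_interval e)
      (hm x hx) (hm y hy)
    rcases hσ with rfl | rfl
    · simp only [one_mul] at hi ⊢
      simpa using hi.comp_add_left x₀
    · simp only [neg_mul, one_mul, ← sub_eq_add_neg] at hi ⊢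
      simpa using hi.comp_sub_left x₀
  · simp only [hf]
    rw [intervalIntegral.integral_const_mul, integral_comp_add_sign_mul hσ,
      ← h.sub_eq' e _ (hm x hx) _ (hm y hy)]
    ring
  · rw [abs_sign_mul hτ]
    exact hmax e _ (hm t ht)
  · simp [hτu]
  · simp [hd]

end MetricGraph

/-! ### Estimates along a branch, and its rescaling. -/

/-- Mean value inequalities on `[s, t]` for a function `v`, with derivative `w` and values in
`[-1, 1]`, that solves an equation `v'' = -k |v|^(p-2) v` with `k ≥ a` up to an error `δ`. -/
structure IsOscillator (p a C δ s t : ℝ) (v w : ℝ → ℝ) : Prop where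
  continuousOn : ContinuousOn v (Icc s t)
  continuousOn_deriv : ContinuousOn w (Icc s t)
  abs_le : ∀ x ∈ Icc s t, |v x| ≤ 1
  sub_le : ∀ x y, s ≤ x → x ≤ y → y ≤ t → ∀ B, (∀ z ∈ Icc x y, w z ≤ B) →
    v y - v x ≤ B * (y - x)
  le_sub : ∀ x y, s ≤ x → x ≤ y → y ≤ t → ∀ B, (∀ z ∈ Icc x y, B ≤ w z) →
    B * (y - x) ≤ v y - v x
  abs_deriv_sub_le : ∀ x y, s ≤ x → x ≤ y → y ≤ t → ∀ B, (∀ z ∈ Icc x y, |v z| ≤ B) →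
    |w y - w x| ≤ C * B * (y - x)
  deriv_sub_le : ∀ x y, s ≤ x → x ≤ y → y ≤ t → ∀ β, 0 ≤ β → (∀ z ∈ Icc x y, β ≤ v z) →
    w y - w x ≤ (δ - a * β ^ (p - 1)) * (y - x)
  le_deriv_sub : ∀ x y, s ≤ x → x ≤ y → y ≤ t → ∀ β, 0 ≤ β → (∀ z ∈ Icc x y, v z ≤ -β) →
    -((δ - a * β ^ (p - 1)) * (y - x)) ≤ w y - w x

namespace IsBranch

variable {p lam Wbar b M R : ℝ} {v w Wt ρt : ℝ → ℝ}

theorem sub_le (h : IsBranch p lam Wbar b M R v w Wt ρt) {x y B : ℝ} (hx : 0 ≤ x) (hxy : x ≤ y)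
    (hy : y ≤ R) (hB : ∀ z ∈ Icc x y, w z ≤ B) : v y - v x ≤ B * (y - x) := by
  rw [h.sub_eq x ⟨hx, hxy.trans hy⟩ y ⟨hx.trans hxy, hy⟩]
  refine (intervalIntegral.integral_mono_on hxy (ContinuousOn.intervalIntegrable ?_)
    (intervalIntegrable_const (c := B)) hB).trans_eq ?_
  · rw [uIcc_of_le hxy]
    exact h.continuousOn_deriv.mono (Icc_subset_Icc hx hy)
  · simp; ring

theorem le_sub (h : IsBranch p lam Wbar b M R v w Wt ρt) {x y B : ℝ} (hx : 0 ≤ x) (hxy : x ≤ y)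
    (hy : y ≤ R) (hB : ∀ z ∈ Icc x y, B ≤ w z) : B * (y - x) ≤ v y - v x := by
  rw [h.sub_eq x ⟨hx, hxy.trans hy⟩ y ⟨hx.trans hxy, hy⟩]
  refine le_trans (le_of_eq ?_) (intervalIntegral.integral_mono_on hxy
    (intervalIntegrable_const (c := B)) (ContinuousOn.intervalIntegrable ?_) hB)
  · simp; ring
  · rw [uIcc_of_le hxy]
    exact h.continuousOn_deriv.mono (Icc_subset_Icc hx hy)

theorem deriv_sub_le_of_ae (h : IsBranch p lam Wbar b M R v w Wt ρt) {x y B : ℝ} (hx : 0 ≤ x)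
    (hxy : x ≤ y) (hy : y ≤ R) (hB : ∀ᵐ t, t ∈ Icc x y →
      (Wt t + lam) * v t - ρt t * |v t| ^ (p - 2) * v t ≤ B) : w y - w x ≤ B * (y - x) := by
  rw [h.sub_eq' x ⟨hx, hxy.trans hy⟩ y ⟨hx.trans hxy, hy⟩]
  refine (intervalIntegral.integral_mono_ae_restrict hxy
    (h.intervalIntegrable x ⟨hx, hxy.trans hy⟩ y ⟨hx.trans hxy, hy⟩)
    (intervalIntegrable_const (c := B)) ?_).trans_eq ?_
  · exact (ae_restrict_iff' measurableSet_Icc).2 hB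
  · simp; ring

theorem le_deriv_sub_of_ae (h : IsBranch p lam Wbar b M R v w Wt ρt) {x y B : ℝ} (hx : 0 ≤ x)
    (hxy : x ≤ y) (hy : y ≤ R) (hB : ∀ᵐ t, t ∈ Icc x y →
      B ≤ (Wt t + lam) * v t - ρt t * |v t| ^ (p - 2) * v t) : B * (y - x) ≤ w y - w x := by
  rw [h.sub_eq' x ⟨hx, hxy.trans hy⟩ y ⟨hx.trans hxy, hy⟩]
  refine le_trans (le_of_eq ?_) (intervalIntegral.integral_mono_ae_restrict hxy
    (intervalIntegrable_const (c := B))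
    (h.intervalIntegrable x ⟨hx, hxy.trans hy⟩ y ⟨hx.trans hxy, hy⟩) ?_)
  · simp; ring
  · exact (ae_restrict_iff' measurableSet_Icc).2 hB

theorem abs_deriv_sub_le (h : IsBranch p lam Wbar b M R v w Wt ρt) (hp : 2 < p) {x y B : ℝ}
    (hx : 0 ≤ x) (hxy : x ≤ y) (hy : y ≤ R) (hB : ∀ z ∈ Icc x y, |v z| ≤ B) :
    |w y - w x| ≤ (Wbar + |lam| + b * M ^ (p - 2)) * B * (y - x) := by
  have key : ∀ᵐ t, t ∈ Icc x y → |(Wt t + lam) * v t - ρt t * |v t| ^ (p - 2) * v t| ≤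
      (Wbar + |lam| + b * M ^ (p - 2)) * B := by
    filter_upwards [h.W_le, h.ρ_le] with t h1 h2 ht
    have ht' : t ∈ Icc 0 R := ⟨hx.trans ht.1, ht.2.trans hy⟩
    refine (MetricGraph.abs_forcing_le hp (h1 ht') (h2 ht').1 (h2 ht').2
      (h.abs_le t ht')).trans (mul_le_mul_of_nonneg_left (hB t ht) ?_)
    have := (abs_nonneg _).trans (h1 ht')
    have := (h2 ht').1.trans (h2 ht').2
    have := (abs_nonneg _).trans (h.abs_le t ht')
    positivity
  rw [_root_.abs_le]
  constructor
  · rw [← neg_mul]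
    exact h.le_deriv_sub_of_ae hx hxy hy (key.mono fun t ht htm => (_root_.abs_le.1 (ht htm)).1)
  · exact h.deriv_sub_le_of_ae hx hxy hy (key.mono fun t ht htm => (_root_.abs_le.1 (ht htm)).2)

/-- With zero initial slope and |v''| ≤ K M, the slope on [0, t] is at most K M t in size, so v
loses at most K M t². -/
theorem half_le (h : IsBranch p lam Wbar b M R v w Wt ρt) (hp : 2 < p) {t : ℝ} (ht0 : 0 ≤ t)
    (htR : t ≤ R) (ht : (Wbar + |lam| + b * M ^ (p - 2)) * t ^ 2 ≤ 1 / 2) : M / 2 ≤ v t := by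
  set K := Wbar + |lam| + b * M ^ (p - 2) with hK
  have hM0 : 0 ≤ M := (abs_nonneg _).trans (h.abs_le 0 ⟨le_rfl, ht0.trans htR⟩)
  have h1 : ∀ z ∈ Icc 0 t, |w z| ≤ K * M * z := by
    intro z hz
    have := h.abs_deriv_sub_le hp le_rfl hz.1 (hz.2.trans htR) (B := M)
      fun x hx => h.abs_le x ⟨hx.1, hx.2.trans (hz.2.trans htR)⟩
    rwa [h.deriv_zero_eq, sub_zero, sub_zero] at this
  rcases ht0.eq_or_lt with rfl | ht0
  · rw [h.zero_eq]; linarith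
  have hK0 : 0 ≤ K * M := by
    have := (abs_nonneg _).trans (h1 t ⟨ht0.le, le_rfl⟩)
    exact nonneg_of_mul_nonneg_left this ht0
  have h2 := h.le_sub le_rfl ht0.le htR (B := -(K * M * t)) fun z hz => by
    have := (_root_.abs_le.1 (h1 z hz)).1
    have : K * M * z ≤ K * M * t := mul_le_mul_of_nonneg_left hz.2 hK0
    linarith
  rw [h.zero_eq, sub_zero] at h2
  nlinarith [mul_le_mul_of_nonneg_left ht hM0]

/-- Near 0 one has v ≥ M/2, so v'' ≥ ε M/2 and v' ≥ ε (M/2) t; then v rises above its maximum. -/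
theorem false_of_convex (h : IsBranch p lam Wbar b M R v w Wt ρt) (hM : 0 < M) (hR : 0 < R)
    {ε : ℝ} (hε : 0 < ε)
    (hconv : ∀ᵐ t, t ∈ Icc 0 R → ε ≤ Wt t + lam - ρt t * |v t| ^ (p - 2)) : False := by
  have h0 : (0 : ℝ) ∈ Icc 0 R := ⟨le_rfl, hR.le⟩
  obtain ⟨δ, hδ, hδ'⟩ := Metric.continuousOn_iff.1 h.continuousOn 0 h0 (M / 2) (by positivity)
  set r := min R (δ / 2) with hr
  have hr0 : 0 < r := lt_min hR (by positivity)
  have hrR : r ≤ R := min_le_left _ _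
  have hv : ∀ t ∈ Icc 0 r, M / 2 ≤ v t := by
    intro t ht
    have := hδ' t ⟨ht.1, ht.2.trans hrR⟩ (by
      rw [Real.dist_eq, sub_zero, abs_of_nonneg ht.1]
      linarith [ht.2, min_le_right R (δ / 2)])
    rw [Real.dist_eq, h.zero_eq] at this
    linarith [(abs_lt.1 this).1]
  have hw : ∀ t ∈ Icc 0 r, ε * (M / 2) * t ≤ w t := by
    intro t ht
    have := h.le_deriv_sub_of_ae le_rfl ht.1 (ht.2.trans hrR) (B := ε * (M / 2)) (by
      filter_upwards [hconv] with z hz hzm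
      have h1 := hz ⟨hzm.1, hzm.2.trans (ht.2.trans hrR)⟩
      have h2 := hv z ⟨hzm.1, hzm.2.trans ht.2⟩
      have : (Wt z + lam) * v z - ρt z * |v z| ^ (p - 2) * v z =
        (Wt z + lam - ρt z * |v z| ^ (p - 2)) * v z := by ring
      rw [this]
      exact mul_le_mul h1 h2 (by positivity) (hε.le.trans h1))
    rwa [h.deriv_zero_eq, sub_zero, sub_zero] at this
  -- The lower bound on the slope degenerates at 0: on the first half v is only nondecreasing, and
  -- the strict gain comes from the second half.
  have h1 := h.le_sub le_rfl (half_pos hr0).le (by linarith) (B := 0) fun z hz =>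
    le_trans (mul_nonneg (by positivity) hz.1) (hw z ⟨hz.1, by linarith [hz.2]⟩)
  have h2 := h.le_sub (half_pos hr0).le (by linarith) hrR (B := ε * (M / 2) * (r / 2))
    fun z hz => le_trans (mul_le_mul_of_nonneg_left hz.1 (by positivity))
      (hw z ⟨by linarith [hz.1], hz.2⟩)
  have h3 := (le_abs_self _).trans (h.abs_le r ⟨hr0.le, hrR⟩)
  rw [h.zero_eq] at h1
  have : 0 < ε * (M / 2) * (r / 2) * (r - r / 2) := by
    have : 0 < r - r / 2 := by linarith
    positivity
  linarith

/-- The linear term is treated as an error, bounded by its size at height M, while ρ ≥ a makes the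
nonlinear term a restoring force of at least a β^(p-1) where v ≥ β. -/
theorem deriv_sub_le (h : IsBranch p lam Wbar b M R v w Wt ρt) (hp : 2 < p) {a : ℝ} (ha : 0 ≤ a)
    (hρa : ∀ᵐ t, t ∈ Icc 0 R → a ≤ ρt t) {x y β : ℝ} (hx : 0 ≤ x) (hxy : x ≤ y) (hy : y ≤ R)
    (hβ : 0 ≤ β) (hv : ∀ z ∈ Icc x y, β ≤ v z) :
    w y - w x ≤ ((Wbar + |lam|) * M - a * β ^ (p - 1)) * (y - x) := by
  refine h.deriv_sub_le_of_ae hx hxy hy ?_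
  filter_upwards [h.W_le, hρa] with t h1 h2 ht
  have ht' : t ∈ Icc 0 R := ⟨hx.trans ht.1, ht.2.trans hy⟩
  have hvt := hv t ht
  have hv0 := hβ.trans hvt
  have hW0 := (abs_nonneg _).trans (h1 ht')
  have e1 : |v t| ^ (p - 2) * v t = v t ^ (p - 1) := by
    rw [abs_of_nonneg hv0]
    rcases hv0.eq_or_lt with h0 | h0
    · rw [← h0, mul_zero, Real.zero_rpow (by linarith)]
    · rw [← Real.rpow_add_one h0.ne']; ring_nf
  rw [mul_assoc, e1]
  refine sub_le_sub ?_ ?_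
  · refine mul_le_mul ?_ ((le_abs_self _).trans (h.abs_le t ht')) hv0 (by positivity)
    exact add_le_add ((le_abs_self _).trans (h1 ht')) (le_abs_self _)
  · exact mul_le_mul (h2 ht') (Real.rpow_le_rpow hβ hvt (by linarith)) (by positivity)
      (ha.trans (h2 ht'))

theorem le_deriv_sub (h : IsBranch p lam Wbar b M R v w Wt ρt) (hp : 2 < p) {a : ℝ} (ha : 0 ≤ a)
    (hρa : ∀ᵐ t, t ∈ Icc 0 R → a ≤ ρt t) {x y β : ℝ} (hx : 0 ≤ x) (hxy : x ≤ y) (hy : y ≤ R)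
    (hβ : 0 ≤ β) (hv : ∀ z ∈ Icc x y, v z ≤ -β) :
    -(((Wbar + |lam|) * M - a * β ^ (p - 1)) * (y - x)) ≤ w y - w x := by
  rw [← neg_mul]
  refine h.le_deriv_sub_of_ae hx hxy hy ?_
  filter_upwards [h.W_le, hρa] with t h1 h2 ht
  have ht' : t ∈ Icc 0 R := ⟨hx.trans ht.1, ht.2.trans hy⟩
  have hvt : β ≤ -v t := by linarith [hv t ht]
  have hv0 := hβ.trans hvt
  have hW0 := (abs_nonneg _).trans (h1 ht')
  have e1 : |v t| ^ (p - 2) * (-v t) = (-v t) ^ (p - 1) := by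
    rw [← abs_neg, abs_of_nonneg hv0]
    rcases hv0.eq_or_lt with h0 | h0
    · rw [← h0, mul_zero, Real.zero_rpow (by linarith)]
    · rw [← Real.rpow_add_one h0.ne']; ring_nf
  have e2 : (Wt t + lam) * v t - ρt t * |v t| ^ (p - 2) * v t =
      -((Wt t + lam) * (-v t) - ρt t * (|v t| ^ (p - 2) * (-v t))) := by ring
  rw [e2, e1]
  refine neg_le_neg (sub_le_sub ?_ ?_)
  · refine mul_le_mul ?_ ((neg_le_abs _).trans (h.abs_le t ht')) hv0 (by positivity)
    exact add_le_add ((le_abs_self _).trans (h1 ht')) (le_abs_self _)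
  · exact mul_le_mul (h2 ht') (Real.rpow_le_rpow hβ hvt (by linarith)) (by positivity)
      (ha.trans (h2 ht'))

/-- Heights are measured in units of M and lengths in units of r, with r² M^(p-2) = 1. The nonlinear
term is invariant under this scaling, while the linear one acquires the factor r², hence the error
δ. -/
theorem isOscillator (h : IsBranch p lam Wbar b M R v w Wt ρt) (hp : 2 < p) {a : ℝ} (ha : 0 ≤ a)
    (hρa : ∀ᵐ t, t ∈ Icc 0 R → a ≤ ρt t) (hM : 0 < M) {r T C δ : ℝ} (hr : 0 < r)
    (hrM : r ^ 2 * M ^ (p - 2) = 1) (hT : r * T ≤ R) (hδ : (Wbar + |lam|) * r ^ 2 ≤ δ)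
    (hC : δ + b ≤ C) :
    IsOscillator p a C δ 0 T (fun t => v (r * t) / M) (fun t => r * w (r * t) / M) := by
  have hm : ∀ {t}, 0 ≤ t → t ≤ T → r * t ∈ Icc 0 R := fun {t} h0 hT' =>
    ⟨by positivity, (mul_le_mul_of_nonneg_left hT' hr.le).trans hT⟩
  have hmt : MapsTo (fun t => r * t) (Icc 0 T) (Icc 0 R) := fun t ht => hm ht.1 ht.2
  have hz : ∀ {x y z : ℝ}, z ∈ Icc (r * x) (r * y) → z / r ∈ Icc x y ∧ r * (z / r) = z :=
    fun {x y z} hz => ⟨⟨by rw [le_div_iff₀ hr]; linarith [hz.1],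
      by rw [div_le_iff₀ hr]; linarith [hz.2]⟩, by field_simp⟩
  have hrw : ∀ β, 0 ≤ β → (M * β) ^ (p - 1) * (r ^ 2 / M) = β ^ (p - 1) := fun β hβ => by
    rw [Real.mul_rpow hM.le hβ, show p - 1 = p - 2 + 1 by ring, Real.rpow_add_one hM.ne']
    calc _ = (r ^ 2 * M ^ (p - 2)) * β ^ (p - 2 + 1) := by field_simp
      _ = _ := by rw [hrM, one_mul]
  refine ⟨?_, ?_, fun x hx => ?_, fun x y hx hxy hy B hB => ?_, fun x y hx hxy hy B hB => ?_,
    fun x y hx hxy hy B hB => ?_, fun x y hx hxy hy β hβ hv => ?_,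
    fun x y hx hxy hy β hβ hv => ?_⟩
  · exact (h.continuousOn.comp (by fun_prop) hmt).div_const _
  · exact (continuousOn_const.mul (h.continuousOn_deriv.comp (by fun_prop) hmt)).div_const _
  · rw [abs_div, abs_of_pos hM, div_le_one hM]
    exact h.abs_le _ (hmt hx)
  all_goals
    have hx' := hm hx (hxy.trans hy)
    have hy' := hm (hx.trans hxy) hy
    have hxy' := mul_le_mul_of_nonneg_left hxy hr.le
  · have := h.sub_le hx'.1 hxy' hy'.2 (B := B * M / r) fun z hzm => by
      obtain ⟨h1, h2⟩ := hz hzm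
      have := hB _ h1
      rw [h2, div_le_iff₀ hM] at this
      rw [le_div_iff₀ hr]; linarith
    rw [← sub_div, div_le_iff₀ hM]
    refine this.trans_eq ?_
    field_simp
  · have := h.le_sub hx'.1 hxy' hy'.2 (B := B * M / r) fun z hzm => by
      obtain ⟨h1, h2⟩ := hz hzm
      have := hB _ h1
      rw [h2, le_div_iff₀ hM] at this
      rw [div_le_iff₀ hr]; linarith
    rw [← sub_div, le_div_iff₀ hM]
    refine le_trans (le_of_eq ?_) this
    field_simp
  · have := h.abs_deriv_sub_le hp hx'.1 hxy' hy'.2 (B := M * B) fun z hzm => by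
      obtain ⟨h1, h2⟩ := hz hzm
      have := hB _ h1
      rwa [h2, abs_div, abs_of_pos hM, div_le_iff₀ hM, mul_comm] at this
    have hB0 : 0 ≤ B := (abs_nonneg _).trans (hB x ⟨le_rfl, hxy⟩)
    rw [← sub_div, ← mul_sub, abs_div, abs_mul, abs_of_pos hM, abs_of_pos hr]
    calc r * |w (r * y) - w (r * x)| / M
        ≤ r * ((Wbar + |lam| + b * M ^ (p - 2)) * (M * B) * (r * y - r * x)) / M := by gcongr
      _ = ((Wbar + |lam|) * r ^ 2 + b * (r ^ 2 * M ^ (p - 2))) * B * (y - x) := by field_simp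
      _ ≤ C * B * (y - x) := by
        rw [hrM]
        have : 0 ≤ y - x := sub_nonneg.2 hxy
        gcongr
        linarith
  · have := h.deriv_sub_le hp ha hρa hx'.1 hxy' hy'.2 (β := M * β) (by positivity) fun z hzm => by
      obtain ⟨h1, h2⟩ := hz hzm
      have := hv _ h1
      rwa [h2, le_div_iff₀ hM, mul_comm] at this
    rw [← sub_div, ← mul_sub]
    have h0 : 0 ≤ y - x := sub_nonneg.2 hxy
    calc r * (w (r * y) - w (r * x)) / M
        ≤ r * (((Wbar + |lam|) * M - a * (M * β) ^ (p - 1)) * (r * y - r * x)) / M := by gcongr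
      _ = ((Wbar + |lam|) * r ^ 2 - a * ((M * β) ^ (p - 1) * (r ^ 2 / M))) * (y - x) := by
        field_simp
      _ ≤ _ := by
        rw [hrw β hβ]
        gcongr
  · have := h.le_deriv_sub hp ha hρa hx'.1 hxy' hy'.2 (β := M * β) (by positivity) fun z hzm => by
      obtain ⟨h1, h2⟩ := hz hzm
      have := hv _ h1
      rw [h2, div_le_iff₀ hM] at this
      linarith
    rw [← sub_div, ← mul_sub]
    have h0 : 0 ≤ y - x := sub_nonneg.2 hxy
    calc -((δ - a * β ^ (p - 1)) * (y - x))
        ≤ -(((Wbar + |lam|) * r ^ 2 - a * ((M * β) ^ (p - 1) * (r ^ 2 / M))) * (y - x)) := by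
          rw [hrw β hβ]
          gcongr
      _ = r * (-(((Wbar + |lam|) * M - a * (M * β) ^ (p - 1)) * (r * y - r * x))) / M := by
        field_simp
      _ ≤ r * (w (r * y) - w (r * x)) / M := by gcongr

end IsBranch

/-! ### Oscillation: many zeros in a bounded time. -/

namespace IsOscillator

variable {p a C δ s t : ℝ} {v w : ℝ → ℝ}

theorem neg (h : IsOscillator p a C δ s t v w) :
    IsOscillator p a C δ s t (fun x => -v x) (fun x => -w x) where
  continuousOn := h.continuousOn.neg
  continuousOn_deriv := h.continuousOn_deriv.neg
  abs_le x hx := by rw [abs_neg]; exact h.abs_le x hx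
  sub_le x y hx hxy hy B hB := by
    have := h.le_sub x y hx hxy hy (-B) fun z hz => by linarith [hB z hz]
    linarith
  le_sub x y hx hxy hy B hB := by
    have := h.sub_le x y hx hxy hy (-B) fun z hz => by linarith [hB z hz]
    linarith
  abs_deriv_sub_le x y hx hxy hy B hB := by
    have := h.abs_deriv_sub_le x y hx hxy hy B fun z hz => by simpa using hB z hz
    rwa [neg_sub_neg, abs_sub_comm]
  deriv_sub_le x y hx hxy hy β hβ hv := by
    have := h.le_deriv_sub x y hx hxy hy β hβ fun z hz => by linarith [hv z hz]
    linarith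
  le_deriv_sub x y hx hxy hy β hβ hv := by
    have := h.deriv_sub_le x y hx hxy hy β hβ fun z hz => by linarith [hv z hz]
    linarith

theorem mono (h : IsOscillator p a C δ s t v w) {s' t' : ℝ} (hs : s ≤ s') (ht : t' ≤ t) :
    IsOscillator p a C δ s' t' v w where
  continuousOn := h.continuousOn.mono (Icc_subset_Icc hs ht)
  continuousOn_deriv := h.continuousOn_deriv.mono (Icc_subset_Icc hs ht)
  abs_le x hx := h.abs_le x ⟨hs.trans hx.1, hx.2.trans ht⟩
  sub_le x y hx hxy hy := h.sub_le x y (hs.trans hx) hxy (hy.trans ht)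
  le_sub x y hx hxy hy := h.le_sub x y (hs.trans hx) hxy (hy.trans ht)
  abs_deriv_sub_le x y hx hxy hy := h.abs_deriv_sub_le x y (hs.trans hx) hxy (hy.trans ht)
  deriv_sub_le x y hx hxy hy := h.deriv_sub_le x y (hs.trans hx) hxy (hy.trans ht)
  le_deriv_sub x y hx hxy hy := h.le_deriv_sub x y (hs.trans hx) hxy (hy.trans ht)

theorem abs_sub_le (h : IsOscillator p a C δ s t v w) {x y B : ℝ} (hx : s ≤ x) (hxy : x ≤ y)
    (hy : y ≤ t) (hB : ∀ z ∈ Icc x y, |w z| ≤ B) : |v y - v x| ≤ B * (y - x) := by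
  rw [_root_.abs_le, ← neg_mul]
  exact ⟨h.le_sub x y hx hxy hy (-B) fun z hz => (_root_.abs_le.1 (hB z hz)).1,
    h.sub_le x y hx hxy hy B fun z hz => (_root_.abs_le.1 (hB z hz)).2⟩

/-- A Gronwall step run backwards. If Y is the maximum of |v| + |w| on [x, y], attained at z, then Y
≤ |v y| + |w y| + (1 + C)(y - z) Y, and the last term is at most Y/2. -/
theorem add_abs_le_two_mul (h : IsOscillator p a C δ s t v w) (hC : 0 ≤ C) {x y : ℝ}
    (hx : s ≤ x) (hxy : x ≤ y) (hy : y ≤ t) (hstep : (1 + C) * (y - x) ≤ 1 / 2) :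
    |v x| + |w x| ≤ 2 * (|v y| + |w y|) := by
  obtain ⟨z, hz, hmax⟩ := isCompact_Icc.exists_isMaxOn (nonempty_Icc.2 hxy)
    ((h.continuousOn.abs.add h.continuousOn_deriv.abs).mono (Icc_subset_Icc hx hy))
  set Y := |v z| + |w z| with hY
  have hle : ∀ q ∈ Icc x y, |v q| + |w q| ≤ Y := fun q hq => hmax hq
  have hY0 : 0 ≤ Y := by positivity
  have h1 := h.abs_sub_le (hx.trans hz.1) hz.2 hy (B := Y) fun q hq =>
    (le_add_of_nonneg_left (abs_nonneg _)).trans (hle q ⟨hz.1.trans hq.1, hq.2⟩)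
  have h2 := h.abs_deriv_sub_le z y (hx.trans hz.1) hz.2 hy Y fun q hq =>
    (le_add_of_nonneg_right (abs_nonneg _)).trans (hle q ⟨hz.1.trans hq.1, hq.2⟩)
  have h3 : |v z| ≤ |v y| + |v y - v z| := by
    have := abs_sub_abs_le_abs_sub (v z) (v y)
    rw [abs_sub_comm] at this; linarith
  have h4 : |w z| ≤ |w y| + |w y - w z| := by
    have := abs_sub_abs_le_abs_sub (w z) (w y)
    rw [abs_sub_comm] at this; linarith
  have h5 : (1 + C) * (y - z) * Y ≤ 1 / 2 * Y := by
    refine mul_le_mul_of_nonneg_right (le_trans ?_ hstep) hY0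
    exact mul_le_mul_of_nonneg_left (by linarith [hz.1]) (by linarith)
  have h6 := hle x ⟨le_rfl, hxy⟩
  nlinarith

/-- Iterating the doubling step bounds from below the size of (v, w) that survives after a bounded
time; this lets the search for zeros restart at each zero found. -/
theorem le_pow_mul_add_abs (h : IsOscillator p a C δ s t v w) (hC : 0 ≤ C) (n : ℕ) {y : ℝ}
    (hsy : s ≤ y) (hyt : y ≤ t) (hn : (1 + C) * (y - s) ≤ n / 2) :
    |v s| + |w s| ≤ 2 ^ n * (|v y| + |w y|) := by
  induction n generalizing y with
  | zero =>
    have : y = s := by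
      simp only [Nat.cast_zero, zero_div] at hn
      nlinarith
    simp [this]
  | succ n ih =>
    have hC1 : 0 < 1 + C := by linarith
    set y' := max s (y - 1 / (2 * (1 + C))) with hy'
    have h1 : s ≤ y' := le_max_left _ _
    have h2 : y' ≤ y := max_le hsy (by
      have : 0 < 1 / (2 * (1 + C)) := by positivity
      linarith)
    have e : (1 + C) * (1 / (2 * (1 + C))) = 1 / 2 := by field_simp
    have h3 := h.add_abs_le_two_mul hC h1 h2 hyt (by
      have := mul_le_mul_of_nonneg_left (le_max_right s (y - 1 / (2 * (1 + C)))) hC1.le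
      rw [mul_sub, e] at this
      linarith)
    have h4 := ih h1 (h2.trans hyt) (by
      rcases max_choice s (y - 1 / (2 * (1 + C))) with h | h
      · rw [hy', h]; simp only [sub_self, mul_zero]; positivity
      · rw [hy', h]; push_cast at hn
        have : (1 + C) * (y - 1 / (2 * (1 + C)) - s) = (1 + C) * (y - s) - 1 / 2 := by
          rw [← e]; ring
        linarith)
    calc _ ≤ 2 ^ n * (|v y'| + |w y'|) := h4
      _ ≤ 2 ^ n * (2 * (|v y| + |w y|)) := by gcongr
      _ = _ := by ring

/-- If v vanished on an interval to the right of x, so would w, whereas |v| + |w| is positive at x.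
-/
theorem exists_ne_zero (h : IsOscillator p a C δ s t v w) {x y : ℝ} (hx : s ≤ x) (hxy : x < y)
    (hy : y ≤ t) (hx0 : 0 < |v x| + |w x|) (hvx : v x = 0) : ∃ q ∈ Ioo x y, v q ≠ 0 := by
  by_contra! hcon
  set m := (x + y) / 2 with hm
  have hxm : x < m := by linarith
  have hmy : m < y := by linarith
  have hz : ∀ q ∈ Icc x m, v q = 0 := fun q hq => by
    rcases hq.1.eq_or_lt with rfl | h1
    · exact hvx
    · exact hcon q ⟨h1, hq.2.trans_lt hmy⟩
  have hw : ∀ q ∈ Icc x m, w q = w x := fun q hq => by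
    have := h.abs_deriv_sub_le x q hx hq.1 (hq.2.trans (hmy.le.trans hy)) 0 fun z hzm => by
      rw [hz z ⟨hzm.1, hzm.2.trans hq.2⟩, abs_zero]
    rw [mul_zero, zero_mul] at this
    exact sub_eq_zero.1 (abs_nonpos_iff.1 this)
  have h1 := h.sub_le x m hx hxm.le (hmy.le.trans hy) (w x) fun q hq => (hw q hq).le
  have h2 := h.le_sub x m hx hxm.le (hmy.le.trans hy) (w x) fun q hq => (hw q hq).ge
  rw [hz m ⟨hxm.le, le_rfl⟩, hvx, sub_zero] at h1 h2
  have h3 : w x = 0 := by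
    have : w x * (m - x) = 0 := le_antisymm h2 h1
    exact (mul_eq_zero.1 this).resolve_right (by linarith)
  rw [hvx, h3] at hx0
  simp at hx0

end IsOscillator

/-- A nonnegative v is almost concave, so once its slope is visibly negative it must cross zero.
Hence the slope stays above -κ for a long time. Meanwhile v reaches a height β and remains above β/2
during a time D, in which the restoring force brings the slope below -1 ≤ -κ. The constants are
chosen in the order τ, β, g, D, κ, T, δ₀ and depend only on p, a, C, f. -/
theorem exists_time_not_nonneg {p a C f : ℝ} (hp : 1 < p) (ha : 0 < a) (hC : 0 ≤ C) (hf : 0 < f) :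
    ∃ T > 0, ∃ δ₀ > 0, ∀ (δ s : ℝ) (v w : ℝ → ℝ), δ ≤ δ₀ → IsOscillator p a C δ s (s + T) v w →
      f ≤ |v s| + |w s| → ¬ ∀ z ∈ Icc s (s + T), 0 ≤ v z := by
  set τ := f / (4 * (C + 1)) with hτ
  have hτ0 : 0 < τ := by positivity
  set β := min (f / 2) (τ * f / 4) with hβ
  have hβ0 : 0 < β := lt_min (by positivity) (by positivity)
  set g := a * (β / 2) ^ (p - 1) with hg
  have hg0 : 0 < g := by positivity
  set D := 2 * (C + 2) / g with hD
  have hD0 : 0 < D := by positivity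
  set κ := min 1 (min (f / 4) (β / (2 * D))) with hκ
  have hκ0 : 0 < κ := lt_min one_pos (lt_min (by positivity) (by positivity))
  have hκ1 : κ ≤ 1 := min_le_left _ _
  have hκf : κ ≤ f / 4 := (min_le_right _ _).trans (min_le_left _ _)
  have hκD : κ * D ≤ β / 2 := by
    have : κ ≤ β / (2 * D) := (min_le_right _ _).trans (min_le_right _ _)
    rw [le_div_iff₀ (by positivity)] at this
    linarith
  set T := 2 * (τ + D + 1) + 8 / κ with hT
  have h8 : 0 < 8 / κ := by positivity
  have hT0 : 0 < T := by positivity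
  refine ⟨T, hT0, min (κ / (2 * T)) (g / 2), lt_min (by positivity) (by positivity), ?_⟩
  intro δ s v w hδ h hfs hv
  have hδT : δ * T ≤ κ / 2 := by
    have := hδ.trans (min_le_left _ _)
    rw [le_div_iff₀ (by positivity)] at this
    linarith
  have hδg : δ ≤ g / 2 := hδ.trans (min_le_right _ _)
  -- A slope ≤ -κ at x stays ≤ -κ/2, since it can recover at most δ T ≤ κ/2. The remaining time is
  -- at least 4/κ, so v falls by 2, although 0 ≤ v ≤ 1.
  have step1 : ∀ x, s ≤ x → x ≤ s + T / 2 → -κ < w x := by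
    intro x hx hxT
    by_contra! hcon
    have h1 : ∀ z ∈ Icc x (s + T), w z ≤ -(κ / 2) := by
      intro z hz
      have := h.deriv_sub_le x z hx hz.1 hz.2 0 le_rfl fun q hq =>
        hv q ⟨hx.trans hq.1, hq.2.trans hz.2⟩
      rw [Real.zero_rpow (by linarith), mul_zero, sub_zero] at this
      have h2 : δ * (z - x) ≤ κ / 2 := by
        rcases le_total δ 0 with hδ0 | hδ0
        · exact (mul_nonpos_of_nonpos_of_nonneg hδ0 (sub_nonneg.2 hz.1)).trans (by positivity)
        · exact (mul_le_mul_of_nonneg_left (by linarith [hz.2]) hδ0).trans hδT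
      linarith
    have h2 := h.sub_le x (s + T) hx (by linarith) le_rfl _ h1
    have h3 := (le_abs_self _).trans (h.abs_le x ⟨hx, by linarith⟩)
    have h4 := hv (s + T) ⟨by linarith, le_rfl⟩
    have h5 : κ / 2 * (8 / κ / 2) ≤ κ / 2 * (s + T - x) := by
      refine mul_le_mul_of_nonneg_left ?_ (by positivity)
      linarith
    have h6 : κ / 2 * (8 / κ / 2) = 2 := by field_simp; norm_num
    linarith
  -- If v is below f/2 at s, then |w s| ≥ f/2, and w s > -κ ≥ -f/4 excludes the negative sign; the
  -- slope stays at least f/4 during the time τ.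
  have step2 : ∃ s₁, s ≤ s₁ ∧ s₁ ≤ s + τ ∧ β ≤ v s₁ := by
    by_cases hvs : f / 2 ≤ v s
    · exact ⟨s, le_rfl, by linarith, (min_le_left _ _).trans hvs⟩
    push Not at hvs
    have hv0 := hv s ⟨le_rfl, by linarith⟩
    rw [abs_of_nonneg hv0] at hfs
    have hw := step1 s le_rfl (by linarith)
    have hws : f / 2 ≤ w s := by
      rcases abs_cases (w s) with ⟨h1, _⟩ | ⟨h1, _⟩ <;> rw [h1] at hfs <;> linarith
    have h1 : ∀ z ∈ Icc s (s + τ), f / 4 ≤ w z := by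
      intro z hz
      have := h.abs_deriv_sub_le s z le_rfl hz.1 (by linarith [hz.2]) 1 fun q hq =>
        h.abs_le q ⟨hq.1, by linarith [hz.2, hq.2]⟩
      have h2 : C * 1 * (z - s) ≤ f / 4 := by
        calc C * 1 * (z - s) ≤ (C + 1) * τ := by
              rw [mul_one]
              exact mul_le_mul (by linarith) (by linarith [hz.2]) (by linarith [hz.1])
                (by linarith)
          _ = f / 4 := by rw [hτ]; field_simp
      have := (abs_le.1 this).1
      linarith
    have h2 := h.le_sub s (s + τ) le_rfl (by linarith) (by linarith) _ h1
    refine ⟨s + τ, by linarith, le_rfl, (min_le_right _ _).trans ?_⟩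
    have : f / 4 * (s + τ - s) = τ * f / 4 := by ring
    linarith
  obtain ⟨s₁, hs₁, hs₁τ, hβs₁⟩ := step2
  -- A larger slope would still exceed 1 after unit time, and v would leave [-1, 1].
  have hw1 : w s₁ ≤ 1 + C := by
    by_contra! hcon
    have h1 : ∀ z ∈ Icc s₁ (s₁ + 1), w s₁ - C ≤ w z := by
      intro z hz
      have := h.abs_deriv_sub_le s₁ z hs₁ hz.1 (by linarith [hz.2]) 1 fun q hq =>
        h.abs_le q ⟨hs₁.trans hq.1, by linarith [hz.2, hq.2]⟩
      have h2 : C * 1 * (z - s₁) ≤ C := by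
        rw [mul_one]
        exact mul_le_of_le_one_right hC (by linarith [hz.2])
      have := (abs_le.1 this).1
      linarith
    have h2 := h.le_sub s₁ (s₁ + 1) hs₁ (by linarith) (by linarith) _ h1
    have h3 := (le_abs_self _).trans (h.abs_le (s₁ + 1) ⟨by linarith, by linarith⟩)
    have h4 : (w s₁ - C) * (s₁ + 1 - s₁) = w s₁ - C := by ring
    linarith
  have h1 : ∀ z ∈ Icc s₁ (s₁ + D), β / 2 ≤ v z := by
    intro z hz
    have h2 := h.le_sub s₁ z hs₁ hz.1 (by linarith [hz.2]) (-κ) fun q hq =>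
      (step1 q (hs₁.trans hq.1) (by linarith [hz.2, hq.2])).le
    have h3 : κ * (z - s₁) ≤ κ * D := mul_le_mul_of_nonneg_left (by linarith [hz.2]) hκ0.le
    linarith
  have h2 := h.deriv_sub_le s₁ (s₁ + D) hs₁ (by linarith) (by linarith) (β / 2) (by positivity) h1
  have h3 := step1 (s₁ + D) (by linarith) (by linarith)
  have h4 : (δ - g) * (s₁ + D - s₁) ≤ -(C + 2) := by
    have e : -(g / 2) * D = -(C + 2) := by rw [hD]; field_simp
    rw [← e, add_sub_cancel_left]
    exact mul_le_mul_of_nonneg_right (by linarith) hD0.le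
  linarith

theorem exists_time_exists_zero {p a C f : ℝ} (hp : 1 < p) (ha : 0 < a) (hC : 0 ≤ C)
    (hf : 0 < f) :
    ∃ T > 0, ∃ δ₀ > 0, ∀ (δ s : ℝ) (v w : ℝ → ℝ), δ ≤ δ₀ → IsOscillator p a C δ s (s + T) v w →
      f ≤ |v s| + |w s| → ∃ z ∈ Ioc s (s + T), v z = 0 := by
  obtain ⟨T, hT, δ₀, hδ₀, key⟩ := exists_time_not_nonneg hp ha hC hf
  refine ⟨T, hT, δ₀, hδ₀, fun δ s v w hδ h hfs => ?_⟩
  by_contra! hcon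
  -- The starting point may itself be a zero and is excluded from the search; the sign of v there is
  -- recovered by continuity.
  have hcl : Icc s (s + T) = closure (Ioc s (s + T)) := (closure_Ioc (by linarith)).symm
  have hpos : (∀ z ∈ Ioc s (s + T), 0 < v z) ∨ ∀ z ∈ Ioc s (s + T), v z < 0 := by
    by_contra! hmix
    obtain ⟨⟨x, hx, hx'⟩, y, hy, hy'⟩ := hmix
    obtain ⟨z, hz, hz0⟩ := isPreconnected_Ioc.intermediate_value hx hy
      (h.continuousOn.mono Ioc_subset_Icc_self) ⟨hx', hy'⟩
    exact hcon z hz hz0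
  rcases hpos with hpos | hneg
  · refine key δ s v w hδ h hfs fun z hz => ?_
    exact ContinuousWithinAt.closure_le (s := Ioc s (s + T)) (f := fun _ => (0 : ℝ))
      (by rw [← hcl]; exact hz) continuousWithinAt_const
      ((h.continuousOn z hz).mono Ioc_subset_Icc_self) fun q hq => (hpos q hq).le
  · refine key δ s _ _ hδ h.neg (by simpa using hfs) fun z hz => neg_nonneg.2 ?_
    exact ContinuousWithinAt.closure_le (s := Ioc s (s + T)) (g := fun _ => (0 : ℝ))
      (by rw [← hcl]; exact hz) ((h.continuousOn z hz).mono Ioc_subset_Icc_self)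
      continuousWithinAt_const fun q hq => (hneg q hq).le

/-- Induction on the number of zeros: find one, then restart there with the smaller threshold f /
2^n left by `le_pow_mul_add_abs`. -/
theorem exists_time_exists_zeros {p a C : ℝ} (hp : 1 < p) (ha : 0 < a) (hC : 0 ≤ C) (m : ℕ)
    {f : ℝ} (hf : 0 < f) :
    ∃ T > 0, ∃ δ₀ > 0, ∀ (δ s : ℝ) (v w : ℝ → ℝ), δ ≤ δ₀ → IsOscillator p a C δ s (s + T) v w →
      f ≤ |v s| + |w s| → ∃ z : ℕ → ℝ, (∀ i < m, z i ∈ Ioc s (s + T) ∧ v (z i) = 0) ∧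
        ∀ i, i + 1 < m → z i < z (i + 1) ∧ ∃ x ∈ Ioo (z i) (z (i + 1)), v x ≠ 0 := by
  induction m generalizing f with
  | zero => exact ⟨1, one_pos, 1, one_pos, fun _ _ _ _ _ _ _ => ⟨0, by simp, by simp⟩⟩
  | succ m ih =>
    obtain ⟨T₁, hT₁, δ₁, hδ₁, h₁⟩ := exists_time_exists_zero hp ha hC hf
    obtain ⟨n, hn⟩ := exists_nat_ge (2 * ((1 + C) * T₁))
    obtain ⟨T₂, hT₂, δ₂, hδ₂, h₂⟩ := ih (f := f / 2 ^ n) (by positivity)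
    refine ⟨T₁ + T₂, by positivity, min δ₁ δ₂, lt_min hδ₁ hδ₂, fun δ s v w hδ h hfs => ?_⟩
    obtain ⟨z₀, hz₀, hz₀v⟩ := h₁ δ s v w (hδ.trans (min_le_left _ _))
      (h.mono le_rfl (by linarith)) hfs
    have hlow : f / 2 ^ n ≤ |v z₀| + |w z₀| := by
      rw [div_le_iff₀ (by positivity), mul_comm]
      refine hfs.trans (h.le_pow_mul_add_abs hC n hz₀.1.le (by linarith [hz₀.2]) ?_)
      have : (1 + C) * (z₀ - s) ≤ (1 + C) * T₁ :=
        mul_le_mul_of_nonneg_left (by linarith [hz₀.2]) (by linarith)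
      linarith
    have hlow0 : 0 < |v z₀| + |w z₀| := lt_of_lt_of_le (by positivity) hlow
    obtain ⟨z, hz, hz'⟩ := h₂ δ z₀ v w (hδ.trans (min_le_right _ _))
      (h.mono hz₀.1.le (by linarith [hz₀.2])) hlow
    refine ⟨fun i => Nat.casesOn i z₀ z, fun i hi => ?_, fun i hi => ?_⟩
    · cases i with
      | zero => exact ⟨⟨hz₀.1, hz₀.2.trans (by linarith)⟩, hz₀v⟩
      | succ i =>
        have := hz i (by omega)
        exact ⟨⟨hz₀.1.trans this.1.1, by linarith [this.1.2, hz₀.2]⟩, this.2⟩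
    · cases i with
      | zero =>
        have := (hz 0 (by omega)).1
        exact ⟨this.1, h.exists_ne_zero hz₀.1.le this.1 (by linarith [this.2, hz₀.2]) hlow0 hz₀v⟩
      | succ i => exact hz' i (by omega)

/-! ### Localized energy identities and negative directions. -/

namespace MetricGraph

variable {V E : Type*} {G : MetricGraph V E}

theorem isArcFunction_of_hasDerivAt {e : E} {s t : ℝ} {F H : ℝ → ℝ} (hs : s ∈ G.interval e)
    (ht : t ∈ G.interval e) (hst : s < t) (hF : ContinuousOn F (Icc s t))
    (hH : ContinuousOn H (Icc s t)) (hFs : F s = 0) (hFt : F t = 0)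
    (hd : ∀ x ∈ Ioo s t, HasDerivAt F (H x) x) : G.IsArcFunction e s t F H := by
  refine ⟨hs, ht, hst, hF, hH, hFs, hFt, ?_⟩
  have key : ∀ x ∈ Icc s t, ∀ y ∈ Icc s t, x ≤ y → F y - F x = ∫ z in x..y, H z := by
    intro x hx y hy hxy
    have hsub : Icc x y ⊆ Icc s t := Icc_subset_Icc hx.1 hy.2
    refine (intervalIntegral.integral_eq_sub_of_hasDerivAt_of_le hxy (hF.mono hsub)
      (fun z hz => hd z ⟨hx.1.trans_lt hz.1, hz.2.trans_le hy.2⟩) ?_).symm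
    refine ContinuousOn.intervalIntegrable ?_
    rw [uIcc_of_le hxy]
    exact hH.mono hsub
  intro x hx y hy
  rcases le_total x y with h | h
  · exact key x hx y hy h
  · rw [intervalIntegral.integral_symm, ← key y hy x hx h]; ring

/-- Test the equation with u η² and use u' (u η²)' = ((u η)')² - (u η')². Only the product u η has
to vanish at the ends, which allows both cutoffs and arcs between zeros of u. -/
theorem IsSolution.integral_energy_eq [Fintype E] {p lam : ℝ} {W ρ u d : E → ℝ → ℝ} (hp : 2 < p)
    (hW : G.MemLInfty W) (hρ : G.MemLInfty ρ) (hu : G.IsSolution p W ρ lam u)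
    (hd : G.IsClassicalDeriv p W ρ lam u d) {e : E} {s t : ℝ} {η η' : ℝ → ℝ}
    (hs : s ∈ G.interval e) (ht : t ∈ G.interval e) (hst : s < t)
    (hη : ∀ x, HasDerivAt η (η' x) x) (hη' : Continuous η') (h0s : u e s * η s = 0)
    (h0t : u e t * η t = 0) :
    G.IsArcFunction e s t (fun x => u e x * η x) (fun x => d e x * η x + u e x * η' x) ∧
    IntegrableOn (fun x => ρ e x * |u e x| ^ (p - 2) * (u e x * η x) ^ 2) (Ioo s t) ∧
    ∫ x in Ioo s t, ((d e x * η x + u e x * η' x) ^ 2 + (W e x + lam) * (u e x * η x) ^ 2) =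
      (∫ x in Ioo s t, ρ e x * |u e x| ^ (p - 2) * (u e x * η x) ^ 2) +
        ∫ x in Ioo s t, (u e x * η' x) ^ 2 := by
  have hI := G.Icc_subset_interval hs ht
  have cu := (hu.1.continuousOn e).mono hI
  have cd := (hd.continuousOn e).mono hI
  have cη : Continuous η := continuous_iff_continuousAt.2 fun x => (hη x).continuousAt
  have hud : ∀ x ∈ Ioo s t, HasDerivAt (u e) (d e x) x := fun x hx =>
    hd.hasDerivAt (G.Ioo_subset_openInterval hs ht hx)
  have A1 : G.IsArcFunction e s t (fun x => u e x * η x)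
      (fun x => d e x * η x + u e x * η' x) :=
    isArcFunction_of_hasDerivAt hs ht hst (cu.mul cη.continuousOn)
      ((cd.mul cη.continuousOn).add (cu.mul hη'.continuousOn)) h0s h0t
      fun x hx => (hud x hx).mul (hη x)
  have A2 : G.IsArcFunction e s t (fun x => u e x * η x * η x)
      (fun x => (d e x * η x + u e x * η' x) * η x + u e x * η x * η' x) := by
    refine isArcFunction_of_hasDerivAt hs ht hst ((cu.mul cη.continuousOn).mul cη.continuousOn)
      ?_ (by simp only [h0s, zero_mul]) (by simp only [h0t, zero_mul])
      fun x hx => ((hud x hx).mul (hη x)).mul (hη x)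
    exact (((cd.mul cη.continuousOn).add (cu.mul hη'.continuousOn)).mul cη.continuousOn).add
      ((cu.mul cη.continuousOn).mul hη'.continuousOn)
  have i1 : IntegrableOn (fun x => ρ e x * |u e x| ^ (p - 2) * (u e x * η x) ^ 2) (Ioo s t) :=
    integrableOn_mul_of_continuousOn hs ht
      (locallyIntegrableOn_power_part hρ hp (hu.1.continuousOn e)) ((cu.mul cη.continuousOn).pow 2)
  refine ⟨A1, i1, ?_⟩
  have key := A2.weak_form hu
  have i2 : IntegrableOn (fun x => (u e x * η' x) ^ 2) (Ioo s t) :=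
    (((cu.mul hη'.continuousOn).pow 2).integrableOn_compact isCompact_Icc).mono_set
      Ioo_subset_Icc_self
  have i3 : IntegrableOn (fun x => (W e x + lam) * (u e x * η x) ^ 2) (Ioo s t) :=
    integrableOn_mul_of_continuousOn hs ht ((hW.locallyIntegrableOn e).add
      (continuousOn_const.locallyIntegrableOn (G.isClosed_interval e).measurableSet))
      ((cu.mul cη.continuousOn).pow 2)
  have i4 : IntegrableOn (fun x => (d e x * η x + u e x * η' x) ^ 2) (Ioo s t) :=
    ((((cd.mul cη.continuousOn).add (cu.mul hη'.continuousOn)).pow 2).integrableOn_compact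
      isCompact_Icc).mono_set Ioo_subset_Icc_self
  have e1 : ∫ x in Ioo s t, ρ e x * |u e x| ^ (p - 2) * u e x * (u e x * η x * η x) =
      ∫ x in Ioo s t, (ρ e x * |u e x| ^ (p - 2) * (u e x * η x) ^ 2) :=
    integral_congr_ae (ae_of_all _ fun x => by ring)
  rw [e1] at key
  rw [← key, ← sub_eq_iff_eq_add]
  refine (integral_sub (i4.add i3) i2).symm.trans (integral_congr_ae ?_)
  have hae : ∀ᵐ x ∂(volume.restrict (Ioo s t)), G.der u e x = d e x :=
    ae_restrict_of_ae_restrict_of_subset (Ioo_subset_Icc_self.trans hI) (hd.ae_eq e)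
  filter_upwards [hae] with x hx
  simp only [Pi.add_apply, hx]
  ring

theorem IsSolution.integral_quadDensity_eq [Fintype E] {p lam : ℝ} {W ρ u d : E → ℝ → ℝ}
    (hp : 2 < p) (hW : G.MemLInfty W) (hρ : G.MemLInfty ρ) (hu : G.IsSolution p W ρ lam u)
    (hd : G.IsClassicalDeriv p W ρ lam u d) {e : E} {s t : ℝ} {η η' : ℝ → ℝ}
    (hs : s ∈ G.interval e) (ht : t ∈ G.interval e) (hst : s < t)
    (hη : ∀ x, HasDerivAt η (η' x) x) (hη' : Continuous η') (h0s : u e s * η s = 0)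
    (h0t : u e t * η t = 0) :
    ∫ x in Ioo s t, quadDensity p W ρ lam u e (fun x => u e x * η x)
        (fun x => d e x * η x + u e x * η' x) x =
      (∫ x in Ioo s t, (u e x * η' x) ^ 2) -
        (p - 2) * ∫ x in Ioo s t, (ρ e x * |u e x| ^ (p - 2) * (u e x * η x) ^ 2) := by
  obtain ⟨A1, i1, key⟩ := hu.integral_energy_eq hp hW hρ hd hs ht hst hη hη' h0s h0t
  have iq := A1.integrableOn_quadDensity (lam := lam) hp hW hρ hu.1
  have e1 : ∫ x in Ioo s t, ((d e x * η x + u e x * η' x) ^ 2 +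
      (W e x + lam) * (u e x * η x) ^ 2) = ∫ x in Ioo s t, (quadDensity p W ρ lam u e
        (fun x => u e x * η x) (fun x => d e x * η x + u e x * η' x) x +
        (p - 1) * (ρ e x * |u e x| ^ (p - 2) * (u e x * η x) ^ 2)) :=
    integral_congr_ae (ae_of_all _ fun x => by simp only [quadDensity]; ring)
  rw [e1, integral_add iq (i1.const_mul _), integral_const_mul] at key
  linarith

/-- With η = 1 the form equals -(p-2) ∫ ρ |u|^p, which is negative because ρ ≥ a and u is not
identically zero on the arc. -/
theorem IsSolution.integral_quadDensity_neg [Fintype E] {p lam a : ℝ} {W ρ u d : E → ℝ → ℝ}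
    (hp : 2 < p) (hW : G.MemLInfty W) (hρ : G.MemLInfty ρ) (hu : G.IsSolution p W ρ lam u)
    (hd : G.IsClassicalDeriv p W ρ lam u d) {e : E} {s t q : ℝ} (ha : 0 < a)
    (hρa : ∀ᵐ x ∂(G.edgeMeasure e), a ≤ ρ e x)
    (hs : s ∈ G.interval e) (ht : t ∈ G.interval e) (hus : u e s = 0) (hut : u e t = 0)
    (hq : q ∈ Ioo s t) (huq : u e q ≠ 0) :
    G.IsArcFunction e s t (u e) (d e) ∧
      ∫ x in Ioo s t, quadDensity p W ρ lam u e (u e) (d e) x < 0 := by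
  have hst := hq.1.trans hq.2
  have hη : ∀ x : ℝ, HasDerivAt (fun _ : ℝ => (1 : ℝ)) ((fun _ => (0 : ℝ)) x) x :=
    fun x => hasDerivAt_const x 1
  have hI := G.Icc_subset_interval hs ht
  obtain ⟨A1, i1, _⟩ := hu.integral_energy_eq hp hW hρ hd hs ht hst hη continuous_const
    (by simp [hus]) (by simp [hut])
  have key := hu.integral_quadDensity_eq hp hW hρ hd hs ht hst hη continuous_const
    (by simp [hus]) (by simp [hut])
  simp only [mul_one, mul_zero, add_zero, ne_eq, OfNat.ofNat_ne_zero, not_false_eq_true, zero_pow,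
    integral_zero, zero_sub] at A1 i1 key
  refine ⟨A1, ?_⟩
  rw [key, neg_lt_zero]
  refine mul_pos (by linarith) ?_
  set f : ℝ → ℝ := fun x => |u e x| ^ (p - 2) * u e x ^ 2 with hf
  have cf : ContinuousOn f (Icc s t) :=
    ((continuousOn_abs_rpow (hu.1.continuousOn e) (by linarith)).mul
      ((hu.1.continuousOn e).pow 2)).mono hI
  have f0 : ∀ x, 0 ≤ f x := fun x => by positivity
  have fi : IntegrableOn f (Ioo s t) :=
    (cf.integrableOn_compact isCompact_Icc).mono_set Ioo_subset_Icc_self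
  have hpos : 0 < ∫ x in Ioo s t, f x := by
    rw [setIntegral_pos_iff_support_of_nonneg_ae (ae_of_all _ f0) fi]
    have hopen : IsOpen (Ioo s t ∩ f ⁻¹' {0}ᶜ) :=
      (cf.mono Ioo_subset_Icc_self).isOpen_inter_preimage isOpen_Ioo isOpen_compl_singleton
    have : (Ioo s t ∩ f ⁻¹' {0}ᶜ).Nonempty := by
      refine ⟨q, hq, ?_⟩
      have : 0 < f q := by
        have := abs_pos.2 huq
        simp only [hf]; positivity
      exact this.ne'
    refine (hopen.measure_pos volume this).trans_le (measure_mono fun x hx => ⟨hx.2, hx.1⟩)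
  refine (mul_pos ha hpos).trans_le ?_
  rw [← integral_const_mul]
  refine integral_mono_ae (fi.const_mul a) i1 ?_
  filter_upwards [ae_restrict_of_ae_restrict_of_subset (Ioo_subset_Icc_self.trans hI) hρa] with x hx
  simp only [hf, ← mul_assoc]
  gcongr

/-! ### Consequences of the maximum and of the Morse index for the size of M. -/

theorem IsSolution.exists_maximal_branch [Fintype E] {p lam Wbar b R : ℝ} {W ρ u d : E → ℝ → ℝ}
    (hp : 2 < p) (hWρ : G.CoefficientBounds W ρ Wbar b) (hu : G.IsSolution p W ρ lam u)
    (hd : G.IsClassicalDeriv p W ρ lam u d)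
    (hmass : 0 < G.integral fun e x => |u e x| ^ 2) (hlam : Wbar < lam) (hR : 0 < R)
    (hRl : ∀ e, ENNReal.ofReal (2 * R) ≤ G.length e) :
    ∃ (e : E) (x₀ σ τ : ℝ), (σ = 1 ∨ σ = -1) ∧ (τ = 1 ∨ τ = -1) ∧ x₀ ∈ G.interval e ∧
      x₀ + σ * R ∈ G.interval e ∧ (∀ e', ∀ y ∈ G.interval e', |u e' y| ≤ |u e x₀|) ∧
      0 < |u e x₀| ∧ lam - Wbar ≤ b * |u e x₀| ^ (p - 2) ∧
      (¬ ∀ᵐ x ∂(G.edgeMeasure e), ρ e x = 0) ∧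
      IsBranch p lam Wbar b |u e x₀| R (fun t => τ * u e (x₀ + σ * t))
        (fun t => τ * σ * d e (x₀ + σ * t)) (fun t => W e (x₀ + σ * t))
        (fun t => ρ e (x₀ + σ * t)) := by
  have hne : Nonempty E := by
    by_contra h
    rw [not_nonempty_iff] at h
    simp [MetricGraph.integral] at hmass
  obtain ⟨e, x₀, hx₀, hmax⟩ := hu.1.exists_isMax hd
  obtain ⟨τ, hτ, hτu⟩ := exists_sign_mul_eq_abs (u e x₀)
  have hM : 0 < |u e x₀| := by
    by_contra hM
    have h0 : ∀ e', ∀ y ∈ G.interval e', |u e' y| = 0 := fun e' y hy =>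
      le_antisymm ((hmax e' y hy).trans (not_lt.1 hM)) (abs_nonneg _)
    refine hmass.ne' ?_
    rw [MetricGraph.integral]
    refine Finset.sum_eq_zero fun e' _ => ?_
    rw [edgeMeasure, setIntegral_congr_fun (G.isClosed_interval e').measurableSet
      (g := fun _ => 0) fun y hy => by simp [h0 e' y hy]]
    simp
  -- Since the edge has length at least 2R, at least one side of x₀ has room R.
  have hdir : ∃ σ : ℝ, (σ = 1 ∨ σ = -1) ∧ x₀ + σ * R ∈ G.interval e := by
    have h2R : 2 * R ∈ G.interval e := ⟨by positivity, hRl e⟩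
    rcases le_total R x₀ with h | h
    · exact ⟨-1, Or.inr rfl, G.mem_interval_of_le hx₀ (by linarith) (by linarith)⟩
    · refine ⟨1, Or.inl rfl, G.mem_interval_of_le h2R ?_ (by linarith)⟩
      linarith [hx₀.1]
  obtain ⟨σ, hσ, hσR⟩ := hdir
  have hbr := hd.isBranch hWρ hu.1 hx₀ hmax (hu.deriv_eq_zero_of_isMax hp hWρ hd hx₀ hmax) hσ hτ
    hτu hσR
  have hae : ∀ {P : ℝ → Prop}, (∀ᵐ x ∂(G.edgeMeasure e), P x) →
      ∀ᵐ t, t ∈ Icc 0 R → P (x₀ + σ * t) := fun {P} hP => by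
    filter_upwards [(measurePreserving_add_sign_mul hσ x₀).quasiMeasurePreserving.ae
      ((G.ae_edgeMeasure_iff).1 hP)] with t ht htm
    exact ht ((G.ordConnected_interval e).uIcc_subset hx₀ hσR (add_sign_mul_mem_segment hσ htm))
  refine ⟨e, x₀, σ, τ, hσ, hτ, hx₀, hσR, hmax, hM, ?_, fun hρ0 => ?_, hbr⟩
  -- Were b M^(p-2) < lam - Wbar, the factor W + lam - ρ |u|^(p-2) would be bounded below by a
  -- positive constant, and the branch would be convex.
  · by_contra! hcon
    refine hbr.false_of_convex hM hR (sub_pos.2 hcon) ?_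
    filter_upwards [hbr.W_le, hbr.ρ_le] with t h1 h2 ht
    have h3 : ρ e (x₀ + σ * t) * |τ * u e (x₀ + σ * t)| ^ (p - 2) ≤ b * |u e x₀| ^ (p - 2) :=
      mul_le_mul (h2 ht).2 (Real.rpow_le_rpow (abs_nonneg _) (hbr.abs_le t ht) (by linarith))
        (by positivity) ((h2 ht).1.trans (h2 ht).2)
    linarith [neg_le_of_abs_le (h1 ht)]
  -- On an edge without nonlinearity the factor is W + lam ≥ lam - Wbar > 0: convex again.
  · refine hbr.false_of_convex hM hR (sub_pos.2 hlam) ?_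
    filter_upwards [hbr.W_le, hae hρ0] with t h1 h2 ht
    rw [h2 ht, zero_mul]
    linarith [neg_le_of_abs_le (h1 ht)]

/-- On each edge the weight is either bounded below by `a`, or zero. -/
def WeightDichotomy (G : MetricGraph V E) (ρ : E → ℝ → ℝ) (a : ℝ) : Prop :=
  ∀ e, (∀ᵐ x ∂(G.edgeMeasure e), a ≤ ρ e x) ∨ ∀ᵐ x ∂(G.edgeMeasure e), ρ e x = 0

/-- The m + 2 zeros bound m + 1 disjoint arcs, each with a negative direction. For σ = -1 the map to
the edge reverses order, so the ends of every arc swap. -/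
theorem IsSolution.succ_le_morseIndex_of_zeros [Fintype E] {p lam a : ℝ} {W ρ u d : E → ℝ → ℝ}
    (hp : 2 < p) (hW : G.MemLInfty W) (hρ : G.MemLInfty ρ) (hu : G.IsSolution p W ρ lam u)
    (hd : G.IsClassicalDeriv p W ρ lam u d) {e : E} (ha : 0 < a)
    (hρa : ∀ᵐ x ∂(G.edgeMeasure e), a ≤ ρ e x) {m : ℕ} {x₀ σ r : ℝ} (hσ : σ = 1 ∨ σ = -1)
    (hr : 0 < r) {z : ℕ → ℝ} (hz : ∀ i < m + 2, x₀ + σ * (r * z i) ∈ G.interval e ∧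
      u e (x₀ + σ * (r * z i)) = 0)
    (hz' : ∀ i, i + 1 < m + 2 → z i < z (i + 1) ∧ ∃ y ∈ Ioo (z i) (z (i + 1)),
      u e (x₀ + σ * (r * y)) ≠ 0) :
    ((m + 1 : ℕ) : ℕ∞) ≤ G.morseIndex p W ρ lam u := by
  have hmono : ∀ i j, i ≤ j → j < m + 2 → z i ≤ z j := by
    intro i j hij
    induction j, hij using Nat.le_induction with
    | base => exact fun _ => le_rfl
    | succ j hij ih => exact fun hj => (ih (by omega)).trans (hz' j hj).1.le
  have hcard : Fintype.card (Fin (m + 1)) = m + 1 := Fintype.card_fin _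
  rw [← hcard]
  set P : ℕ → ℝ := fun i => x₀ + σ * (r * z i) with hP
  rcases hσ with rfl | rfl
  · have harc : ∀ i : Fin (m + 1), G.IsArcFunction e (P i) (P (i + 1)) (u e) (d e) ∧
        ∫ x in Ioo (P i) (P (i + 1)), quadDensity p W ρ lam u e (u e) (d e) x < 0 := by
      intro i
      have hi := i.2
      obtain ⟨_, y, hy, huy⟩ := hz' i (by omega)
      refine hu.integral_quadDensity_neg hp hW hρ hd ha hρa (hz i (by omega)).1
        (hz (i + 1) (by omega)).1 (hz i (by omega)).2 (hz (i + 1) (by omega)).2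
        (q := x₀ + 1 * (r * y)) ⟨?_, ?_⟩ huy
      · simp only [hP]; nlinarith [hy.1]
      · simp only [hP]; nlinarith [hy.2]
    refine card_le_morseIndex hp hW hρ hu.1 (fun i => (harc i).1) ?_ fun i => (harc i).2
    have hlt : ∀ i j : Fin (m + 1), i < j →
        Disjoint (Ioo (P i) (P (i + 1))) (Ioo (P j) (P (j + 1))) := by
      intro i j hij
      have := hmono (i + 1) j hij (by omega)
      have h2 : P (i + 1) ≤ P j := by simp only [hP]; nlinarith
      exact disjoint_left.2 fun x hx hx' => absurd (hx.2.trans_le h2) (not_lt.2 hx'.1.le)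
    intro i j hij
    rcases lt_or_gt_of_ne hij with h | h
    · exact hlt i j h
    · exact (hlt j i h).symm
  · have harc : ∀ i : Fin (m + 1), G.IsArcFunction e (P (i + 1)) (P i) (u e) (d e) ∧
        ∫ x in Ioo (P (i + 1)) (P i), quadDensity p W ρ lam u e (u e) (d e) x < 0 := by
      intro i
      have hi := i.2
      obtain ⟨_, y, hy, huy⟩ := hz' i (by omega)
      refine hu.integral_quadDensity_neg hp hW hρ hd ha hρa (hz (i + 1) (by omega)).1
        (hz i (by omega)).1 (hz (i + 1) (by omega)).2 (hz i (by omega)).2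
        (q := x₀ + -1 * (r * y)) ⟨?_, ?_⟩ huy
      · simp only [hP]; nlinarith [hy.2]
      · simp only [hP]; nlinarith [hy.1]
    refine card_le_morseIndex hp hW hρ hu.1 (fun i => (harc i).1) ?_ fun i => (harc i).2
    have hlt : ∀ i j : Fin (m + 1), i < j →
        Disjoint (Ioo (P (i + 1)) (P i)) (Ioo (P (j + 1)) (P j)) := by
      intro i j hij
      have := hmono (i + 1) j hij (by omega)
      have h2 : P j ≤ P (i + 1) := by simp only [hP]; nlinarith
      exact disjoint_left.2 fun x hx hx' => absurd (hx'.2.trans_le h2) (not_lt.2 hx.1.le)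
    intro i j hij
    rcases lt_or_gt_of_ne hij with h | h
    · exact hlt i j h
    · exact (hlt j i h).symm

/-- A solution of Morse index at most `m` has `|u|^(p-2)` bounded in terms of `|lam|`. -/
theorem exists_sup_bound {p a b : ℝ} (hp : 2 < p) (ha : 0 < a) (hb : 0 ≤ b) (m : ℕ) :
    ∃ T > 0, ∃ δ₀ > 0, ∀ (V E : Type*) (_ : Fintype E) (G : MetricGraph V E)
      (W ρ u d : E → ℝ → ℝ) (lam Wbar M R : ℝ), G.CoefficientBounds W ρ Wbar b →
      G.WeightDichotomy ρ a → G.IsSolution p W ρ lam u → G.IsClassicalDeriv p W ρ lam u d →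
      (0 < G.integral fun e x => |u e x| ^ 2) → Wbar < lam → 0 < R →
      (∀ e, ENNReal.ofReal (2 * R) ≤ G.length e) →
      (∀ e, ∀ y ∈ G.interval e, |u e y| ≤ M) → (∃ e, ∃ y ∈ G.interval e, |u e y| = M) →
      G.morseIndex p W ρ lam u ≤ m → T * M ^ (-((p - 2) / 2)) ≤ R →
      δ₀ * M ^ (p - 2) ≤ Wbar + |lam| := by
  -- One arc more than the index allows needs m + 2 zeros. After normalization v starts at 1, hence
  -- the threshold 1; capping δ at 1 makes C = 1 + b admissible.
  obtain ⟨T, hT, δ₀, hδ₀, key⟩ := exists_time_exists_zeros (p := p) (a := a) (C := 1 + b)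
    (by linarith) ha (by positivity) (m + 2) one_pos
  refine ⟨T, hT, min δ₀ 1, lt_min hδ₀ one_pos, ?_⟩
  intro V E _ G W ρ u d lam Wbar M R hWρ hdich hu hd hmass hlam hR hRl hM hM' hmorse hTR
  obtain ⟨e, x₀, σ, τ, hσ, hτ, hx₀, hσR, hmax, hpos, _, hρ0, hbr⟩ :=
    hu.exists_maximal_branch hp hWρ hd hmass hlam hR hRl
  have hMe : |u e x₀| = M := by
    obtain ⟨e', y, hy, hye⟩ := hM'
    exact le_antisymm (hM e x₀ hx₀) (hye ▸ hmax e' y hy)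
  rw [hMe] at hpos hbr
  have hρa := (hdich e).resolve_right hρ0
  by_contra! hcon
  set r := M ^ (-((p - 2) / 2)) with hr
  have hr0 : 0 < r := Real.rpow_pos_of_pos hpos _
  have hrM : r ^ 2 * M ^ (p - 2) = 1 := by
    rw [hr, ← Real.rpow_natCast, ← Real.rpow_mul hpos.le, ← Real.rpow_add hpos]
    norm_num
  have hδ : (Wbar + |lam|) * r ^ 2 ≤ min δ₀ 1 := by
    calc (Wbar + |lam|) * r ^ 2 ≤ min δ₀ 1 * M ^ (p - 2) * r ^ 2 := by gcongr
      _ = min δ₀ 1 * (r ^ 2 * M ^ (p - 2)) := by ring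
      _ = _ := by rw [hrM, mul_one]
  have hρa' : ∀ᵐ t, t ∈ Icc 0 R → a ≤ ρ e (x₀ + σ * t) := by
    filter_upwards [(measurePreserving_add_sign_mul hσ x₀).quasiMeasurePreserving.ae
      ((G.ae_edgeMeasure_iff).1 hρa)] with t ht htm
    exact ht ((G.ordConnected_interval e).uIcc_subset hx₀ hσR (add_sign_mul_mem_segment hσ htm))
  have hosc := hbr.isOscillator hp ha.le hρa' hpos (r := r) (T := 0 + T) (C := 1 + b)
    (δ := min δ₀ 1) hr0 hrM (by linarith) hδ (by linarith [min_le_right δ₀ 1])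
  obtain ⟨z, hz, hz'⟩ := key _ 0 _ _ (min_le_left _ _) hosc (by
    have h1 := hbr.zero_eq
    simp only [mul_zero, add_zero] at h1 ⊢
    rw [h1, div_self hpos.ne', abs_one]
    linarith [abs_nonneg (r * (τ * σ * d e x₀) / M)])
  have hτ0 : τ ≠ 0 := by rcases hτ with rfl | rfl <;> norm_num
  have := hu.succ_le_morseIndex_of_zeros hp hWρ.memLInfty_W hWρ.memLInfty_ρ hd ha hρa hσ hr0
    (x₀ := x₀) (m := m) (z := z) (fun i hi => ?_) fun i hi => ?_
  · have := this.trans hmorse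
    rw [Nat.cast_le] at this
    omega
  · obtain ⟨h1, h2⟩ := hz i hi
    refine ⟨(G.ordConnected_interval e).uIcc_subset hx₀ hσR (add_sign_mul_mem_segment hσ
      ⟨mul_nonneg hr0.le h1.1.le, ?_⟩), ?_⟩
    · have := mul_le_mul_of_nonneg_left h1.2 hr0.le
      linarith
    · exact (mul_eq_zero.1 ((div_eq_zero_iff.1 h2).resolve_right hpos.ne')).resolve_left hτ0
  · obtain ⟨h1, y, hy, hvy⟩ := hz' i hi
    refine ⟨h1, y, hy, fun h0 => hvy ?_⟩
    simp [h0]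

end MetricGraph

/-! ### Mass of an edge, cell by cell. -/

theorem sum_range_add_two_le {n : ℕ} {μ : ℕ → ℝ} {A K : ℝ} {S : Finset ℕ} (h0 : ∀ k, 0 ≤ μ k)
    (hA : 0 ≤ A) (hK : ∀ k, k < n + 2 → μ k ≤ K)
    (hS : ∀ k, k < n → k ∉ S → μ (k + 1) ≤ A * (μ k + μ (k + 1) + μ (k + 2))) :
    ∑ k ∈ Finset.range (n + 2), μ k ≤
      (2 + S.card) * K + 3 * A * ∑ k ∈ Finset.range (n + 2), μ k := by
  have hK0 : 0 ≤ K := (h0 0).trans (hK 0 (by omega))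
  have s1 : ∑ k ∈ Finset.range n, μ k ≤ ∑ k ∈ Finset.range (n + 2), μ k :=
    Finset.sum_le_sum_of_subset_of_nonneg (Finset.range_subset_range.2 (by omega))
      fun k _ _ => h0 k
  have s2 : ∑ k ∈ Finset.range n, μ (k + 1) ≤ ∑ k ∈ Finset.range (n + 2), μ k := by
    rw [Finset.sum_range_succ', Finset.sum_range_succ]
    linarith [h0 (n + 1), h0 0]
  have s3 : ∑ k ∈ Finset.range n, μ (k + 2) ≤ ∑ k ∈ Finset.range (n + 2), μ k := by
    rw [Finset.sum_range_succ', Finset.sum_range_succ']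
    linarith [h0 0, h0 1]
  -- Index k stands for the triple k, k+1, k+2 with middle cell k+1. Exceptional middle cells cost
  -- K, and each cell lies in at most three triples.
  have key : ∑ k ∈ Finset.range n, μ (k + 1) ≤ ∑ k ∈ Finset.range n,
      ((if k ∈ S then K else 0) + A * (μ k + μ (k + 1) + μ (k + 2))) := by
    refine Finset.sum_le_sum fun k hk => ?_
    rw [Finset.mem_range] at hk
    by_cases hkS : k ∈ S
    · rw [if_pos hkS]
      have := mul_nonneg hA (add_nonneg (add_nonneg (h0 k) (h0 (k + 1))) (h0 (k + 2)))
      linarith [hK (k + 1) (by omega)]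
    · rw [if_neg hkS, zero_add]
      exact hS k hk hkS
  have hbad : ∑ k ∈ Finset.range n, (if k ∈ S then K else 0) ≤ S.card * K := by
    rw [← Finset.sum_filter, Finset.sum_const, nsmul_eq_mul]
    refine mul_le_mul_of_nonneg_right ?_ hK0
    exact_mod_cast Finset.card_le_card fun k hk => (Finset.mem_filter.1 hk).2
  rw [Finset.sum_add_distrib, ← Finset.mul_sum, Finset.sum_add_distrib,
    Finset.sum_add_distrib] at key
  have h3 := mul_le_mul_of_nonneg_left (add_le_add (add_le_add s1 s2) s3) hA
  -- The first and the last cell are never in the middle; they account for the 2 in the coefficient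
  -- of K.
  have htot : ∑ k ∈ Finset.range (n + 2), μ k =
      ∑ k ∈ Finset.range n, μ (k + 1) + μ 0 + μ (n + 1) := by
    rw [Finset.sum_range_succ, Finset.sum_range_succ']
  have := hK 0 (by omega)
  have := hK (n + 1) (by omega)
  linarith

namespace MetricGraph

variable {V E : Type*} {G : MetricGraph V E}

/-- The cutoff is the parabola η vanishing at the ends of the triple: η ≥ 2L² on the middle cell and
|η'| ≤ 3L. A nonnegative form bounds the nonlinear term by ∫ (u η')² / (p-2), and the energy
identity then bounds (lam - Wbar) ∫ (u η)² by (p-1)/(p-2) times ∫ (u η')². -/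
theorem IsSolution.cell_estimate [Fintype E] {p lam Wbar b L α : ℝ} {W ρ u d : E → ℝ → ℝ}
    (hp : 2 < p) (hWρ : G.CoefficientBounds W ρ Wbar b) (hu : G.IsSolution p W ρ lam u)
    (hd : G.IsClassicalDeriv p W ρ lam u d) {e : E} (hL : 0 < L) (hlam : Wbar < lam)
    (hs : α - L ∈ G.interval e) (ht : α + 2 * L ∈ G.interval e) :
    G.IsArcFunction e (α - L) (α + 2 * L)
      (fun x => u e x * ((x - (α - L)) * (α + 2 * L - x)))
      (fun x => d e x * ((x - (α - L)) * (α + 2 * L - x)) + u e x * (2 * α + L - 2 * x)) ∧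
    (0 ≤ ∫ x in Ioo (α - L) (α + 2 * L), quadDensity p W ρ lam u e
      (fun x => u e x * ((x - (α - L)) * (α + 2 * L - x)))
      (fun x => d e x * ((x - (α - L)) * (α + 2 * L - x)) + u e x * (2 * α + L - 2 * x)) x →
    ∫ x in Ioo α (α + L), u e x ^ 2 ≤ 9 / 4 * ((p - 1) / (p - 2)) / ((lam - Wbar) * L ^ 2) *
      ∫ x in Ioo (α - L) (α + 2 * L), u e x ^ 2) := by
  set s := α - L with hsdef
  set t := α + 2 * L with htdef
  set η : ℝ → ℝ := fun x => (x - s) * (t - x) with hηdef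
  set η' : ℝ → ℝ := fun x => 2 * α + L - 2 * x with hη'def
  have hst : s < t := by linarith
  have hI := G.Icc_subset_interval hs ht
  have hη : ∀ x, HasDerivAt η (η' x) x := fun x => by
    refine (((hasDerivAt_id x).sub_const s).mul ((hasDerivAt_id x).const_sub t)).congr_deriv ?_
    simp only [id, hη'def, hsdef, htdef]; ring
  have hη'c : Continuous η' := by fun_prop
  have hηc : Continuous η := by fun_prop
  have h0s : u e s * η s = 0 := by simp [hηdef]
  have h0t : u e t * η t = 0 := by simp [hηdef]
  obtain ⟨A1, i1, key⟩ := hu.integral_energy_eq hp hWρ.memLInfty_W hWρ.memLInfty_ρ hd hs ht hst hη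
    hη'c h0s h0t
  have quad := hu.integral_quadDensity_eq hp hWρ.memLInfty_W hWρ.memLInfty_ρ hd hs ht hst hη
    hη'c h0s h0t
  refine ⟨A1, fun hQ => ?_⟩
  rw [quad] at hQ
  have cu := (hu.1.continuousOn e).mono hI
  have cd := (hd.continuousOn e).mono hI
  have iu : IntegrableOn (fun x => u e x ^ 2) (Ioo s t) :=
    ((cu.pow 2).integrableOn_compact isCompact_Icc).mono_set Ioo_subset_Icc_self
  have iη : IntegrableOn (fun x => (u e x * η x) ^ 2) (Ioo s t) :=
    (((cu.mul hηc.continuousOn).pow 2).integrableOn_compact isCompact_Icc).mono_set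
      Ioo_subset_Icc_self
  have iη' : IntegrableOn (fun x => (u e x * η' x) ^ 2) (Ioo s t) :=
    (((cu.mul hη'c.continuousOn).pow 2).integrableOn_compact isCompact_Icc).mono_set
      Ioo_subset_Icc_self
  have iW : IntegrableOn (fun x => (d e x * η x + u e x * η' x) ^ 2 +
      (W e x + lam) * (u e x * η x) ^ 2) (Ioo s t) := by
    refine IntegrableOn.add ?_ ?_
    · exact ((((cd.mul hηc.continuousOn).add (cu.mul hη'c.continuousOn)).pow
        2).integrableOn_compact isCompact_Icc).mono_set Ioo_subset_Icc_self
    · exact integrableOn_mul_of_continuousOn hs ht ((hWρ.memLInfty_W.locallyIntegrableOn e).add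
        (continuousOn_const.locallyIntegrableOn (G.isClosed_interval e).measurableSet))
        ((cu.mul hηc.continuousOn).pow 2)
  have b1 : (lam - Wbar) * ∫ x in Ioo s t, (u e x * η x) ^ 2 ≤
      ∫ x in Ioo s t, ((d e x * η x + u e x * η' x) ^ 2 +
        (W e x + lam) * (u e x * η x) ^ 2) := by
    rw [← integral_const_mul]
    refine integral_mono_ae (iη.const_mul _) iW ?_
    filter_upwards [ae_restrict_of_ae_restrict_of_subset (Ioo_subset_Icc_self.trans hI)
      (hWρ.W_le e)] with x hx
    have := neg_le_of_abs_le hx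
    nlinarith [sq_nonneg (d e x * η x + u e x * η' x), sq_nonneg (u e x * η x)]
  have b2 : ∫ x in Ioo s t, (u e x * η' x) ^ 2 ≤ 9 * L ^ 2 * ∫ x in Ioo s t, u e x ^ 2 := by
    rw [← integral_const_mul]
    refine setIntegral_mono_on iη' (iu.const_mul _) measurableSet_Ioo fun x hx => ?_
    have h1 : η' x ^ 2 ≤ (3 * L) ^ 2 := by
      refine sq_le_sq' ?_ ?_ <;> simp only [hη'def] <;> linarith [hx.1, hx.2]
    calc (u e x * η' x) ^ 2 = η' x ^ 2 * u e x ^ 2 := by ring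
      _ ≤ (3 * L) ^ 2 * u e x ^ 2 := by gcongr
      _ = _ := by ring
  have hsub : Ioo α (α + L) ⊆ Ioo s t := Ioo_subset_Ioo (by linarith) (by linarith)
  have b3 : (2 * L ^ 2) ^ 2 * ∫ x in Ioo α (α + L), u e x ^ 2 ≤
      ∫ x in Ioo s t, (u e x * η x) ^ 2 := by
    refine le_trans ?_ (setIntegral_mono_set iη (ae_of_all _ fun x => sq_nonneg _)
      hsub.eventuallyLE)
    rw [← integral_const_mul]
    refine setIntegral_mono_on ((iu.mono_set hsub).const_mul _) (iη.mono_set hsub)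
      measurableSet_Ioo fun x hx => ?_
    have h1 : 2 * L ^ 2 ≤ η x := by
      simp only [hηdef, hsdef, htdef]
      nlinarith [mul_pos (sub_pos.2 hx.1) (sub_pos.2 hx.2)]
    calc (2 * L ^ 2) ^ 2 * u e x ^ 2 ≤ η x ^ 2 * u e x ^ 2 := by gcongr
      _ = _ := by ring
  set Y := ∫ x in Ioo s t, (u e x * η' x) ^ 2
  set Z := ∫ x in Ioo s t, (ρ e x * |u e x| ^ (p - 2) * (u e x * η x) ^ 2)
  set X := ∫ x in Ioo α (α + L), u e x ^ 2
  set U := ∫ x in Ioo s t, u e x ^ 2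
  have hp2 : 0 < p - 2 := by linarith
  have hl : 0 < lam - Wbar := by linarith
  have hZ : Z ≤ Y / (p - 2) := by rw [le_div_iff₀ hp2]; linarith
  have b4 : (lam - Wbar) * ((2 * L ^ 2) ^ 2 * X) ≤ (p - 1) / (p - 2) * (9 * L ^ 2 * U) := by
    have h1 : (lam - Wbar) * ((2 * L ^ 2) ^ 2 * X) ≤ Z + Y :=
      (mul_le_mul_of_nonneg_left b3 hl.le).trans (b1.trans key.le)
    have h2 : Y / (p - 2) + Y = (p - 1) / (p - 2) * Y := by field_simp; ring
    have h3 : (p - 1) / (p - 2) * Y ≤ (p - 1) / (p - 2) * (9 * L ^ 2 * U) :=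
      mul_le_mul_of_nonneg_left b2 (div_nonneg (by linarith) hp2.le)
    linarith
  rw [div_mul_eq_mul_div, le_div_iff₀ (by positivity)]
  have : 0 < 4 * L ^ 2 := by positivity
  refine le_of_mul_le_mul_left ?_ this
  calc 4 * L ^ 2 * (X * ((lam - Wbar) * L ^ 2)) = (lam - Wbar) * ((2 * L ^ 2) ^ 2 * X) := by ring
    _ ≤ _ := b4
    _ = _ := by ring

/-- Triples whose first index has a given residue mod 3 are disjoint, so at most m of them have a
negative form, hence at most 3m in all. The bound is uniform in the number of cells, as half-lines
require. -/
theorem IsSolution.integral_sq_le_of_morseIndex_le [Fintype E] {p lam Wbar b M L : ℝ}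
    {W ρ u : E → ℝ → ℝ} {m n : ℕ} (hp : 2 < p) (hWρ : G.CoefficientBounds W ρ Wbar b)
    (hu : G.IsSolution p W ρ lam u) {e : E} (hL : 0 < L) (hlam : Wbar < lam)
    (hM : ∀ y ∈ G.interval e, |u e y| ≤ M) (hmorse : G.morseIndex p W ρ lam u ≤ m)
    (hn : ((n + 2 : ℕ) : ℝ) * L ∈ G.interval e) :
    ∫ x in (0 : ℝ)..((n + 2 : ℕ) : ℝ) * L, u e x ^ 2 ≤ (2 + 3 * m) * (L * M ^ 2) +
      3 * (9 / 4 * ((p - 1) / (p - 2)) / ((lam - Wbar) * L ^ 2)) *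
        ∫ x in (0 : ℝ)..((n + 2 : ℕ) : ℝ) * L, u e x ^ 2 := by
  classical
  obtain ⟨d, hd⟩ := hu.exists_isClassicalDeriv hp hWρ.memLInfty_W hWρ.memLInfty_ρ
  set A := 9 / 4 * ((p - 1) / (p - 2)) / ((lam - Wbar) * L ^ 2) with hA
  have hl : 0 < lam - Wbar := by linarith
  have hA0 : 0 ≤ A := by
    have : 0 ≤ (p - 1) / (p - 2) := div_nonneg (by linarith) (by linarith)
    positivity
  have hmem : ∀ k : ℕ, k ≤ n + 2 → (k : ℝ) * L ∈ G.interval e := fun k hk =>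
    G.mem_interval_of_le hn (by positivity) (by
      refine mul_le_mul_of_nonneg_right ?_ hL.le
      exact_mod_cast hk)
  have hii : ∀ j k : ℕ, j ≤ n + 2 → k ≤ n + 2 →
      IntervalIntegrable (fun x => u e x ^ 2) volume (j * L) (k * L) := fun j k hj hk =>
    (((hu.1.continuousOn e).pow 2).mono ((G.ordConnected_interval e).uIcc_subset (hmem j hj)
      (hmem k hk))).intervalIntegrable
  set μ : ℕ → ℝ := fun k => ∫ x in (k * L)..((k + 1 : ℕ) * L), u e x ^ 2 with hμ
  have hstep : ∀ k : ℕ, (k : ℝ) * L ≤ ((k + 1 : ℕ) : ℝ) * L := fun k =>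
    mul_le_mul_of_nonneg_right (by exact_mod_cast Nat.le_succ k) hL.le
  have hμ0 : ∀ k, 0 ≤ μ k := fun k =>
    intervalIntegral.integral_nonneg (hstep k) fun x _ => sq_nonneg _
  have hμK : ∀ k, k < n + 2 → μ k ≤ L * M ^ 2 := by
    intro k hk
    refine (intervalIntegral.integral_mono_on (hstep k) (hii k (k + 1) (by omega) (by omega))
      (intervalIntegrable_const (c := M ^ 2)) fun x hx => ?_).trans_eq ?_
    · rw [← sq_abs]
      have := hM x (G.Icc_subset_interval (hmem k (by omega)) (hmem (k + 1) (by omega)) hx)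
      gcongr
    · rw [intervalIntegral.integral_const, smul_eq_mul]; push_cast; ring
  have hsum : ∀ j N : ℕ, j + N ≤ n + 2 → ∑ k ∈ Finset.range N, μ (j + k) =
      ∫ x in ((j : ℕ) * L)..((j + N : ℕ) * L), u e x ^ 2 := fun j N hN =>
    intervalIntegral.sum_integral_adjacent_intervals (a := fun k : ℕ => ((j + k : ℕ) : ℝ) * L)
      (f := fun x => u e x ^ 2) (n := N) fun k hk => hii _ _ (by omega) (by omega)
  set F : ℕ → ℝ → ℝ := fun k x => u e x * ((x - k * L) * (((k + 3 : ℕ) : ℝ) * L - x)) with hF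
  set H : ℕ → ℝ → ℝ := fun k x => d e x * ((x - k * L) * (((k + 3 : ℕ) : ℝ) * L - x)) +
    u e x * (2 * (((k + 1 : ℕ) : ℝ) * L) + L - 2 * x) with hH
  have e1 : ∀ k : ℕ, ((k + 1 : ℕ) : ℝ) * L - L = k * L := fun k => by push_cast; ring
  have e2 : ∀ k : ℕ, ((k + 1 : ℕ) : ℝ) * L + 2 * L = ((k + 3 : ℕ) : ℝ) * L := fun k => by
    push_cast; ring
  have e3 : ∀ k : ℕ, ((k + 1 : ℕ) : ℝ) * L + L = ((k + 1 + 1 : ℕ) : ℝ) * L := fun k => by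
    push_cast; ring
  have cell : ∀ k, k < n → G.IsArcFunction e (k * L) ((k + 3 : ℕ) * L) (F k) (H k) ∧
      (0 ≤ ∫ x in Ioo ((k : ℝ) * L) ((k + 3 : ℕ) * L), quadDensity p W ρ lam u e (F k) (H k) x →
      μ (k + 1) ≤ A * (μ k + μ (k + 1) + μ (k + 2))) := by
    intro k hk
    have h1 := hu.cell_estimate (α := ((k + 1 : ℕ) : ℝ) * L) hp hWρ hd hL hlam
      (by rw [e1]; exact hmem k (by omega)) (by rw [e2]; exact hmem (k + 3) (by omega))
    simp only [e1, e2] at h1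
    refine ⟨h1.1, fun hQ => ?_⟩
    have h2 := h1.2 hQ
    rw [e3, ← integral_Ioc_eq_integral_Ioo, ← integral_Ioc_eq_integral_Ioo,
      ← intervalIntegral.integral_of_le (hstep (k + 1)),
      ← intervalIntegral.integral_of_le (by
        refine mul_le_mul_of_nonneg_right ?_ hL.le
        exact_mod_cast (by omega : k ≤ k + 3)), ← hsum k 3 (by omega)] at h2
    simp only [Finset.sum_range_succ, Finset.sum_range_zero, zero_add, add_zero] at h2
    exact h2
  set S := (Finset.range n).filter fun k : ℕ =>
    ∫ x in Ioo ((k : ℝ) * L) ((k + 3 : ℕ) * L), quadDensity p W ρ lam u e (F k) (H k) x < 0 with hS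
  have hres : ∀ j : ℕ, (S.filter fun k => k % 3 = j).card ≤ m := by
    intro j
    have hmemS : ∀ i : {k // k ∈ S.filter fun k => k % 3 = j}, (i : ℕ) < n ∧
        ∫ x in Ioo ((i : ℕ) * L) (((i : ℕ) + 3 : ℕ) * L),
          quadDensity p W ρ lam u e (F i) (H i) x < 0 ∧ (i : ℕ) % 3 = j := by
      intro i
      have h1 := Finset.mem_filter.1 i.2
      have h2 := Finset.mem_filter.1 h1.1
      exact ⟨Finset.mem_range.1 h2.1, h2.2, h1.2⟩
    have := card_le_morseIndex hp hWρ.memLInfty_W hWρ.memLInfty_ρ hu.1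
      (ι := {k // k ∈ S.filter fun k => k % 3 = j})
      (fun i => (cell i (hmemS i).1).1) ?_ fun i => (hmemS i).2.1
    · have h1 := this.trans hmorse
      rw [Fintype.card_coe, Nat.cast_le] at h1
      exact h1
    · have hlt : ∀ i i' : {k // k ∈ S.filter fun k => k % 3 = j}, (i : ℕ) < i' →
          Disjoint (Ioo ((i : ℕ) * L) (((i : ℕ) + 3 : ℕ) * L))
            (Ioo ((i' : ℕ) * L) (((i' : ℕ) + 3 : ℕ) * L)) := by
        intro i i' hii'
        have h1 := (hmemS i).2.2
        have h2 := (hmemS i').2.2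
        have h3 : (i : ℕ) + 3 ≤ i' := by omega
        have h4 : (((i : ℕ) + 3 : ℕ) : ℝ) * L ≤ ((i' : ℕ) : ℝ) * L :=
          mul_le_mul_of_nonneg_right (by exact_mod_cast h3) hL.le
        exact disjoint_left.2 fun x hx hx' => absurd (hx.2.trans_le h4) (not_lt.2 hx'.1.le)
      intro i i' hne
      rcases lt_or_gt_of_ne (fun h => hne (Subtype.ext h) : (i : ℕ) ≠ i') with h | h
      · exact hlt i i' h
      · exact (hlt i' i h).symm
  have hcard : S.card ≤ 3 * m := by
    rw [Finset.card_eq_sum_card_fiberwise (f := fun k => k % 3) (t := Finset.range 3)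
      fun k _ => Finset.mem_coe.2 (Finset.mem_range.2 (Nat.mod_lt _ (by norm_num)))]
    refine (Finset.sum_le_sum fun j _ => hres j).trans ?_
    simp
  have hM0 : 0 ≤ L * M ^ 2 := by positivity
  have main := sum_range_add_two_le (n := n) (S := S) hμ0 hA0 hμK fun k hk hkS =>
    (cell k hk).2 (not_lt.1 fun h => hkS (Finset.mem_filter.2 ⟨Finset.mem_range.2 hk, h⟩))
  have htot := hsum 0 (n + 2) (by omega)
  simp only [zero_add, Nat.cast_zero, zero_mul] at htot
  rw [htot] at main
  refine main.trans (add_le_add_left (mul_le_mul_of_nonneg_right ?_ hM0) _)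
  have : (S.card : ℝ) ≤ 3 * m := by exact_mod_cast hcard
  linarith

end MetricGraph

/-! ### Bounds for λ below and above the exponent 6. -/

open Filter Topology in
theorem exists_forall_ge_of_tendsto {f : ℝ → ℝ} (hf : Tendsto f atTop atTop) (K : ℝ) :
    ∃ x₀ > 0, ∀ x ≥ x₀, K ≤ f x := by
  obtain ⟨x₀, hx₀⟩ := eventually_atTop.1 (hf.eventually_ge_atTop K)
  exact ⟨max x₀ 1, lt_max_of_lt_right one_pos, fun x hx => hx₀ x ((le_max_left _ _).trans hx)⟩

theorem exists_forall_mul_rpow_neg_le {q K R : ℝ} (hq : 0 < q) (hR : 0 < R) :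
    ∃ M₀ > 0, ∀ M ≥ M₀, K * M ^ (-q) ≤ R := by
  obtain ⟨M₀, h0, h⟩ := exists_forall_ge_of_tendsto (tendsto_rpow_atTop hq) (K / R)
  refine ⟨M₀, h0, fun M hM => ?_⟩
  have hM0 : 0 < M := h0.trans_le hM
  have := h M hM
  rw [div_le_iff₀ hR] at this
  rw [Real.rpow_neg hM0.le, ← div_eq_mul_inv, div_le_iff₀ (by positivity)]
  linarith

theorem lt_of_sub_le_mul_rpow {p lam Wbar b M M₀ : ℝ} (hp : 2 < p) (hb : 0 ≤ b) (hM : 0 ≤ M)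
    (h : lam - Wbar ≤ b * M ^ (p - 2)) (hlam : Wbar + b * M₀ ^ (p - 2) < lam) : M₀ ≤ M := by
  by_contra! hcon
  have := Real.rpow_le_rpow hM hcon.le (z := p - 2) (by linarith)
  have := mul_le_mul_of_nonneg_left this hb
  linarith

namespace MetricGraph

variable {V E : Type*} {G : MetricGraph V E}

theorem MemH1.integral_sq_le_integral [Fintype E] {u : E → ℝ → ℝ} (e : E) :
    ∫ x, u e x ^ 2 ∂(G.edgeMeasure e) ≤ G.integral fun e x => |u e x| ^ 2 := by
  simp only [MetricGraph.integral, sq_abs]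
  exact Finset.single_le_sum (f := fun e => ∫ x, u e x ^ 2 ∂(G.edgeMeasure e))
    (fun e _ => integral_nonneg fun x => sq_nonneg _) (Finset.mem_univ e)

/-- On an arc of length T = κ M^(-(p-2)/2) starting at the maximum, |u| ≥ M/2, so c ≥ (κ/4)
M^(2-(p-2)/2). The exponent is positive for p < 6, which bounds M. -/
theorem exists_lam_bound_of_lt_six [Fintype E] (G : MetricGraph V E) {p Wbar b c : ℝ} (hp : 2 < p)
    (hp6 : p < 6) (hW : 0 ≤ Wbar) (hb : 0 < b) (hc : 0 < c) :
    ∃ Λ, ∀ (W ρ u : E → ℝ → ℝ) (lam : ℝ), G.CoefficientBounds W ρ Wbar b →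
      G.IsSolution p W ρ lam u → (G.integral fun e x => |u e x| ^ 2) = c → lam ≤ Λ := by
  obtain ⟨R₀, hR₀, hR₀l⟩ := G.exists_pos_le_length
  -- Chosen so that 3 b M^(p-2) T² = 1/2, the condition of `half_le`.
  set κ := Real.sqrt (1 / (6 * b)) with hκ
  have hκ0 : 0 < κ := Real.sqrt_pos.2 (by positivity)
  have hκ2 : κ ^ 2 = 1 / (6 * b) := Real.sq_sqrt (by positivity)
  obtain ⟨M₁, hM₁, h₁⟩ := exists_forall_mul_rpow_neg_le (q := (p - 2) / 2) (K := κ) (R := R₀ / 2)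
    (by linarith) (by positivity)
  obtain ⟨M₂, hM₂, h₂⟩ := exists_forall_ge_of_tendsto
    (tendsto_rpow_atTop (show 0 < 2 - (p - 2) / 2 by linarith)) (4 * (c + 1) / κ)
  refine ⟨max (3 * Wbar) (Wbar + b * (max M₁ M₂) ^ (p - 2)), ?_⟩
  intro W ρ u lam hWρ hu hmass
  by_contra! hcon
  obtain ⟨hlam3, hlamM⟩ := max_lt_iff.1 hcon
  have hlam : Wbar < lam := by linarith
  obtain ⟨d, hd⟩ := hu.exists_isClassicalDeriv hp hWρ.memLInfty_W hWρ.memLInfty_ρ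
  obtain ⟨e, x₀, σ, τ, hσ, hτ, hx₀, hσR, hmax, hpos, hMlow, -, hbr⟩ :=
    hu.exists_maximal_branch hp hWρ hd (R := R₀ / 2) (by rw [hmass]; exact hc) hlam
      (by positivity) (fun e => by
        rw [show 2 * (R₀ / 2) = R₀ by ring]; exact hR₀l e)
  set M := |u e x₀| with hM
  have hMM := lt_of_sub_le_mul_rpow hp hb.le hpos.le hMlow hlamM
  have g₁ := h₁ M ((le_max_left _ _).trans hMM)
  have g₂ := h₂ M ((le_max_right _ _).trans hMM)
  set T := κ * M ^ (-((p - 2) / 2)) with hT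
  have hT0 : 0 < T := by positivity
  have hT2 : T ^ 2 * M ^ (p - 2) = 1 / (6 * b) := by
    rw [hT, mul_pow, hκ2, mul_assoc, ← Real.rpow_natCast, ← Real.rpow_mul hpos.le,
      ← Real.rpow_add hpos]
    norm_num
  have hhalf : ∀ t ∈ Icc 0 T, M / 2 ≤ τ * u e (x₀ + σ * t) := by
    intro t ht
    refine hbr.half_le hp ht.1 (ht.2.trans g₁) ?_
    -- From lam > 3 Wbar follows Wbar + lam ≤ 2 (lam - Wbar) ≤ 2 b M^(p-2).
    have h3 : Wbar + |lam| + b * M ^ (p - 2) ≤ 3 * (b * M ^ (p - 2)) := by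
      rw [abs_of_nonneg (by linarith)]; linarith
    calc (Wbar + |lam| + b * M ^ (p - 2)) * t ^ 2 ≤ 3 * (b * M ^ (p - 2)) * T ^ 2 := by
          have := ht.1
          have := ht.2
          gcongr
      _ = 3 * b * (T ^ 2 * M ^ (p - 2)) := by ring
      _ = 1 / 2 := by rw [hT2]; field_simp; norm_num
  have hTm : x₀ + σ * T ∈ G.interval e :=
    (G.ordConnected_interval e).uIcc_subset hx₀ hσR (add_sign_mul_mem_segment hσ ⟨hT0.le, g₁⟩)
  have hsub : uIoc x₀ (x₀ + σ * T) ⊆ G.interval e :=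
    uIoc_subset_uIcc.trans ((G.ordConnected_interval e).uIcc_subset hx₀ hTm)
  have hvol : volume.real (uIoc x₀ (x₀ + σ * T)) = T := by
    rw [Measure.real, Real.volume_uIoc, add_sub_cancel_left, abs_sign_mul hσ, abs_of_pos hT0,
      ENNReal.toReal_ofReal hT0.le]
  have hint : IntegrableOn (fun x => u e x ^ 2) (G.interval e) := (hu.1.2 e).1.integrable_sq
  have hlow : T * (M / 2) ^ 2 ≤ c := by
    rw [← hmass]
    refine le_trans ?_ (MemH1.integral_sq_le_integral e)
    refine le_trans ?_ (setIntegral_mono_set hint (ae_of_all _ fun x => sq_nonneg _)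
      hsub.eventuallyLE)
    have hconst : ∫ _ in uIoc x₀ (x₀ + σ * T), (M / 2) ^ 2 = T * (M / 2) ^ 2 := by
      rw [setIntegral_const, hvol, smul_eq_mul]
    rw [← hconst]
    refine setIntegral_mono_on (integrableOn_const (by
      rw [Real.volume_uIoc]; exact ENNReal.ofReal_ne_top)) (hint.mono_set hsub)
      measurableSet_uIoc fun x hx => ?_
    have hx' : ∃ t ∈ Icc 0 T, x = x₀ + σ * t := by
      have hx2 := uIoc_subset_uIcc hx
      rw [mem_uIcc] at hx2
      rcases hσ with rfl | rfl
      · refine ⟨x - x₀, ⟨?_, ?_⟩, by ring⟩ <;> rcases hx2 with h | h <;> linarith [h.1, h.2]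
      · refine ⟨x₀ - x, ⟨?_, ?_⟩, by ring⟩ <;> rcases hx2 with h | h <;> linarith [h.1, h.2]
    obtain ⟨t, ht, rfl⟩ := hx'
    have := (hhalf t ht).trans (sign_mul_le_abs hτ _)
    rw [← sq_abs (u e _)]
    gcongr
  have hTM : T * (M / 2) ^ 2 = κ / 4 * M ^ (2 - (p - 2) / 2) := by
    rw [show 2 - (p - 2) / 2 = -((p - 2) / 2) + (2 : ℕ) by push_cast; ring, Real.rpow_add hpos,
      Real.rpow_natCast, hT]
    ring
  rw [hTM] at hlow
  rw [div_le_iff₀ hκ0] at g₂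
  linarith

/-- A half-line is cut where the remaining mass is at most ε; R is not controlled, and the cell
estimate does not need it to be. -/
theorem MemH1.exists_truncation {u : E → ℝ → ℝ} (hu : G.MemH1 u) {R₀ ε : ℝ}
    (hR₀ : ∀ e, ENNReal.ofReal R₀ ≤ G.length e) (hε : 0 < ε) (e : E) :
    ∃ R ∈ G.interval e, R₀ ≤ R ∧
      ∫ x, u e x ^ 2 ∂(G.edgeMeasure e) ≤ (∫ x in (0 : ℝ)..R, u e x ^ 2) + ε := by
  by_cases he : G.length e = ⊤
  · have hint : IntegrableOn (fun x => u e x ^ 2) (Ioi 0) := by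
      have h := (hu.2 e).1.integrable_sq
      rw [edgeMeasure, G.interval_eq_Ici he] at h
      exact IntegrableOn.mono_set h Ioi_subset_Ici_self
    have ht := intervalIntegral_tendsto_integral_Ioi 0 hint Filter.tendsto_id
    obtain ⟨R, hR, hR'⟩ := ((ht.eventually (lt_mem_nhds (sub_lt_self _ hε))).and
      (Filter.eventually_ge_atTop (max R₀ 0))).exists
    refine ⟨R, ⟨(le_max_right _ _).trans hR', by simp [he]⟩, (le_max_left _ _).trans hR', ?_⟩
    rw [edgeMeasure, G.interval_eq_Ici he, integral_Ici_eq_integral_Ioi]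
    simp only [id] at hR
    linarith
  · refine ⟨_, G.length_mem_interval he, (ENNReal.ofReal_le_iff_le_toReal he).1 (hR₀ e), ?_⟩
    rw [edgeMeasure, G.interval_eq_Icc he, integral_Icc_eq_integral_Ioc,
      ← intervalIntegral.integral_of_le ENNReal.toReal_nonneg]
    linarith

theorem IsSolution.integral_sq_le_of_sup_le [Fintype E] {p lam Wbar b M R₀ ε' ε c : ℝ}
    {W ρ u : E → ℝ → ℝ} {m : ℕ} (hp : 2 < p) (hWρ : G.CoefficientBounds W ρ Wbar b)
    (hu : G.IsSolution p W ρ lam u) (hlam : Wbar < lam) (hM0 : 0 < M) (hε' : 0 < ε') (hε : 0 < ε)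
    (hR₀ : ∀ e, ENNReal.ofReal R₀ ≤ G.length e) (hRM : ε' ≤ R₀ * M ^ 2)
    (hM : ∀ e, ∀ y ∈ G.interval e, |u e y| ≤ M) (hmorse : G.morseIndex p W ρ lam u ≤ m)
    (hmass : (G.integral fun e x => |u e x| ^ 2) = c) (e : E) :
    ∫ x, u e x ^ 2 ∂(G.edgeMeasure e) ≤ (2 + 3 * m) * ε' +
      108 * ((p - 1) / (p - 2)) / ε' ^ 2 * (M ^ 4 / (lam - Wbar)) * c + ε := by
  obtain ⟨R, hR, hR₀R, hle⟩ := hu.1.exists_truncation hR₀ hε e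
  set N := R * M ^ 2 / ε' with hN
  have hN1 : 1 ≤ N := by
    rw [hN, one_le_div hε']
    exact hRM.trans (by gcongr)
  -- With n + 2 cells, L M² lies between ε'/4 and ε': n + 2 ≥ N gives the upper bound, and n + 2 ≤ N
  -- + 3 ≤ 4N, valid as N ≥ 1, the lower one.
  set n := ⌈N⌉₊ with hn
  have hnN : N ≤ n := Nat.le_ceil N
  have hnN' : (n : ℝ) < N + 1 := Nat.ceil_lt_add_one (by linarith)
  have hn2 : (0 : ℝ) < ((n + 2 : ℕ) : ℝ) := by positivity
  have hR0 : 0 < R := by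
    have : 0 < R * M ^ 2 := hε'.trans_le (hRM.trans (by gcongr))
    exact pos_of_mul_pos_left this (by positivity)
  set L := R / ((n + 2 : ℕ) : ℝ) with hL
  have hL0 : 0 < L := by positivity
  have hnL : ((n + 2 : ℕ) : ℝ) * L = R := by rw [hL]; field_simp
  have hNε : N * ε' = R * M ^ 2 := by rw [hN]; field_simp
  have hLM : L * M ^ 2 ≤ ε' := by
    rw [hL, div_mul_eq_mul_div, div_le_iff₀ hn2, ← hNε]
    push_cast
    nlinarith
  have hLM' : ε' ≤ 4 * (L * M ^ 2) := by
    have : ε' * ((n + 2 : ℕ) : ℝ) ≤ 4 * (R * M ^ 2) := by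
      rw [← hNε]; push_cast
      nlinarith
    rw [hL, div_mul_eq_mul_div, ← mul_div_assoc, le_div_iff₀ hn2]
    exact this
  have key := hu.integral_sq_le_of_morseIndex_le (L := L) (n := n) hp hWρ hL0 hlam (hM e) hmorse
    (by rw [hnL]; exact hR)
  rw [hnL] at key
  have hl : 0 < lam - Wbar := by linarith
  have hP : 0 ≤ (p - 1) / (p - 2) := div_nonneg (by linarith) (by linarith)
  have hRc : ∫ x in (0 : ℝ)..R, u e x ^ 2 ≤ c := by
    rw [← hmass]
    refine le_trans ?_ (MemH1.integral_sq_le_integral e)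
    rw [intervalIntegral.integral_of_le hR0.le]
    exact setIntegral_mono_set (hu.1.2 e).1.integrable_sq (ae_of_all _ fun x => sq_nonneg _)
      (Ioc_subset_Icc_self.trans (G.Icc_subset_interval (G.zero_mem_interval e) hR)).eventuallyLE
  have hc0 : 0 ≤ c := by
    rw [← hmass]
    exact Finset.sum_nonneg fun e _ => integral_nonneg fun x => by positivity
  -- The lower bound on L M² gives 1/L² ≤ 16 M⁴ / ε'², and 108 = 16 · 27/4.
  have hcoef : 3 * (9 / 4 * ((p - 1) / (p - 2)) / ((lam - Wbar) * L ^ 2)) ≤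
      108 * ((p - 1) / (p - 2)) / ε' ^ 2 * (M ^ 4 / (lam - Wbar)) := by
    have h1 : ε' ^ 2 ≤ 16 * L ^ 2 * M ^ 4 := by
      calc ε' ^ 2 ≤ (4 * (L * M ^ 2)) ^ 2 := by gcongr
        _ = _ := by ring
    calc 3 * (9 / 4 * ((p - 1) / (p - 2)) / ((lam - Wbar) * L ^ 2))
        = 27 / 4 * ((p - 1) / (p - 2)) / (lam - Wbar) * (1 / L ^ 2) := by field_simp; ring
      _ ≤ 27 / 4 * ((p - 1) / (p - 2)) / (lam - Wbar) * (16 * M ^ 4 / ε' ^ 2) := by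
          refine mul_le_mul_of_nonneg_left ?_ (div_nonneg (by positivity) hl.le)
          rw [div_le_div_iff₀ (by positivity) (by positivity)]
          linarith
      _ = _ := by ring
  have hcoef0 : 0 ≤ 108 * ((p - 1) / (p - 2)) / ε' ^ 2 * (M ^ 4 / (lam - Wbar)) := by
    positivity
  have h1 : (2 + 3 * (m : ℝ)) * (L * M ^ 2) ≤ (2 + 3 * m) * ε' := by gcongr
  have h2 : 3 * (9 / 4 * ((p - 1) / (p - 2)) / ((lam - Wbar) * L ^ 2)) *
      ∫ x in (0 : ℝ)..R, u e x ^ 2 ≤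
      108 * ((p - 1) / (p - 2)) / ε' ^ 2 * (M ^ 4 / (lam - Wbar)) * c :=
    mul_le_mul hcoef hRc (intervalIntegral.integral_nonneg hR0.le fun x _ => sq_nonneg _) hcoef0
  linarith

/-- Part (a) makes lam of order M^(p-2) at least, so M⁴ / (lam - Wbar) is at most of order M^(6-p).
Part (b) then leaves every edge with a small share of the mass. -/
theorem exists_lam_bound_of_six_lt [Fintype E] (G : MetricGraph V E) {p Wbar a b c : ℝ}
    (hp6 : 6 < p) (hW : 0 ≤ Wbar) (ha : 0 < a) (hb : 0 < b) (hc : 0 < c) (m : ℕ) :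
    ∃ Λ, ∀ (W ρ u : E → ℝ → ℝ) (lam : ℝ), G.CoefficientBounds W ρ Wbar b →
      G.WeightDichotomy ρ a → G.IsSolution p W ρ lam u →
      (G.integral fun e x => |u e x| ^ 2) = c → G.morseIndex p W ρ lam u ≤ m → lam ≤ Λ := by
  have hp : 2 < p := by linarith
  obtain ⟨R₀, hR₀, hR₀l⟩ := G.exists_pos_le_length
  obtain ⟨T, hT, δ₀, hδ₀, hsup⟩ := exists_sup_bound hp ha hb.le m
  set k : ℝ := ((Fintype.card E : ℕ) : ℝ) with hk
  rcases (show (0 : ℝ) ≤ k by positivity).eq_or_lt with hk0 | hk0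
  · refine ⟨0, fun W ρ u lam _ _ _ hmass _ => ?_⟩
    have hE : IsEmpty E := Fintype.card_eq_zero_iff.1 (by rw [hk] at hk0; exact_mod_cast hk0.symm)
    simp [MetricGraph.integral] at hmass
    linarith
  -- Each of the three error terms is to be at most c / (4k) on each of the k edges, so that the
  -- total mass is at most 3c/4; K is the value that achieves this for the third term.
  set ε := c / (4 * k) with hε
  set ε' := c / (4 * k * (2 + 3 * m)) with hε'
  have hε0 : 0 < ε := by positivity
  have hε'0 : 0 < ε' := by positivity
  set K := 108 * ((p - 1) / (p - 2)) / ε' ^ 2 * (4 * k) with hK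
  have hP : 0 < (p - 1) / (p - 2) := div_pos (by linarith) (by linarith)
  have hK0 : 0 < K := by positivity
  obtain ⟨M₁, hM₁, h₁⟩ := exists_forall_mul_rpow_neg_le (q := (p - 2) / 2) (K := T) (R := R₀ / 2)
    (by linarith) (by positivity)
  obtain ⟨M₂, hM₂, h₂⟩ := exists_forall_ge_of_tendsto
    (tendsto_rpow_atTop (show 0 < p - 2 - 4 by linarith)) ((K + 2 * Wbar) / δ₀)
  obtain ⟨M₃, hM₃, h₃⟩ := exists_forall_ge_of_tendsto
    (Filter.tendsto_pow_atTop (α := ℝ) (n := 2) (by norm_num)) (ε' / R₀)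
  set M₀ := max (max M₁ M₂) (max M₃ 1) with hM₀
  refine ⟨Wbar + b * M₀ ^ (p - 2), ?_⟩
  intro W ρ u lam hWρ hdich hu hmass hmorse
  by_contra! hlamM
  have hM₀0 : 0 < M₀ := lt_max_of_lt_left (lt_max_of_lt_left hM₁)
  have hlam : Wbar < lam := by
    have : 0 ≤ b * M₀ ^ (p - 2) := by positivity
    linarith
  obtain ⟨d, hd⟩ := hu.exists_isClassicalDeriv hp hWρ.memLInfty_W hWρ.memLInfty_ρ
  have hR₀l' : ∀ e, ENNReal.ofReal (2 * (R₀ / 2)) ≤ G.length e := fun e => by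
    rw [show 2 * (R₀ / 2) = R₀ by ring]; exact hR₀l e
  obtain ⟨e, x₀, σ, τ, -, -, hx₀, -, hmax, hpos, hMlow, -, -⟩ :=
    hu.exists_maximal_branch hp hWρ hd (R := R₀ / 2) (by rw [hmass]; exact hc) hlam
      (by positivity) hR₀l'
  set M := |u e x₀| with hM
  have hMM := lt_of_sub_le_mul_rpow hp hb.le hpos.le hMlow hlamM
  have g₁ := h₁ M (((le_max_left _ _).trans (le_max_left _ _)).trans hMM)
  have g₂ := h₂ M (((le_max_right _ _).trans (le_max_left _ _)).trans hMM)
  have g₃ := h₃ M (((le_max_left _ _).trans (le_max_right _ _)).trans hMM)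
  have g₄ : 1 ≤ M := ((le_max_right _ _).trans (le_max_right _ _)).trans hMM
  have hs := hsup V E _ G W ρ u d lam Wbar M (R₀ / 2) hWρ hdich hu hd (by rw [hmass]; exact hc)
    hlam (by positivity) hR₀l' hmax ⟨e, x₀, hx₀, rfl⟩ hmorse g₁
  rw [abs_of_nonneg (by linarith)] at hs
  have hM4 : 1 ≤ M ^ 4 := one_le_pow₀ g₄
  -- Here p > 6 enters: δ₀ M^(p-6) ≥ K + 2 Wbar and δ₀ M^(p-2) ≤ Wbar + lam. The 2 Wbar, multiplied
  -- by M⁴ ≥ 1, turns Wbar + lam into lam - Wbar.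
  have hKM : K * M ^ 4 ≤ lam - Wbar := by
    have h5 : M ^ (p - 2) = M ^ (p - 2 - 4) * M ^ 4 := by
      rw [← Real.rpow_natCast M 4, ← Real.rpow_add hpos]; norm_num
    rw [div_le_iff₀ hδ₀] at g₂
    have h6 : (K + 2 * Wbar) * M ^ 4 ≤ δ₀ * M ^ (p - 2) := by
      rw [h5]
      calc (K + 2 * Wbar) * M ^ 4 ≤ M ^ (p - 2 - 4) * δ₀ * M ^ 4 := by gcongr
        _ = _ := by ring
    nlinarith
  have hRM : ε' ≤ R₀ * M ^ 2 := by
    rw [div_le_iff₀ hR₀] at g₃; linarith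
  have hl : 0 < lam - Wbar := by linarith
  have hedge := hu.integral_sq_le_of_sup_le (ε' := ε') (ε := ε) hp hWρ hlam hpos hε'0 hε0 hR₀l hRM
    hmax hmorse hmass
  have hthird : 108 * ((p - 1) / (p - 2)) / ε' ^ 2 * (M ^ 4 / (lam - Wbar)) * c ≤ c / (4 * k) := by
    have h7 : M ^ 4 / (lam - Wbar) ≤ 1 / K := by
      rw [div_le_div_iff₀ hl hK0]; linarith
    calc 108 * ((p - 1) / (p - 2)) / ε' ^ 2 * (M ^ 4 / (lam - Wbar)) * c
        ≤ 108 * ((p - 1) / (p - 2)) / ε' ^ 2 * (1 / K) * c := by gcongr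
      _ = c / (4 * k) := by
        have : (p - 1) / (p - 2) ≠ 0 := hP.ne'
        rw [hK]
        generalize (p - 1) / (p - 2) = P at this
        field_simp
  have hfirst : (2 + 3 * (m : ℝ)) * ε' = c / (4 * k) := by
    rw [hε']; field_simp
  have hsum : c ≤ k * (3 * (c / (4 * k))) := by
    have : (G.integral fun e x => |u e x| ^ 2) ≤ ∑ _e : E, 3 * (c / (4 * k)) := by
      simp only [MetricGraph.integral, sq_abs]
      refine Finset.sum_le_sum fun e _ => (hedge e).trans ?_
      linarith
    rw [hmass] at this
    simpa using this
  have : k * (3 * (c / (4 * k))) = 3 / 4 * c := by field_simp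
  linarith

end MetricGraph

end

theorem corollary1p2 {V E : Type*} [Fintype V] [Fintype E] (G : MetricGraph V E)
    (hG : G.IsConnected) (p : ℝ) (hp : 2 < p) (hp6 : p ≠ 6)
    (W ρ : ℕ → E → ℝ → ℝ) (hH : G.AssumptionH W ρ)
    (lam : ℕ → ℝ) (u : ℕ → E → ℝ → ℝ)
    (hu : ∀ n, G.IsSolution p (W n) (ρ n) (lam n) (u n))
    (c : ℝ) (hc : 0 < c) (hmass : ∀ n, G.integral (fun e x => |u n e x| ^ 2) = c)
    (mstar : ℕ) (hmstar : 0 < mstar)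
    (hmorse : ∀ n, G.morseIndex p (W n) (ρ n) (lam n) (u n) ≤ mstar) :
    BddAbove (Set.range lam) := by
  obtain ⟨hWL, hρL, ⟨Wbar, hWbar⟩, b, hb, hρb, a, ha, -, hdich⟩ := hH
  -- Replacing Wbar by its positive part keeps the bound and makes it nonnegative, as the two
  -- estimates require.
  have hbounds : ∀ n, G.CoefficientBounds (W n) (ρ n) (max Wbar 0) b := fun n =>
    ⟨hWL n, hρL n, fun e => (hWbar n e).mono fun x hx => hx.trans (le_max_left _ _), hρb n⟩
  have hdich' : ∀ n, G.WeightDichotomy (ρ n) a := fun n e =>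
    (hdich e).imp (fun h => h n) fun h => h n
  rcases lt_or_gt_of_ne hp6 with h6 | h6
  · obtain ⟨Λ, hΛ⟩ := G.exists_lam_bound_of_lt_six hp h6 (le_max_right Wbar 0) hb hc
    exact ⟨Λ, forall_mem_range.2 fun n => hΛ _ _ _ _ (hbounds n) (hu n) (hmass n)⟩
  · obtain ⟨Λ, hΛ⟩ := G.exists_lam_bound_of_six_lt h6 (le_max_right Wbar 0) ha hb hc mstar
    exact ⟨Λ, forall_mem_range.2 fun n =>
      hΛ _ _ _ _ (hbounds n) (hdich' n) (hu n) (hmass n) (hmorse n)⟩
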